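/- **Setting.** Let $q_o>0$, $\theta_\pm\in\mathbb R$, and let $\mathbf q(x,t)\in\mathbb C^3$ be a classical ($C^2$) solution of $i\mathbf q_t+\mathbf q_{xx}-2(\|\mathbf q\|^2-q_o^2)\mathbf q=0$ on $\mathbb R^2$ with $\mathbf q\to\mathbf q_\pm=(0,0,q_\pm)^T$, $q_\pm=q_oe^{i\theta_\pm}$, and $\mathbf q_x\to0$ as $x\to\pm\infty$, locally uniformly in $t$, and $\mathbf q(\cdot,t)-\mathbf q_\pm\in L^1(\mathbb R^\pm)$ for every $t$. Put $$k=\tfrac12\Big(z+\frac{q_o^2}{z}\Big),\quad \lambda=\tfrac12\Big(z-\frac{q_o^2}{z}\Big),\quad \gamma(z)=1-\frac{q_o^2}{z^2},\quad J=\mathrm{diag}(1,-1,-1,-1),\quad Q=\begin{pmatrix}0&\mathbf q^\dagger\\ \mathbf q&0\end{pmatrix},$$ $$X=-ikJ+Q,\qquad T=2ik^2J-iJ(Q_x-Q^2+q_o^2)-2kQ,\qquad E_\pm(z)=I-\tfrac iz\,J\,Q_\pm,$$ $$\Theta=\mathrm{diag}(\theta_1,\theta_2,\theta_2,-\theta_1),\qquad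 \theta_1=-\lambda x+2k\lambda t,\qquad \theta_2=kx-(k^2+\lambda^2)t .$$ For $z\in\mathbb R\setminus\{0,\pm q_o\}$ let $\phi_\pm(x,t,z)$ be the Jost eigenfunctions: the $4\times4$ matrix solutions of $\phi_x=X\phi$, $\phi_t=T\phi$ with $\phi_\pm=E_\pm e^{i\Theta}+o(1)$ as $x\to\pm\infty$. Let $A(z)=(a_{ij})$ be the scattering matrix, $\phi_-=\phi_+A$, and $B=A^{-1}=(b_{ij})$. Denote by $A_{\binom{i_1,\dots,i_p}{j_1,\dots,j_p}}$ the minor with rows $i_1,\dots,i_p$ and columns $j_1,\dots,j_p$, and by $A_{[i_1,\dots,i_p]}$ the principal minor with these rows and columns; likewise for $B$. For $z\in\mathbb R\setminus\{0,\pm q_o\}$ let $$\chi_2^+=a_{11}\phi_{-,2}-a_{12}\phi_{-,1},\qquad \chi_3^+=A_{\binom{1,2}{2,3}}\phi_{-,1}-A_{\binom{1,2}{1,3}}\phi_{-,2}+A_{[1,2]}\phi_{-,3},$$ $$\chi_2^-=b_{11}\phi_{+,2}-b_{12}\phi_{+,1},\qquad \chi_3^-=B_{\binom{1,2}{2,3}}\phi_{+,1}-B_{\binom{1,2}{1,3}}\phi_{+,2}+B_{[1,2]}\phi_{+,3}.$$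 The functions $\phi_{-,1},\phi_{+,4},\chi_2^+,\chi_3^+,A_{[1]},A_{[1,2]},A_{[1,2,3]},A_{\binom{1,3}{1,2}}$ are extended analytically to $\mathrm{Im}\,z>0$, and $\phi_{+,1},\phi_{-,4},\chi_2^-,\chi_3^-,A_{[4]},A_{[3,4]},A_{[2,3,4]},A_{\binom{2,4}{3,4}}$ to $\mathrm{Im}\,z<0$, continuously up to $\mathbb R\setminus\{0,\pm q_o\}$. Let $M=M^+$ for $\mathrm{Im}\,z>0$ and $M=M^-$ for $\mathrm{Im}\,z<0$, where $$M^+=\Big(\frac{\phi_{-,1}}{A_{[1]}},\ \frac1{A_{[1,2]}}\Big(\chi_2^+-\frac{A_{\binom{1,3}{1,2}}}{A_{[1,2,3]}}\chi_3^+\Big),\ \frac{\chi_3^+}{A_{[1,2,3]}},\ \phi_{+,4}\Big)e^{-i\Theta},$$ $$M^-=\Big(\phi_{+,1},\ \frac{\chi_2^-}{A_{[2,3,4]}},\ \frac1{A_{[3,4]}}\Big(\chi_3^--\frac{A_{\binom{2,4}{3,4}}}{A_{[2,3,4]}}\chi_2^-\Big),\ \frac{\phi_{-,4}}{A_{[4]}}\Big)e^{-i\Theta}.$$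 For real $z$ let $\hat z=q_o^2/z$, $\rho_1=a_{21}/a_{11}$, $\rho_2=a_{31}/a_{11}$, $\rho_3=a_{41}/a_{11}$, $\bar\rho_1=b_{12}/b_{11}$, $\bar\rho_2=b_{13}/b_{11}$, and $$a(z)=\frac{A_{\binom{1,4}{1,2}}(z)}{A_{[1,2]}(z)}-\frac{z}{iq_+^*}\,\bar\rho_2(\hat z)\,\frac{A_{\binom{1,3}{1,2}}(z)}{A_{[1,2]}(z)},\qquad b(z)=\frac{B_{\binom{1,2}{2,3}}(z)}{B_{[1,2]}(z)}-\bar\rho_1(z)\frac{B_{\binom{1,2}{1,3}}(z)}{B_{[1,2]}(z)}.$$ Write $\rho_j=\rho_j(z)$, $\hat\rho_j=\rho_j(\hat z)$, $\gamma=\gamma(z)$, $c=iq_+^*/z$, $p=q_+^*/q_+$, and define $L(z)=(L_{ij}(z))$ by $$L_{11}=\frac{|\rho_1|^2}{\gamma}+b\,(\rho_2+c\hat\rho_2\rho_3)-p\,\rho_3\hat\rho_3+\frac c\gamma\rho_1^*\hat\rho_1\rho_3,\qquad L_{12}=\frac{\rho_1^*}{\gamma}-a\Big(p\hat\rho_3-\frac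 c\gamma\rho_1^*\hat\rho_1-bc\hat\rho_2\Big),$$ $$L_{13}=b+\frac{iq_+}{z\gamma}\hat\rho_2^*\Big(p\hat\rho_3-\frac c\gamma\rho_1^*\hat\rho_1-cb\hat\rho_2\Big),\qquad L_{14}=-p\hat\rho_3+\frac c\gamma\rho_1^*\hat\rho_1+cb\hat\rho_2,$$ $$L_{21}=-\rho_1-c\hat\rho_1\rho_3,\quad L_{22}=-ca\hat\rho_1,\quad L_{23}=-\frac{q_o^2}{z^2\gamma}\hat\rho_1\hat\rho_2^*,\quad L_{24}=-c\hat\rho_1,$$ $$L_{31}=-\rho_2-c\hat\rho_2\rho_3,\quad L_{32}=-ca\hat\rho_2,\quad L_{33}=-\frac{q_o^2}{z^2\gamma}|\hat\rho_2|^2,\quad L_{34}=-c\hat\rho_2,$$ $$L_{41}=-\rho_3,\quad L_{42}=-a,\quad L_{43}=\frac{iq_+}{z\gamma}\hat\rho_2^*,\quad L_{44}=0 .$$ **Lemma.** $M(x,t,\cdot)$ is meromorphic off the real axis. At every $z\in\mathbb R\setminus\{0,\pm q_o\}$ at which $A_{[1]},A_{[1,2]},A_{[1,2,3]}$ do not vanish,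 the boundary values $M^\pm(x,t,z)$ of $M$ from $\mathrm{Im}\,z\gtrless0$ exist for all $x,t\in\mathbb R$ and satisfy $$M^+(x,t,z)=M^-(x,t,z)\,\big[I-e^{i\Theta(x,t,z)}L(z)e^{-i\Theta(x,t,z)}\big].$$ If $\rho_1,\rho_2,\rho_3$ vanish identically on $\mathbb R\setminus\{0,\pm q_o\}$ (the reflectionless case), then $L(z)=0$ at every $z\in\mathbb R\setminus\{0,\pm q_o\}$ at which $A_{[1]},A_{[1,2]},A_{[1,2,3]}$ do not vanish. -/

import Mathlib

open Filter Topology Matrix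

noncomputable section

namespace VNLS

/-- `4 × 4` complex matrices. -/
abbrev Mat := Matrix (Fin 4) (Fin 4) ℂ

/-! ### The equation and its boundary conditions -/

/-- The background vector `(0, 0, qₒ e^{iθ})`. -/
def background (qo θ : ℝ) : Fin 3 → ℂ :=
  ![0, 0, (qo : ℂ) * Complex.exp (Complex.I * (θ : ℂ))]

/-- `q(x,t)` is a classical solution of the defocusing three-component vector NLS equation
`i q_t + q_xx - 2 (‖q‖² - qₒ²) q = 0` with the nonzero boundary conditions
`q → q_± = (0, 0, qₒ e^{iθ_±})` as `x → ±∞`. The boundary conditions are attained together with the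
first `x`-derivative, locally uniformly in time, and `q(·,t) - q_±` is absolutely integrable
on the corresponding half-line. -/
structure IsSolution (qo θm θp : ℝ) (q : ℝ → ℝ → Fin 3 → ℂ) : Prop where
  smooth : ContDiff ℝ 2 (fun p : ℝ × ℝ => q p.1 p.2)
  eqn : ∀ (x t : ℝ) (j : Fin 3),
    Complex.I * deriv (fun s => q x s j) t + deriv (deriv (fun y => q y t j)) x
      - 2 * (((∑ l, ‖q x t l‖ ^ 2) - qo ^ 2 : ℝ) : ℂ) * q x t j = 0
  integrable_left : ∀ t, MeasureTheory.IntegrableOn (fun x => q x t - background qo θm) (Set.Iic 0)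
  integrable_right : ∀ t, MeasureTheory.IntegrableOn (fun x => q x t - background qo θp) (Set.Ici 0)
  tendsto_left : TendstoLocallyUniformly (fun x t => q x t) (fun _ => background qo θm) atBot
  tendsto_right : TendstoLocallyUniformly (fun x t => q x t) (fun _ => background qo θp) atTop
  deriv_left : TendstoLocallyUniformly (fun x t => deriv (fun y => q y t) x) (fun _ => 0) atBot
  deriv_right : TendstoLocallyUniformly (fun x t => deriv (fun y => q y t) x) (fun _ => 0) atTop

/-! ### The Lax pair in the uniformization variable `z = k + λ` -/

/-- `k = (z + qₒ²/z)/2`. -/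
def kk (qo : ℝ) (z : ℂ) : ℂ := (z + (qo : ℂ) ^ 2 / z) / 2

/-- `λ = (z - qₒ²/z)/2`. -/
def lam (qo : ℝ) (z : ℂ) : ℂ := (z - (qo : ℂ) ^ 2 / z) / 2

/-- `γ = 1 - qₒ²/z²`. -/
def gam (qo : ℝ) (z : ℂ) : ℂ := 1 - (qo : ℂ) ^ 2 / z ^ 2

/-- `J = diag(1, -1, -1, -1)`. -/
def J : Mat := diagonal ![1, -1, -1, -1]

/-- `Q = [[0, q†], [q, 0]]`. -/
def Q (v : Fin 3 → ℂ) : Mat :=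
  !![0, star (v 0), star (v 1), star (v 2);
     v 0, 0, 0, 0;
     v 1, 0, 0, 0;
     v 2, 0, 0, 0]

/-- `X = -ikJ + Q`. -/
def laxX (qo : ℝ) (q : ℝ → ℝ → Fin 3 → ℂ) (z : ℂ) (x t : ℝ) : Mat :=
  (-(Complex.I * kk qo z)) • J + Q (q x t)

/-- `T = 2ik²J - iJ(Q_x - Q² + qₒ²) - 2kQ`. -/
def laxT (qo : ℝ) (q : ℝ → ℝ → Fin 3 → ℂ) (z : ℂ) (x t : ℝ) : Mat :=
  (2 * Complex.I * kk qo z ^ 2) • J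
    - Complex.I • (J * (Q (deriv (fun y => q y t) x) - Q (q x t) ^ 2 + ((qo : ℂ) ^ 2) • (1 : Mat)))
    - (2 * kk qo z) • Q (q x t)

/-- The phases `Θ = diag(θ₁, θ₂, θ₂, -θ₁)`, where `θ₁ = -λx + 2kλt` and `θ₂ = kx - (k² + λ²)t`. -/
def phase (qo : ℝ) (x t : ℝ) (z : ℂ) : Fin 4 → ℂ :=
  let θ₁ := -(lam qo z * x) + 2 * kk qo z * lam qo z * t
  let θ₂ := kk qo z * x - (kk qo z ^ 2 + lam qo z ^ 2) * t
  ![θ₁, θ₂, θ₂, -θ₁]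

/-- The diagonal matrix `e^{cΘ(x,t,z)}`. -/
def expPhase (qo : ℝ) (c : ℂ) (x t : ℝ) (z : ℂ) : Mat :=
  diagonal fun j => Complex.exp (c * phase qo x t z j)

/-- `E_± = I - (i/z) J Q_±`, the eigenvector matrix of the asymptotic Lax pair. -/
def eigE (qo θ : ℝ) (z : ℂ) : Mat := 1 - (Complex.I / z) • (J * Q (background qo θ))

/-! ### Jost eigenfunctions and scattering data on the real axis -/

/-- `Φ` is a simultaneous (matrix) solution of both parts of the Lax pair with
`Φ = E e^{iΘ} + o(1)` as `x → ±∞` (the filter `l` is `atBot` or `atTop`). -/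
def IsJost (qo : ℝ) (q : ℝ → ℝ → Fin 3 → ℂ) (θ : ℝ) (l : Filter ℝ) (z : ℝ) (Φ : ℝ → ℝ → Mat) :
    Prop :=
  (∀ x t i j, HasDerivAt (fun y => Φ y t i j) ((laxX qo q z x t * Φ x t) i j) x) ∧
  (∀ x t i j, HasDerivAt (fun s => Φ x s i j) ((laxT qo q z x t * Φ x t) i j) t) ∧
  (∀ t, Tendsto (fun x => Φ x t - eigE qo θ z * expPhase qo Complex.I x t z) l (𝓝 0))

/-- The Jost eigenfunctions, as functions of `z`, `x`, `t`. Away from `z = 0, ±qₒ` the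
defining conditions have at most one solution. -/
def jost (qo : ℝ) (q : ℝ → ℝ → Fin 3 → ℂ) (θ : ℝ) (l : Filter ℝ) (z : ℝ) : ℝ → ℝ → Mat :=
  Classical.epsilon (IsJost qo q θ l z)

/-- A potential together with its asymptotic amplitude and phases. -/
structure Data where
  qo : ℝ
  θm : ℝ
  θp : ℝ
  q : ℝ → ℝ → Fin 3 → ℂ

namespace Data

variable (d : Data)

/-- `q` solves the vector NLS equation with nonzero boundary conditions of amplitude `qₒ > 0`. -/
def Valid : Prop := 0 < d.qo ∧ IsSolution d.qo d.θm d.θp d.q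

/-- The scalar `q_+ = qₒ e^{iθ_+}`. -/
def qp : ℂ := (d.qo : ℂ) * Complex.exp (Complex.I * (d.θp : ℂ))

/-- The real axis without the origin and the branch points `±qₒ`. -/
def Regular (s : ℝ) : Prop := s ≠ 0 ∧ s ≠ d.qo ∧ s ≠ -d.qo

/-- The involution `s ↦ qₒ²/s` (for real `s` it is both `ŝ` and `ŝ*`). -/
def hat (s : ℝ) : ℝ := d.qo ^ 2 / s

/-- `φ_-(x,t,s)`. -/
def phiMinus (x t s : ℝ) : Mat := jost d.qo d.q d.θm atBot s x t

/-- `φ_+(x,t,s)`. -/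
def phiPlus (x t s : ℝ) : Mat := jost d.qo d.q d.θp atTop s x t

/-- The scattering matrix of `φ_- = φ_+ A`, computed at `(x,t) = (0,0)`. -/
def scatA (s : ℝ) : Mat := (d.phiPlus 0 0 s)⁻¹ * d.phiMinus 0 0 s

/-- `B = A⁻¹`. -/
def scatB (s : ℝ) : Mat := (d.scatA s)⁻¹

end Data

/-- The minor of `N` with rows `r` and columns `c`, numbered from `0`. -/
def minor (N : Mat) {n : ℕ} (r c : Fin n → Fin 4) : ℂ := (N.submatrix r c).det

/-- The second column of `φ α D`, where `N α` is lower triangular, `α` is unit upper triangular and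
`D` is the diagonal matrix of the leading principal minors of `N` of orders `0, 1, 2, 3`:
`n₁₁ φ₂ - n₁₂ φ₁`. -/
def aux2 (φ N : Mat) : Fin 4 → ℂ := N 0 0 • φ.col 1 - N 0 1 • φ.col 0

/-- The third column of `φ α D`, with `α` and `D` as for `aux2`. -/
def aux3 (φ N : Mat) : Fin 4 → ℂ :=
  minor N ![0, 1] ![1, 2] • φ.col 0 - minor N ![0, 1] ![0, 2] • φ.col 1
    + minor N ![0, 1] ![0, 1] • φ.col 2

/-! ### Analytic continuation off the real axis -/

/-- The open upper half-plane. -/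
def upper : Set ℂ := {z | 0 < z.im}

/-- The open lower half-plane. -/
def lower : Set ℂ := {z | z.im < 0}

/-- `F` is analytic in the open half-plane `H` and has the boundary values `f` on the real axis
without `0, ±qₒ`. -/
def IsExtension (d : Data) (H : Set ℂ) {V : Type} [NormedAddCommGroup V] [NormedSpace ℂ V]
    (f : ℝ → V) (F : ℂ → V) : Prop :=
  DifferentiableOn ℂ F H ∧ ∀ s : ℝ, d.Regular s → Tendsto F (𝓝[H] (s : ℂ)) (𝓝 (f s))

/-- The analytic extension of `f` to the half-plane `H` (there is at most one on `H`). -/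
def ext (d : Data) (H : Set ℂ) {V : Type} [NormedAddCommGroup V] [NormedSpace ℂ V]
    (f : ℝ → V) : ℂ → V :=
  Classical.epsilon (IsExtension d H f)

namespace Data

variable (d : Data)

/-- The minor of the scattering matrix with rows `r` and columns `c` (numbered from `0`),
extended to the half-plane `H`. -/
def minorExt (H : Set ℂ) {n : ℕ} (r c : Fin n → Fin 4) : ℂ → ℂ :=
  ext d H fun s => minor (d.scatA s) r c

/-- `φ_{-,1}` for `Im z > 0`. -/
def phiMinus1 (x t : ℝ) : ℂ → Fin 4 → ℂ := ext d upper fun s => (d.phiMinus x t s).col 0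

/-- `φ_{+,4}` for `Im z > 0`. -/
def phiPlus4 (x t : ℝ) : ℂ → Fin 4 → ℂ := ext d upper fun s => (d.phiPlus x t s).col 3

/-- `φ_{+,1}` for `Im z < 0`. -/
def phiPlus1 (x t : ℝ) : ℂ → Fin 4 → ℂ := ext d lower fun s => (d.phiPlus x t s).col 0

/-- `φ_{-,4}` for `Im z < 0`. -/
def phiMinus4 (x t : ℝ) : ℂ → Fin 4 → ℂ := ext d lower fun s => (d.phiMinus x t s).col 3

/-- The auxiliary analytic eigenfunction `χ₂⁺` for `Im z > 0`. -/
def chi2Plus (x t : ℝ) : ℂ → Fin 4 → ℂ :=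
  ext d upper fun s => aux2 (d.phiMinus x t s) (d.scatA s)

/-- The auxiliary analytic eigenfunction `χ₃⁺` for `Im z > 0`. -/
def chi3Plus (x t : ℝ) : ℂ → Fin 4 → ℂ :=
  ext d upper fun s => aux3 (d.phiMinus x t s) (d.scatA s)

/-- The auxiliary analytic eigenfunction `χ₂⁻` for `Im z < 0`. -/
def chi2Minus (x t : ℝ) : ℂ → Fin 4 → ℂ :=
  ext d lower fun s => aux2 (d.phiPlus x t s) (d.scatB s)

/-- The auxiliary analytic eigenfunction `χ₃⁻` for `Im z < 0`. -/
def chi3Minus (x t : ℝ) : ℂ → Fin 4 → ℂ :=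
  ext d lower fun s => aux3 (d.phiPlus x t s) (d.scatB s)

/-! ### The sectionally meromorphic matrix -/

/-- `M⁺`, for `Im z > 0`. -/
def MPlus (x t : ℝ) (z : ℂ) : Mat :=
  let A1 := d.minorExt upper ![0] ![0] z
  let A12 := d.minorExt upper ![0, 1] ![0, 1] z
  let A123 := d.minorExt upper ![0, 1, 2] ![0, 1, 2] z
  let A13_12 := d.minorExt upper ![0, 2] ![0, 1] z
  (Matrix.of
    ![A1⁻¹ • d.phiMinus1 x t z,
      A12⁻¹ • (d.chi2Plus x t z - (A13_12 / A123) • d.chi3Plus x t z),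
      A123⁻¹ • d.chi3Plus x t z,
      d.phiPlus4 x t z])ᵀ * expPhase d.qo (-Complex.I) x t z

/-- `M⁻`, for `Im z < 0`. -/
def MMinus (x t : ℝ) (z : ℂ) : Mat :=
  let A4 := d.minorExt lower ![3] ![3] z
  let A34 := d.minorExt lower ![2, 3] ![2, 3] z
  let A234 := d.minorExt lower ![1, 2, 3] ![1, 2, 3] z
  let A24_34 := d.minorExt lower ![1, 3] ![2, 3] z
  (Matrix.of
    ![d.phiPlus1 x t z,
      A234⁻¹ • d.chi2Minus x t z,
      A34⁻¹ • (d.chi3Minus x t z - (A24_34 / A234) • d.chi2Minus x t z),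
      A4⁻¹ • d.phiMinus4 x t z])ᵀ * expPhase d.qo (-Complex.I) x t z

open Classical in
/-- The sectionally meromorphic matrix `M`: it is `M⁺` for `Im z > 0` and `M⁻` for `Im z < 0`
(its value on the real axis is irrelevant). -/
def M (x t : ℝ) (z : ℂ) : Mat := if 0 < z.im then d.MPlus x t z else d.MMinus x t z

/-! ### The jump matrix -/

/-- `ρ₁ = a₂₁/a₁₁`. -/
def rho1 (s : ℝ) : ℂ := d.scatA s 1 0 / d.scatA s 0 0

/-- `ρ₂ = a₃₁/a₁₁`. -/
def rho2 (s : ℝ) : ℂ := d.scatA s 2 0 / d.scatA s 0 0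

/-- `ρ₃ = a₄₁/a₁₁`. -/
def rho3 (s : ℝ) : ℂ := d.scatA s 3 0 / d.scatA s 0 0

/-- `ρ̄₁ = b₁₂/b₁₁`. -/
def rhoBar1 (s : ℝ) : ℂ := d.scatB s 0 1 / d.scatB s 0 0

/-- `ρ̄₂ = b₁₃/b₁₁`. -/
def rhoBar2 (s : ℝ) : ℂ := d.scatB s 0 2 / d.scatB s 0 0

/-- The auxiliary function `a`. -/
def a (s : ℝ) : ℂ :=
  minor (d.scatA s) ![0, 3] ![0, 1] / minor (d.scatA s) ![0, 1] ![0, 1]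
    - s / (Complex.I * star d.qp) * d.rhoBar2 (d.hat s)
      * (minor (d.scatA s) ![0, 2] ![0, 1] / minor (d.scatA s) ![0, 1] ![0, 1])

/-- The auxiliary function `b`. -/
def b (s : ℝ) : ℂ :=
  minor (d.scatB s) ![0, 1] ![1, 2] / minor (d.scatB s) ![0, 1] ![0, 1]
    - d.rhoBar1 s * (minor (d.scatB s) ![0, 1] ![0, 2] / minor (d.scatB s) ![0, 1] ![0, 1])

/-- The matrix `L`. -/
def L (s : ℝ) : Mat :=
  let γ := gam d.qo s
  let r1 := d.rho1 s
  let r2 := d.rho2 s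
  let r3 := d.rho3 s
  let h1 := d.rho1 (d.hat s)
  let h2 := d.rho2 (d.hat s)
  let h3 := d.rho3 (d.hat s)
  let c := Complex.I * star d.qp / s
  let e := Complex.I * d.qp / (s * γ)
  let p := star d.qp / d.qp
  let a := d.a s
  let b := d.b s
  !![((‖r1‖ ^ 2 : ℝ) : ℂ) / γ + b * (r2 + c * h2 * r3) - p * r3 * h3 + c / γ * star r1 * h1 * r3,
     star r1 / γ - a * (p * h3 - c / γ * star r1 * h1 - b * c * h2),
     b + e * star h2 * (p * h3 - c / γ * star r1 * h1 - c * b * h2),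
     -(p * h3) + c / γ * star r1 * h1 + c * b * h2;
     -r1 - c * h1 * r3,
     -(c * a * h1),
     -((d.qo : ℂ) ^ 2 / (s ^ 2 * γ) * h1 * star h2),
     -(c * h1);
     -r2 - c * h2 * r3,
     -(c * a * h2),
     -((d.qo : ℂ) ^ 2 / (s ^ 2 * γ) * ((‖h2‖ ^ 2 : ℝ) : ℂ)),
     -(c * h2);
     -r3,
     -a,
     e * star h2,
     0]

/-- No denominator of `M⁺` vanishes at the real point `s`. -/
def NonSingular (s : ℝ) : Prop :=
  minor (d.scatA s) ![0] ![0] ≠ 0 ∧ minor (d.scatA s) ![0, 1] ![0, 1] ≠ 0 ∧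
    minor (d.scatA s) ![0, 1, 2] ![0, 1, 2] ≠ 0

end Data

end VNLS

end

/-!
The proof has an analytic half, which constructs the Jost eigenfunctions and continues the entries
of `M` off the real axis, and an algebraic half, which is an identity for a `4 × 4` matrix of
determinant one that is unitary for an indefinite form and has one discrete symmetry.

*Jost solutions at a fixed time.* In the eigenbasis `E_±` of the asymptotic equation, each column
of the Jost solution normalized at `-∞` solves a Volterra equation with integrable kernel, and the
Neumann series (`volterraSol`) depends analytically on `z` wherever the exponentials of the kernel
stay bounded. For `Im z ≥ 0` this is the case for the first column, whose growth rate dominates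
the others (`abs_kk_im_le`). The other columns do not continue separately, but `φ₁ ∧ φ₂` and
`φ₁ ∧ φ₃` solve the antisymmetric square of the equation, where their rates are dominant again;
so the corresponding `2 × 2` minors continue (`wedge_leftJost`, `hasExt_jost_wedge`). Three
symmetries of the equation, namely the reversal of `x`, complex conjugation and `z ↦ qₒ²/z`, which
interchanges the first and the last column, carry this over to the last column, to the end `+∞`,
and to `Im z < 0` (`ExtCols`, `extCols_left`, `extCols_right` and their conjugates).

*Time dependence.* The vector NLS equation is the zero-curvature condition of the Lax pair
(`zeroCurvature`). Evolving a spatial Jost solution from `t = 0` by `y_t = T y` therefore preserves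
`y_x = X y` (`hasDerivAt_of_zeroCurvature`), and Grönwall's inequality preserves the asymptotics
at infinity, because `T` converges locally uniformly in `t` (`tendsto_sub_of_tendsto_coeff`); this
yields `exists_isJost`. At each fixed time the result is again a spatial Jost solution, up to the
scalar exponentials `e^{iΘ(0,t)}`, so the continuation holds at all times.

*Scattering data.* For real `z` the matrix `X` is anti-self-adjoint for the form `J`, so that
`φ† J φ` is constant, equal to `N = E_±† J E_±`. This gives uniqueness and an inverse of `φ`
whose entries are complex conjugates of those of `φ`; it also gives `A† N A = N`, and `det A = 1` by
Liouville's formula. With these inverses, `A = φ₊⁻¹ φ₋` turns the minors of `A` and the auxiliary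
eigenfunctions `χ` into polynomials in quantities which continue to the half-plane in question
(`hasExt_scat_entry`, `hasExt_scat_minor_two`, `hasExt_scat_minor_three`, `hasExt_aux2`,
`hasExt_aux3`). Minors of `A` that must continue to `Im z < 0` are first replaced by complementary
minors of `B = A⁻¹` through Jacobi's identity (`minor_eq_minor_inv`).

*The jump.* On the real axis `φ₋ = φ₊ A` gives `M⁺ e^{iΘ} = φ₊ U` and `M⁻ e^{iΘ} = φ₊ V` with
`U` unit lower triangular and `V` unit upper triangular (`plus_columns`, `minus_columns`). It remains to see that `U = V (1 - L)` (`Valid.jump_factors`).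
The entries of `V` involve the last column of `A`, which the symmetry `z ↦ qₒ²/z` expresses by the
first column at `qₒ²/z` (`Valid.scatA_hat_col`), and entries of `B`, which unitarity expresses by
entries of `A`; what is left is a polynomial identity (`jumpU_eq_jumpV_mul`). The hypothesis that
the denominators of `M⁺` do not vanish also covers those of `M⁻` (`Valid.denominators`).
In the reflectionless case the first column of `A` is a multiple of `e₁`; unitarity and the symmetry
then make `a`, `b` and all other entries of `L` vanish (`Valid.L_eq_zero`).
-/

noncomputable section

namespace VNLS

open MeasureTheory Set

/-! ### Volterra equations on a left half-line -/

section Volterra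

lemma hasDerivAt_integral_Iic {V : Type*} [NormedAddCommGroup V] [NormedSpace ℝ V]
    [CompleteSpace V] {f : ℝ → V} (hf : Continuous f)
    (hi : ∀ x, IntegrableOn f (Iic x)) (x : ℝ) :
    HasDerivAt (fun x => ∫ y in Iic x, f y) (f x) x := by
  have h : (fun x => ∫ y in Iic x, f y) = fun x => (∫ y in Iic 0, f y) + ∫ y in (0 : ℝ)..x, f y := by
    funext x
    rw [← intervalIntegral.integral_Iic_sub_Iic (hi 0) (hi x)]
    abel
  rw [h]
  exact (intervalIntegral.integral_hasDerivAt_right (hf.intervalIntegrable _ _)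
    (hf.stronglyMeasurableAtFilter _ _) hf.continuousAt).const_add _

/-- The kernel `e^{r(x-y)}` is bounded by `1` for `y ≤ x` as `Re r ≤ 0`. -/
lemma norm_exp_kernel_le {r : ℂ} (hr : r.re ≤ 0) {x y : ℝ} (h : y ≤ x) :
    ‖Complex.exp (r * (x - y))‖ ≤ 1 := by
  rw [Complex.norm_exp, Real.exp_le_one_iff]
  have : (r * ((x : ℂ) - y)).re = r.re * (x - y) := by simp
  rw [this]
  exact mul_nonpos_of_nonpos_of_nonneg hr (by linarith)

lemma integrableOn_kernel_mul {r : ℂ} (hr : r.re ≤ 0) {f : ℝ → ℂ} (hf : Continuous f) {x : ℝ}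
    (hi : IntegrableOn f (Iic x)) :
    IntegrableOn (fun y : ℝ => Complex.exp (r * (x - y)) * f y) (Iic x) := by
  refine Integrable.mono' hi.norm (by fun_prop) ?_
  filter_upwards [ae_restrict_mem measurableSet_Iic] with y hy
  rw [norm_mul]
  exact mul_le_of_le_one_left (norm_nonneg _) (norm_exp_kernel_le hr hy)

lemma hasDerivAt_kernel_integral {r : ℂ} (hr : r.re ≤ 0) {f : ℝ → ℂ} (hf : Continuous f)
    (hi : ∀ x, IntegrableOn f (Iic x)) (x : ℝ) :
    HasDerivAt (fun x : ℝ => ∫ y in Iic x, Complex.exp (r * (x - y)) * f y)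
      (r * (∫ y in Iic x, Complex.exp (r * (x - y)) * f y) + f x) x := by
  have key : ∀ x y : ℝ, Complex.exp (r * (x - y)) * f y =
      Complex.exp (r * x) * (Complex.exp (-(r * y)) * f y) := by
    intro x y
    rw [← mul_assoc, ← Complex.exp_add]
    ring_nf
  have hi' : ∀ x : ℝ, IntegrableOn (fun y : ℝ => Complex.exp (-(r * y)) * f y) (Iic x) := by
    intro x
    have h := (integrableOn_kernel_mul hr hf (hi x)).const_mul (Complex.exp (-(r * x)))
    refine h.congr (Eventually.of_forall fun y => ?_)
    simp only
    rw [← mul_assoc, ← Complex.exp_add]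
    ring_nf
  have h1 := hasDerivAt_integral_Iic (f := fun y : ℝ => Complex.exp (-(r * y)) * f y)
    (by fun_prop) hi' x
  have h2 : HasDerivAt (fun x : ℝ => Complex.exp (r * x)) (Complex.exp (r * x) * r) x := by
    have := ((hasDerivAt_id (x : ℂ)).const_mul r).cexp.comp_ofReal
    simpa using this
  have h3 := h2.mul h1
  simp only [key, integral_const_mul]
  refine h3.congr_deriv ?_
  simp only [← mul_assoc, ← Complex.exp_add]
  ring_nf
  simp

/-- The weight `e^{2∫p}` against which the Volterra operator contracts by a factor `1/2`. -/
lemma integral_mul_exp_weight {p : ℝ → ℝ} (hp : Continuous p) (hp0 : ∀ x, 0 ≤ p x)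
    (hi : ∀ x, IntegrableOn p (Iic x)) (x : ℝ) :
    IntegrableOn (fun y => p y * Real.exp (2 * ∫ u in Iic y, p u)) (Iic x) ∧
    ∫ y in Iic x, p y * Real.exp (2 * ∫ u in Iic y, p u)
      = (Real.exp (2 * ∫ u in Iic x, p u) - 1) / 2 := by
  have hd := hasDerivAt_integral_Iic hp hi
  have hc : Continuous fun x => ∫ u in Iic x, p u :=
    continuous_iff_continuousAt.2 fun x => (hd x).continuousAt
  have hlim : Tendsto (fun x => Real.exp (2 * ∫ u in Iic x, p u) / 2) atBot (𝓝 (1 / 2)) := by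
    have h := tendsto_integral_Iic_zero (μ := volume) (f := p)
      (tendsto_id (α := ℝ) (x := atBot))
    have := ((h.const_mul 2).rexp).div_const 2
    simpa using this
  have hint : IntegrableOn (fun y => p y * Real.exp (2 * ∫ u in Iic y, p u)) (Iic x) := by
    refine Integrable.mono' ((hi x).mul_const (Real.exp (2 * ∫ u in Iic x, p u)))
      (by fun_prop) ?_
    filter_upwards [ae_restrict_mem measurableSet_Iic] with y hy
    rw [Real.norm_of_nonneg (mul_nonneg (hp0 y) (Real.exp_pos _).le)]
    refine mul_le_mul_of_nonneg_left (Real.exp_le_exp.2 ?_) (hp0 y)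
    refine mul_le_mul_of_nonneg_left ?_ zero_le_two
    exact setIntegral_mono_set (hi x) (Eventually.of_forall hp0) (Iic_subset_Iic.2 hy).eventuallyLE
  refine ⟨hint, ?_⟩
  rw [integral_Iic_of_hasDerivAt_of_tendsto' (f := fun x => Real.exp (2 * ∫ u in Iic x, p u) / 2)
    (m := 1 / 2) ?_ hint hlim]
  · ring
  · intro y _
    refine ((((hd y).const_mul 2).exp).div_const 2).congr_deriv ?_
    ring

/-- Holomorphy of a parameter integral with an integrable majorant; the bound on the derivative
comes from the Cauchy estimate. -/
lemma differentiableOn_integral_of_dominated {X : Type*} [MeasurableSpace X] {μ : Measure X}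
    {U : Set ℂ} (hU : IsOpen U) {F : ℂ → X → ℂ} {g : X → ℝ} (hg : Integrable g μ)
    (hm : ∀ z ∈ U, AEStronglyMeasurable (F z) μ)
    (hb : ∀ᵐ y ∂μ, ∀ z ∈ U, ‖F z y‖ ≤ g y)
    (hd : ∀ y, DifferentiableOn ℂ (fun z => F z y) U) :
    DifferentiableOn ℂ (fun z => ∫ y, F z y ∂μ) U := by
  intro z0 hz0
  obtain ⟨ε, hε, hball⟩ := Metric.isOpen_iff.1 hU z0 hz0
  have hsub : ∀ z ∈ Metric.ball z0 (ε / 2), Metric.closedBall z (ε / 4) ⊆ U := by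
    intro z hz w hw
    apply hball
    rw [Metric.mem_ball] at hz ⊢
    rw [Metric.mem_closedBall] at hw
    linarith [dist_triangle w z z0]
  have hmem : ∀ z ∈ Metric.ball z0 (ε / 2), z ∈ U := fun z hz =>
    hsub z hz (Metric.mem_closedBall_self (by positivity))
  have hda : ∀ y, ∀ z ∈ Metric.ball z0 (ε / 2), DifferentiableAt ℂ (fun z => F z y) z := fun y z hz =>
    (hd y z (hmem z hz)).differentiableAt (hU.mem_nhds (hmem z hz))
  have hmeas : AEStronglyMeasurable (fun y => deriv (fun z => F z y) z0) μ := by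
    have hseq : Tendsto (fun n : ℕ => ((ε / 4 / (n + 1) : ℝ) : ℂ)) atTop (𝓝[≠] 0) := by
      refine tendsto_nhdsWithin_iff.2 ⟨?_, Eventually.of_forall fun n => ?_⟩
      · have := (tendsto_one_div_add_atTop_nhds_zero_nat (𝕜 := ℝ)).const_mul (ε / 4)
        have h2 := (Complex.continuous_ofReal.tendsto _).comp this
        simp only [mul_zero, Complex.ofReal_zero] at h2
        refine h2.congr fun n => ?_
        simp [div_eq_mul_inv]
      · have : (0 : ℝ) < ε / 4 / (n + 1) := by positivity
        simpa using Complex.ofReal_ne_zero.2 this.ne'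
    refine aestronglyMeasurable_of_tendsto_ae (u := atTop)
      (f := fun (n : ℕ) y => ((ε / 4 / (n + 1) : ℝ) : ℂ)⁻¹ •
        (F (z0 + ((ε / 4 / (n + 1) : ℝ) : ℂ)) y - F z0 y)) (fun n => ?_)
      (Eventually.of_forall fun y => ?_)
    · have h1 : z0 + ((ε / 4 / (n + 1) : ℝ) : ℂ) ∈ U := ?_
      · exact ((hm _ h1).sub (hm _ hz0)).const_smul (((ε / 4 / (n + 1) : ℝ) : ℂ)⁻¹)
      apply hsub z0 (Metric.mem_ball_self (by positivity))
      rw [Metric.mem_closedBall, dist_eq_norm, add_sub_cancel_left, Complex.norm_real,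
        Real.norm_of_nonneg (by positivity)]
      exact div_le_self (by positivity) (by linarith [(Nat.cast_nonneg n : (0 : ℝ) ≤ n)])
    · exact ((hda y z0 (Metric.mem_ball_self (by positivity))).hasDerivAt.tendsto_slope_zero).comp
        hseq
  have hder := hasDerivAt_integral_of_dominated_loc_of_deriv_le (μ := μ) (F := F)
    (F' := fun z y => deriv (fun z => F z y) z) (x₀ := z0) (s := Metric.ball z0 (ε / 2))
    (bound := fun y => g y / (ε / 4)) (Metric.ball_mem_nhds _ (by positivity)) ?_ ?_ hmeas ?_
    (hg.div_const _) ?_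
  · exact hder.2.differentiableAt.differentiableWithinAt
  · filter_upwards [Metric.ball_mem_nhds z0 (show 0 < ε / 2 by positivity)] with z hz
    exact hm z (hmem z hz)
  · exact Integrable.mono' hg (hm z0 hz0) (hb.mono fun y hy => hy z0 hz0)
  · filter_upwards [hb] with y hy z hz
    refine Complex.norm_deriv_le_of_forall_mem_sphere_norm_le (by positivity) ?_ ?_
    · exact ((hd y).mono ((closure_ball z (by positivity : ε / 4 ≠ 0)).symm ▸
        hsub z hz)).diffContOnCl
    · exact fun w hw => hy w (hsub z hz (Metric.sphere_subset_closedBall hw))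
  · exact Eventually.of_forall fun y z hz => (hda y z hz).hasDerivAt

end Volterra

end VNLS

namespace VNLS

open MeasureTheory Set

section Volterra

variable {ι : Type} [Fintype ι]

/-- The terms of the Neumann series of
`w_j(x) = v_j + ∫_{-∞}^x e^{r_j(z)(x-y)} (P(y,z) w(y))_j dy`. -/
def volterraIter (r : ι → ℂ → ℂ) (P : ℝ → ℂ → Matrix ι ι ℂ) (v : ι → ℂ) : ℕ → ℝ → ℂ → ι → ℂ
  | 0, _, _ => v
  | n + 1, x, z => fun j =>
      ∫ y in Iic x, Complex.exp (r j z * (x - y)) * (P y z *ᵥ volterraIter r P v n y z) j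

/-- The sum of the Neumann series: the solution of the Volterra equation. -/
def volterraSol (r : ι → ℂ → ℂ) (P : ℝ → ℂ → Matrix ι ι ℂ) (v : ι → ℂ) (x : ℝ) (z : ℂ) : ι → ℂ :=
  fun j => ∑' n, volterraIter r P v n x z j

/-- The hypotheses under which the Neumann series converges uniformly for `z ∈ S`: the exponential
kernels do not grow, and `P(x,z)` has an integrable majorant `p(x)` near `-∞`. -/
structure IsVolterra (r : ι → ℂ → ℂ) (P : ℝ → ℂ → Matrix ι ι ℂ) (S : Set ℂ) (p : ℝ → ℝ) :
    Prop where
  cont : Continuous p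
  nonneg : ∀ x, 0 ≤ p x
  integrable : ∀ x, IntegrableOn p (Iic x)
  re_nonpos : ∀ z ∈ S, ∀ j, (r j z).re ≤ 0
  bound : ∀ z ∈ S, ∀ x w, ‖P x z *ᵥ w‖ ≤ p x * ‖w‖
  cont_x : ∀ z ∈ S, ∀ i j, Continuous fun x => P x z i j

variable {r : ι → ℂ → ℂ} {P : ℝ → ℂ → Matrix ι ι ℂ} {S : Set ℂ} {p : ℝ → ℝ} {v : ι → ℂ}

/-- The weight `e^{2∫_{-∞}^x p}`. -/
def volterraWeight (p : ℝ → ℝ) (x : ℝ) : ℝ := Real.exp (2 * ∫ u in Iic x, p u)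

lemma volterraWeight_pos (p : ℝ → ℝ) (x : ℝ) : 0 < volterraWeight p x := Real.exp_pos _

lemma continuous_kernel_mul {r : ℂ} {f : ℝ → ℂ} (hf : Continuous f) (x : ℝ) :
    Continuous fun y : ℝ => Complex.exp (r * (x - y)) * f y := by
  fun_prop

namespace IsVolterra

lemma weight_mono (h : IsVolterra r P S p) {x y : ℝ} (hxy : x ≤ y) :
    volterraWeight p x ≤ volterraWeight p y := by
  refine Real.exp_le_exp.2 (mul_le_mul_of_nonneg_left ?_ zero_le_two)
  exact setIntegral_mono_set (h.integrable y) (Eventually.of_forall h.nonneg)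
    (Iic_subset_Iic.2 hxy).eventuallyLE

lemma continuous_forcing (h : IsVolterra r P S p) {z : ℂ} (hz : z ∈ S) {w : ℝ → ι → ℂ}
    (hw : ∀ j, Continuous fun x => w x j) (j : ι) : Continuous fun y => (P y z *ᵥ w y) j := by
  simp only [mulVec, dotProduct]
  exact continuous_finsetSum _ fun i _ => (h.cont_x z hz j i).mul (hw i)

lemma norm_forcing_le (h : IsVolterra r P S p) {z : ℂ} (hz : z ∈ S) {w : ι → ℂ} {C : ℝ} {y : ℝ}
    (hb : ‖w‖ ≤ C * volterraWeight p y) (j : ι) :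
    ‖(P y z *ᵥ w) j‖ ≤ C * (p y * volterraWeight p y) :=
  calc ‖(P y z *ᵥ w) j‖ ≤ ‖P y z *ᵥ w‖ := norm_le_pi_norm _ j
    _ ≤ p y * ‖w‖ := h.bound z hz y _
    _ ≤ p y * (C * volterraWeight p y) := mul_le_mul_of_nonneg_left hb (h.nonneg y)
    _ = _ := by ring

lemma integrable_weight (h : IsVolterra r P S p) (C x : ℝ) :
    IntegrableOn (fun y => C * (p y * volterraWeight p y)) (Iic x) :=
  (integral_mul_exp_weight h.cont h.nonneg h.integrable x).1.const_mul C

lemma integral_weight (h : IsVolterra r P S p) (C x : ℝ) :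
    ∫ y in Iic x, C * (p y * volterraWeight p y) = C * ((volterraWeight p x - 1) / 2) := by
  rw [integral_const_mul]
  congr 1
  exact (integral_mul_exp_weight h.cont h.nonneg h.integrable x).2

lemma integrable_forcing (h : IsVolterra r P S p) {z : ℂ} (hz : z ∈ S) {w : ℝ → ι → ℂ}
    (hw : ∀ j, Continuous fun x => w x j) {C : ℝ} (hb : ∀ y, ‖w y‖ ≤ C * volterraWeight p y)
    (j : ι) (x : ℝ) : IntegrableOn (fun y => (P y z *ᵥ w y) j) (Iic x) :=
  Integrable.mono' (h.integrable_weight C x) (h.continuous_forcing hz hw j).aestronglyMeasurable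
    (Eventually.of_forall fun y => h.norm_forcing_le hz (hb y) j)

lemma norm_kernel_forcing_le (h : IsVolterra r P S p) {z : ℂ} (hz : z ∈ S) {w : ι → ℂ}
    {C : ℝ} {x y : ℝ} (hy : y ≤ x) (hb : ‖w‖ ≤ C * volterraWeight p y) (j : ι) :
    ‖Complex.exp (r j z * (x - y)) * (P y z *ᵥ w) j‖ ≤ C * (p y * volterraWeight p y) := by
  rw [norm_mul]
  exact (mul_le_of_le_one_left (norm_nonneg _) (norm_exp_kernel_le (h.re_nonpos z hz j) hy)).trans
    (h.norm_forcing_le hz hb j)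

lemma norm_integral_le (h : IsVolterra r P S p) {z : ℂ} (hz : z ∈ S) {w : ℝ → ι → ℂ}
    {C : ℝ} (hb : ∀ y, ‖w y‖ ≤ C * volterraWeight p y)
    (j : ι) (x : ℝ) :
    ‖∫ y in Iic x, Complex.exp (r j z * (x - y)) * (P y z *ᵥ w y) j‖ ≤
      C * ((volterraWeight p x - 1) / 2) := by
  rw [← h.integral_weight]
  refine norm_integral_le_of_norm_le (h.integrable_weight C x) ?_
  filter_upwards [ae_restrict_mem measurableSet_Iic] with y hy
  exact h.norm_kernel_forcing_le hz hy (hb y) j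

lemma hasDerivAt_integral (h : IsVolterra r P S p) {z : ℂ} (hz : z ∈ S) {w : ℝ → ι → ℂ}
    (hw : ∀ j, Continuous fun x => w x j) {C : ℝ} (hb : ∀ y, ‖w y‖ ≤ C * volterraWeight p y)
    (j : ι) (x : ℝ) :
    HasDerivAt (fun x : ℝ => ∫ y in Iic x, Complex.exp (r j z * (x - y)) * (P y z *ᵥ w y) j)
      (r j z * (∫ y in Iic x, Complex.exp (r j z * (x - y)) * (P y z *ᵥ w y) j)
        + (P x z *ᵥ w x) j) x :=
  hasDerivAt_kernel_integral (h.re_nonpos z hz j) (h.continuous_forcing hz hw j)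
    (h.integrable_forcing hz hw hb j) x

lemma iter_continuous_bound (h : IsVolterra r P S p) {z : ℂ} (hz : z ∈ S) (n : ℕ) :
    (∀ j, Continuous fun x => volterraIter r P v n x z j) ∧
    ∀ x, ‖volterraIter r P v n x z‖ ≤ ‖v‖ * (1 / 2) ^ n * volterraWeight p x := by
  induction n with
  | zero =>
    refine ⟨fun j => continuous_const, fun x => ?_⟩
    have : 1 ≤ volterraWeight p x :=
      Real.one_le_exp (mul_nonneg zero_le_two (integral_nonneg h.nonneg))
    simpa [volterraIter] using le_mul_of_one_le_right (norm_nonneg v) this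
  | succ n ih =>
    refine ⟨fun j => continuous_iff_continuousAt.2 fun x =>
      (h.hasDerivAt_integral hz ih.1 ih.2 j x).continuousAt, fun x => ?_⟩
    have hpos := volterraWeight_pos p x
    refine (pi_norm_le_iff_of_nonneg (by positivity)).2 fun j => ?_
    refine (h.norm_integral_le hz ih.2 j x).trans ?_
    have : 0 ≤ ‖v‖ * (1 / 2) ^ n := by positivity
    rw [pow_succ]
    nlinarith

lemma norm_iter_le (h : IsVolterra r P S p) {z : ℂ} (hz : z ∈ S) (n : ℕ) (x : ℝ) :
    ‖volterraIter r P v n x z‖ ≤ ‖v‖ * (1 / 2) ^ n * volterraWeight p x :=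
  (h.iter_continuous_bound hz n).2 x

lemma norm_iter_apply_le (h : IsVolterra r P S p) {z : ℂ} (hz : z ∈ S) (n : ℕ) {x X : ℝ}
    (hx : x ≤ X) (j : ι) :
    ‖volterraIter r P v n x z j‖ ≤ ‖v‖ * volterraWeight p X * (1 / 2) ^ n :=
  calc ‖volterraIter r P v n x z j‖ ≤ ‖volterraIter r P v n x z‖ := norm_le_pi_norm _ j
    _ ≤ ‖v‖ * (1 / 2) ^ n * volterraWeight p x := h.norm_iter_le hz n x
    _ ≤ ‖v‖ * (1 / 2) ^ n * volterraWeight p X :=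
      mul_le_mul_of_nonneg_left (h.weight_mono hx) (by positivity)
    _ = _ := by ring

lemma summable_geometric (C : ℝ) : Summable fun n : ℕ => C * (1 / 2 : ℝ) ^ n :=
  summable_geometric_two.mul_left C

lemma hasSum_sol (h : IsVolterra r P S p) {z : ℂ} (hz : z ∈ S) (x : ℝ) (j : ι) :
    HasSum (fun n => volterraIter r P v n x z j) (volterraSol r P v x z j) :=
  (Summable.of_norm_bounded (summable_geometric _)
    fun n => h.norm_iter_apply_le hz n le_rfl j).hasSum

lemma sol_continuous (h : IsVolterra r P S p) {z : ℂ} (hz : z ∈ S) (j : ι) :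
    Continuous fun x => volterraSol r P v x z j := by
  refine continuous_iff_continuousAt.2 fun x => ?_
  have : ContinuousOn (fun x => volterraSol r P v x z j) (Iic (x + 1)) :=
    continuousOn_tsum (fun n => ((h.iter_continuous_bound hz n).1 j).continuousOn)
      (summable_geometric _) fun n y hy => h.norm_iter_apply_le hz n hy j
  exact this.continuousAt (Iic_mem_nhds (by linarith))

lemma norm_sol_le (h : IsVolterra r P S p) {z : ℂ} (hz : z ∈ S) (x : ℝ) :
    ‖volterraSol r P v x z‖ ≤ 2 * ‖v‖ * volterraWeight p x := by
  have hpos := volterraWeight_pos p x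
  refine (pi_norm_le_iff_of_nonneg (by positivity)).2 fun j => ?_
  have h1 : HasSum (fun n : ℕ => ‖v‖ * volterraWeight p x * (1 / 2 : ℝ) ^ n)
      (‖v‖ * volterraWeight p x * 2) := hasSum_geometric_two.mul_left _
  refine (tsum_of_norm_bounded h1 fun n => h.norm_iter_apply_le hz n le_rfl j).trans (le_of_eq ?_)
  ring

lemma sol_eq (h : IsVolterra r P S p) {z : ℂ} (hz : z ∈ S) (x : ℝ) (j : ι) :
    volterraSol r P v x z j = v j +
      ∫ y in Iic x, Complex.exp (r j z * (x - y)) * (P y z *ᵥ volterraSol r P v y z) j := by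
  have hs := (h.hasSum_sol (v := v) hz x j)
  rw [← hasSum_nat_add_iff' 1] at hs
  have hi := hasSum_integral_of_dominated_convergence (μ := volume.restrict (Iic x))
    (F := fun n y => Complex.exp (r j z * (x - y)) * (P y z *ᵥ volterraIter r P v n y z) j)
    (f := fun y => Complex.exp (r j z * (x - y)) * (P y z *ᵥ volterraSol r P v y z) j)
    (fun n y => ‖v‖ * (p y * volterraWeight p y) * (1 / 2) ^ n) ?_ ?_ ?_ ?_ ?_
  · have := hs.unique hi
    rw [← this]
    simp [volterraIter]
  · intro n
    exact (continuous_kernel_mul (h.continuous_forcing hz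
      (h.iter_continuous_bound (v := v) hz n).1 j) x).aestronglyMeasurable
  · intro n
    filter_upwards [ae_restrict_mem measurableSet_Iic] with y hy
    refine (h.norm_kernel_forcing_le hz hy (h.norm_iter_le hz n y) j).trans (le_of_eq ?_)
    ring
  · exact Eventually.of_forall fun y => summable_geometric _
  · simp only [tsum_mul_left, tsum_geometric_two]
    exact (h.integrable_weight _ x).mul_const _
  · refine Eventually.of_forall fun y => HasSum.mul_left _ ?_
    simp only [mulVec, dotProduct]
    exact hasSum_sum fun i _ => (h.hasSum_sol hz y i).mul_left _

lemma hasDerivAt_sol (h : IsVolterra r P S p) {z : ℂ} (hz : z ∈ S) (x : ℝ) (j : ι) :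
    HasDerivAt (fun x => volterraSol r P v x z j)
      (r j z * (volterraSol r P v x z j - v j) + (P x z *ᵥ volterraSol r P v x z) j) x := by
  have h1 := (h.hasDerivAt_integral (w := fun x => volterraSol r P v x z) hz
    (h.sol_continuous hz) (h.norm_sol_le hz) j x).const_add (v j)
  have h2 : (fun x => volterraSol r P v x z j) = fun x : ℝ => v j +
      ∫ y in Iic x, Complex.exp (r j z * (x - y)) * (P y z *ᵥ volterraSol r P v y z) j :=
    funext fun x => h.sol_eq hz x j
  rw [h2]
  refine h1.congr_deriv ?_
  rw [h.sol_eq hz x j]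
  ring

lemma tendsto_sol (h : IsVolterra r P S p) {z : ℂ} (hz : z ∈ S) (j : ι) :
    Tendsto (fun x => volterraSol r P v x z j) atBot (𝓝 (v j)) := by
  have hlim : Tendsto (fun x => 2 * ‖v‖ * ((volterraWeight p x - 1) / 2)) atBot (𝓝 0) := by
    have h1 := tendsto_integral_Iic_zero (μ := volume) (f := p)
      (tendsto_id (α := ℝ) (x := atBot))
    have := (((h1.const_mul 2).rexp.sub_const 1).div_const 2).const_mul (2 * ‖v‖)
    simpa [volterraWeight] using this
  rw [tendsto_iff_norm_sub_tendsto_zero]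
  refine squeeze_zero (fun _ => norm_nonneg _) (fun x => ?_) hlim
  rw [h.sol_eq hz x j, add_sub_cancel_left]
  exact h.norm_integral_le hz (h.norm_sol_le hz) j x

lemma iter_continuousOn (h : IsVolterra r P S p) (hr : ∀ j, ContinuousOn (r j) S)
    (hP : ∀ x i j, ContinuousOn (fun z => P x z i j) S) (n : ℕ) (x : ℝ) (j : ι) :
    ContinuousOn (fun z => volterraIter r P v n x z j) S := by
  induction n generalizing x j with
  | zero => exact continuousOn_const
  | succ n ih =>
    refine continuousOn_of_dominated (bound := fun y => ‖v‖ * (1 / 2) ^ n *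
      (p y * volterraWeight p y)) (fun z hz => ?_) (fun z hz => ?_) (h.integrable_weight _ x)
      (Eventually.of_forall fun y => ?_)
    · exact (continuous_kernel_mul (h.continuous_forcing hz
        (h.iter_continuous_bound (v := v) hz n).1 j) x).aestronglyMeasurable
    · filter_upwards [ae_restrict_mem measurableSet_Iic] with y hy
      exact h.norm_kernel_forcing_le hz hy (h.norm_iter_le hz n y) j
    · refine ContinuousOn.mul ((hr j).mul continuousOn_const).cexp ?_
      simp only [mulVec, dotProduct]
      exact continuousOn_finsetSum _ fun i _ => (hP y j i).mul (ih y i)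

lemma iter_differentiableOn (h : IsVolterra r P S p) (hS : IsOpen S)
    (hr : ∀ j, DifferentiableOn ℂ (r j) S)
    (hP : ∀ x i j, DifferentiableOn ℂ (fun z => P x z i j) S) (n : ℕ) (x : ℝ) (j : ι) :
    DifferentiableOn ℂ (fun z => volterraIter r P v n x z j) S := by
  induction n generalizing x j with
  | zero => exact differentiableOn_const _
  | succ n ih =>
    refine differentiableOn_integral_of_dominated hS (h.integrable_weight (‖v‖ * (1 / 2) ^ n) x)
      (fun z hz => ?_) ?_ (fun y => ?_)
    · exact (continuous_kernel_mul (h.continuous_forcing hz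
        (h.iter_continuous_bound (v := v) hz n).1 j) x).aestronglyMeasurable
    · filter_upwards [ae_restrict_mem measurableSet_Iic] with y hy z hz
      exact h.norm_kernel_forcing_le hz hy (h.norm_iter_le hz n y) j
    · refine DifferentiableOn.mul ((hr j).mul_const _).cexp ?_
      simp only [mulVec, dotProduct]
      exact DifferentiableOn.fun_sum fun i _ => (hP y j i).mul (ih y i)

lemma sol_continuousOn (h : IsVolterra r P S p) (hr : ∀ j, ContinuousOn (r j) S)
    (hP : ∀ x i j, ContinuousOn (fun z => P x z i j) S) (x : ℝ) (j : ι) :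
    ContinuousOn (fun z => volterraSol r P v x z j) S :=
  continuousOn_tsum (fun n => h.iter_continuousOn hr hP n x j) (summable_geometric _)
    fun n _ hz => h.norm_iter_apply_le hz n le_rfl j

lemma sol_differentiableOn (h : IsVolterra r P S p) (hS : IsOpen S)
    (hr : ∀ j, DifferentiableOn ℂ (r j) S)
    (hP : ∀ x i j, DifferentiableOn ℂ (fun z => P x z i j) S) (x : ℝ) (j : ι) :
    DifferentiableOn ℂ (fun z => volterraSol r P v x z j) S :=
  Complex.differentiableOn_tsum_of_summable_norm (summable_geometric _)
    (fun n => h.iter_differentiableOn hS hr hP n x j) hS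
    fun n _ hz => h.norm_iter_apply_le hz n le_rfl j

end IsVolterra

end Volterra

end VNLS

namespace VNLS

open MeasureTheory Set

/-! ### Linear ordinary differential equations -/

section LinearODE

variable {ι : Type} [Fintype ι]

lemma norm_mulVec_le_sum (A : Matrix ι ι ℂ) (w : ι → ℂ) :
    ‖A *ᵥ w‖ ≤ (∑ i, ∑ j, ‖A i j‖) * ‖w‖ := by
  refine (pi_norm_le_iff_of_nonneg (by positivity)).2 fun i => ?_
  calc ‖(A *ᵥ w) i‖ ≤ ∑ j, ‖A i j * w j‖ := norm_sum_le _ _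
    _ ≤ ∑ j, ‖A i j‖ * ‖w‖ := Finset.sum_le_sum fun j _ => by
        rw [norm_mul]
        exact mul_le_mul_of_nonneg_left (norm_le_pi_norm w j) (norm_nonneg _)
    _ = (∑ j, ‖A i j‖) * ‖w‖ := by rw [Finset.sum_mul]
    _ ≤ _ := by
        refine mul_le_mul_of_nonneg_right ?_ (norm_nonneg _)
        exact Finset.single_le_sum (f := fun i => ∑ j, ‖A i j‖) (fun _ _ => by positivity)
          (Finset.mem_univ i)

/-- In the variable `τ = log t` a linear equation on `t > 0` with coefficients continuous up to
`t = 0` has an integrable coefficient matrix at `τ = -∞`, so it is a Volterra equation. -/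
lemma exists_linearODE_pos {A : ℝ → Matrix ι ι ℂ} (hA : ∀ i j, Continuous fun t => A t i j)
    (v : ι → ℂ) :
    ∃ Y : ℝ → ι → ℂ, (∀ t, 0 < t → ∀ j, HasDerivAt (fun t => Y t j) ((A t *ᵥ Y t) j) t) ∧
      ∀ j, Tendsto (fun t => Y t j) (𝓝[>] 0) (𝓝 (v j)) := by
  set P : ℝ → ℂ → Matrix ι ι ℂ := fun τ _ => (Real.exp τ : ℂ) • A (Real.exp τ) with hP
  set N : ℝ → ℝ := fun t => ∑ i, ∑ j, ‖A t i j‖ with hN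
  have hNc : Continuous N := by
    refine continuous_finsetSum _ fun i _ => continuous_finsetSum _ fun j _ => (hA i j).norm
  have hV : IsVolterra (fun _ _ => 0) P univ (fun τ => Real.exp τ * N (Real.exp τ)) := by
    refine ⟨by fun_prop, fun x => by positivity, fun x => ?_, fun _ _ _ => le_rfl, ?_, ?_⟩
    · obtain ⟨C, hC⟩ := (isCompact_Icc (a := (0 : ℝ)) (b := Real.exp x)).exists_bound_of_continuousOn
        hNc.continuousOn
      refine Integrable.mono' ((integrableOn_exp_Iic x).mul_const C) (by fun_prop) ?_
      filter_upwards [ae_restrict_mem measurableSet_Iic] with y hy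
      rw [norm_mul, Real.norm_of_nonneg (Real.exp_pos y).le]
      exact mul_le_mul_of_nonneg_left (hC _ ⟨(Real.exp_pos y).le, Real.exp_le_exp.2 hy⟩)
        (Real.exp_pos y).le
    · intro z _ x w
      rw [hP, smul_mulVec, norm_smul, Complex.norm_real, Real.norm_of_nonneg (Real.exp_pos x).le,
        mul_assoc]
      exact mul_le_mul_of_nonneg_left (norm_mulVec_le_sum _ _) (Real.exp_pos x).le
    · intro z _ i j
      have := (hA i j).comp Real.continuous_exp
      simp only [hP, Matrix.smul_apply, smul_eq_mul]
      exact (Complex.continuous_ofReal.comp Real.continuous_exp).mul this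
  refine ⟨fun t => volterraSol (fun _ _ => 0) P v (Real.log t) 0, fun t ht j => ?_, fun j => ?_⟩
  · have h1 := (hV.hasDerivAt_sol (v := v) (mem_univ 0) (Real.log t) j).scomp t
      (Real.hasDerivAt_log ht.ne')
    refine h1.congr_deriv ?_
    simp only [hP, zero_mul, zero_add, Real.exp_log ht, smul_mulVec, Pi.smul_apply, smul_eq_mul,
      Complex.real_smul]
    rw [← mul_assoc, ← Complex.ofReal_mul, inv_mul_cancel₀ ht.ne']
    simp
  · exact (hV.tendsto_sol (mem_univ 0) j).comp Real.tendsto_log_nhdsGT_zero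

/-- Global existence for the initial value problem of a linear equation with continuous
coefficients: the solutions on the two half-lines fit together at `0`. -/
theorem exists_linearODE {A : ℝ → Matrix ι ι ℂ} (hA : ∀ i j, Continuous fun t => A t i j)
    (v : ι → ℂ) :
    ∃ Y : ℝ → ι → ℂ, Y 0 = v ∧ ∀ t j, HasDerivAt (fun t => Y t j) ((A t *ᵥ Y t) j) t := by
  obtain ⟨Y₁, hd₁, hl₁⟩ := exists_linearODE_pos hA v
  obtain ⟨Y₂, hd₂, hl₂⟩ := exists_linearODE_pos (A := fun t => -A (-t))
    (fun i j => ((hA i j).comp continuous_neg).neg) v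
  set Y : ℝ → ι → ℂ := fun t => if 0 < t then Y₁ t else if t < 0 then Y₂ (-t) else v with hY
  have hY0 : Y 0 = v := by simp [hY]
  have hne : ∀ t, t ≠ 0 → ∀ j, HasDerivAt (fun t => Y t j) ((A t *ᵥ Y t) j) t := by
    intro t ht j
    rcases lt_or_gt_of_ne ht with h | h
    · have h1 : HasDerivAt (fun t => Y₂ (-t) j) ((A t *ᵥ Y₂ (-t)) j) t := by
        have := (hd₂ (-t) (by linarith) j).scomp t (hasDerivAt_neg t)
        simpa [neg_mulVec, Function.comp_def] using this
      have h2 : Y t = Y₂ (-t) := by simp [hY, h, h.le]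
      rw [h2]
      refine h1.congr_of_eventuallyEq ?_
      filter_upwards [Iio_mem_nhds h] with s hs
      simp [hY, (mem_Iio.1 hs).not_gt, mem_Iio.1 hs]
    · have h2 : Y t = Y₁ t := by simp [hY, h]
      rw [h2]
      refine (hd₁ t h j).congr_of_eventuallyEq ?_
      filter_upwards [Ioi_mem_nhds h] with s hs
      simp [hY, mem_Ioi.1 hs]
  have hc0 : ∀ j, ContinuousAt (fun t => Y t j) 0 := by
    intro j
    rw [continuousAt_iff_punctured_nhds, ← nhdsLT_sup_nhdsGT, tendsto_sup]
    have hneg : Tendsto (fun t : ℝ => -t) (𝓝[<] 0) (𝓝[>] 0) := by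
      refine tendsto_nhdsWithin_iff.2 ⟨?_, ?_⟩
      · simpa using (continuous_neg.tendsto (0 : ℝ)).mono_left nhdsWithin_le_nhds
      · filter_upwards [self_mem_nhdsWithin] with s hs
        simpa using hs
    rw [hY0]
    refine ⟨((hl₂ j).comp hneg).congr' ?_, (hl₁ j).congr' ?_⟩
    · filter_upwards [self_mem_nhdsWithin] with s hs
      simp [hY, (mem_Iio.1 hs).not_gt, mem_Iio.1 hs]
    · filter_upwards [self_mem_nhdsWithin] with s hs
      simp [hY, mem_Ioi.1 hs]
  refine ⟨Y, hY0, fun t j => ?_⟩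
  rcases eq_or_ne t 0 with rfl | ht
  · refine hasDerivAt_of_hasDerivAt_of_ne (f := fun t => Y t j) (g := fun t => (A t *ᵥ Y t) j)
      (fun y hy => hne y hy j) (hc0 j) ?_
    simp only [mulVec, dotProduct]
    exact tendsto_finsetSum _ fun i _ => ((hA j i).continuousAt).mul (hc0 i)
  · exact hne t ht j

end LinearODE

/-- Grönwall's inequality on the interval between `0` and `t`, for `t` of either sign. -/
lemma norm_le_gronwallBound_uIcc {V : Type*} [NormedAddCommGroup V] [NormedSpace ℝ V]
    {f f' : ℝ → V} {K ε δ t : ℝ} (hd : ∀ s, HasDerivAt f (f' s) s) (h0 : ‖f 0‖ ≤ δ)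
    (hb : ∀ s ∈ uIcc 0 t, ‖f' s‖ ≤ K * ‖f s‖ + ε) :
    ‖f t‖ ≤ gronwallBound δ K ε |t| := by
  rcases le_total 0 t with ht | ht
  · have := norm_le_gronwallBound_of_norm_deriv_right_le (f := f) (f' := f') (a := 0) (b := t)
      (fun s _ => (hd s).continuousAt.continuousWithinAt) (fun s _ => (hd s).hasDerivWithinAt) h0
      (fun s hs => hb s (by rw [uIcc_of_le ht]; exact ⟨hs.1, hs.2.le⟩)) t ⟨ht, le_rfl⟩
    simpa [abs_of_nonneg ht] using this
  · have hd' : ∀ s, HasDerivAt (fun s => f (-s)) (-f' (-s)) s := fun s => by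
      simpa [Function.comp_def] using (hd (-s)).scomp s (hasDerivAt_neg s)
    have := norm_le_gronwallBound_of_norm_deriv_right_le (f := fun s => f (-s))
      (f' := fun s => -f' (-s)) (a := 0) (b := -t) (δ := δ) (K := K) (ε := ε)
      (fun s _ => (hd' s).continuousAt.continuousWithinAt) (fun s _ => (hd' s).hasDerivWithinAt)
      (by simpa using h0)
      (fun s hs => by
        rw [norm_neg]
        exact hb (-s) (by rw [uIcc_of_ge ht]; exact ⟨by linarith [hs.2], by linarith [hs.1]⟩))
      (-t) ⟨by linarith, le_rfl⟩
    simpa [abs_of_nonpos ht] using this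

/-- The Grönwall bound is of first order in the initial error and the defect. -/
lemma gronwallBound_le_mul {K T : ℝ} (hK : 0 ≤ K) (hT : 0 ≤ T) :
    ∃ C, 0 ≤ C ∧ ∀ δ ε : ℝ, gronwallBound δ K ε T ≤ C * (|δ| + |ε|) := by
  by_cases h : K = 0
  · subst h
    refine ⟨1 + T, by positivity, fun δ ε => ?_⟩
    rw [gronwallBound_K0]
    have := le_abs_self δ
    have h2 := mul_le_mul_of_nonneg_right (le_abs_self ε) hT
    nlinarith [abs_nonneg δ, abs_nonneg ε, mul_nonneg hT (abs_nonneg δ)]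
  · have hK' : 0 < K := lt_of_le_of_ne hK (Ne.symm h)
    refine ⟨Real.exp (K * T) + Real.exp (K * T) / K, by positivity, fun δ ε => ?_⟩
    rw [gronwallBound_of_K_ne_0 h]
    have e1 : 1 ≤ Real.exp (K * T) := Real.one_le_exp (by positivity)
    have h1 : δ * Real.exp (K * T) ≤ |δ| * Real.exp (K * T) :=
      mul_le_mul_of_nonneg_right (le_abs_self δ) (by positivity)
    have h2 : ε / K * (Real.exp (K * T) - 1) ≤ |ε| / K * Real.exp (K * T) :=
      calc ε / K * (Real.exp (K * T) - 1) ≤ |ε| / K * (Real.exp (K * T) - 1) :=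
            mul_le_mul_of_nonneg_right (div_le_div_of_nonneg_right (le_abs_self ε) hK'.le)
              (by linarith)
        _ ≤ |ε| / K * Real.exp (K * T) :=
            mul_le_mul_of_nonneg_left (by linarith) (by positivity)
    have h3 : 0 ≤ |ε| * Real.exp (K * T) := by positivity
    have h4 : 0 ≤ |δ| * (Real.exp (K * T) / K) := by positivity
    calc _ ≤ |δ| * Real.exp (K * T) + |ε| / K * Real.exp (K * T) := add_le_add h1 h2
      _ = |δ| * Real.exp (K * T) + |ε| * (Real.exp (K * T) / K) := by ring
      _ ≤ _ := by nlinarith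

end VNLS

namespace VNLS

/-! ### The spatial part of the Lax pair at a fixed time -/

/-- Entrywise derivative of a matrix-valued function of a real variable. -/
def HasMatDerivAt (Φ : ℝ → Mat) (Φ' : Mat) (x : ℝ) : Prop :=
  ∀ i j, HasDerivAt (fun y => Φ y i j) (Φ' i j) x

namespace HasMatDerivAt

variable {Φ Ψ : ℝ → Mat} {Φ' Ψ' : Mat} {x : ℝ}

lemma mul (h : HasMatDerivAt Φ Φ' x) (k : HasMatDerivAt Ψ Ψ' x) :
    HasMatDerivAt (fun y => Φ y * Ψ y) (Φ' * Ψ x + Φ x * Ψ') x := by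
  intro i j
  simp only [Matrix.mul_apply, Matrix.add_apply, ← Finset.sum_add_distrib]
  exact HasDerivAt.fun_sum fun l _ => (h i l).mul (k l j)

lemma const (C : Mat) (x : ℝ) : HasMatDerivAt (fun _ => C) 0 x := fun _ _ => hasDerivAt_const _ _

lemma const_mul (C : Mat) (h : HasMatDerivAt Φ Φ' x) :
    HasMatDerivAt (fun y => C * Φ y) (C * Φ') x := by
  simpa using (const C x).mul h

lemma mul_const (h : HasMatDerivAt Φ Φ' x) (C : Mat) :
    HasMatDerivAt (fun y => Φ y * C) (Φ' * C) x := by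
  simpa using h.mul (const C x)

lemma conjTranspose (h : HasMatDerivAt Φ Φ' x) : HasMatDerivAt (fun y => (Φ y)ᴴ) Φ'ᴴ x :=
  fun i j => by simpa using (h j i).star

lemma transpose (h : HasMatDerivAt Φ Φ' x) : HasMatDerivAt (fun y => (Φ y)ᵀ) Φ'ᵀ x :=
  fun i j => h j i

lemma comp_neg (h : HasMatDerivAt Φ Φ' (-x)) : HasMatDerivAt (fun y => Φ (-y)) (-Φ') x :=
  fun i j => by simpa [Function.comp_def] using (h i j).scomp x (hasDerivAt_neg x)

lemma congr_deriv (h : HasMatDerivAt Φ Φ' x) (e : Φ' = Ψ') : HasMatDerivAt Φ Ψ' x := e ▸ h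

end HasMatDerivAt

lemma eq_of_hasMatDerivAt_zero {Φ : ℝ → Mat} (h : ∀ x, HasMatDerivAt Φ 0 x) (x y : ℝ) :
    Φ x = Φ y := by
  ext i j
  exact is_const_of_deriv_eq_zero (f := fun x => Φ x i j) (fun x => (h x i j).differentiableAt)
    (fun x => (h x i j).deriv) x y

/-- The coefficient matrix `X` for the value `u` of the potential. -/
def spatialX (qo : ℝ) (u : Fin 3 → ℂ) (z : ℂ) : Mat := (-(Complex.I * kk qo z)) • J + Q u

/-- The eigenvalues `-iλ, ik, ik, iλ` of the asymptotic coefficient matrix `X_±`. -/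
def rate (qo : ℝ) (z : ℂ) : Fin 4 → ℂ :=
  ![-(Complex.I * lam qo z), Complex.I * kk qo z, Complex.I * kk qo z, Complex.I * lam qo z]

/-- The diagonal matrix of the exponentials `e^{r_j x}`, where `r_j` are the eigenvalues of `X_±`. -/
def expRate (qo : ℝ) (z : ℂ) (x : ℝ) : Mat := diagonal fun j => Complex.exp (rate qo z j * x)

/-- The scalar `qₒ e^{iθ}`. -/
def amp (qo θ : ℝ) : ℂ := (qo : ℂ) * Complex.exp (Complex.I * (θ : ℂ))

/-- The inverse of `E_±`, away from `z = 0, ±qₒ`. -/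
def eigInv (qo θ : ℝ) (z : ℂ) : Mat :=
  !![(gam qo z)⁻¹, 0, 0, Complex.I / z * star (amp qo θ) * (gam qo z)⁻¹;
     0, 1, 0, 0;
     0, 0, 1, 0;
     -(Complex.I / z * amp qo θ * (gam qo z)⁻¹), 0, 0, (gam qo z)⁻¹]

/-- The matrix `E_±† J E_±` for real `z`. -/
def gramN (qo : ℝ) (z : ℂ) : Mat := diagonal ![gam qo z, -1, -1, -gam qo z]

lemma star_amp_mul (qo θ : ℝ) : star (amp qo θ) * amp qo θ = (qo : ℂ) ^ 2 := by
  have : (starRingEnd ℂ) (Complex.exp (Complex.I * θ)) * Complex.exp (Complex.I * θ) = 1 := by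
    rw [← Complex.exp_conj, ← Complex.exp_add]
    simp
  simp only [amp, star_mul', RCLike.star_def, Complex.conj_ofReal]
  linear_combination (qo : ℂ) ^ 2 * this

lemma amp_mul_star (qo θ : ℝ) : amp qo θ * star (amp qo θ) = (qo : ℂ) ^ 2 := by
  rw [mul_comm, star_amp_mul]

lemma background_eq (qo θ : ℝ) : background qo θ = ![0, 0, amp qo θ] := rfl

lemma J_eq : J = !![1, 0, 0, 0; 0, -1, 0, 0; 0, 0, -1, 0; 0, 0, 0, -1] := by
  ext i j
  fin_cases i <;> fin_cases j <;> simp [J]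

lemma J_mul_J : J * J = 1 := by
  rw [J, diagonal_mul_diagonal, ← diagonal_one]
  congr 1
  ext i
  fin_cases i <;> simp

lemma J_transpose : Jᵀ = J := diagonal_transpose _

lemma J_conjTranspose : Jᴴ = J := by
  ext i j
  fin_cases i <;> fin_cases j <;> simp [J]

lemma J_mul_Q (v : Fin 3 → ℂ) : J * Q v = -(Q v * J) := by
  ext i j
  simp only [J, Matrix.neg_apply, diagonal_mul, mul_diagonal]
  fin_cases i <;> fin_cases j <;> simp [Q]

lemma Q_conjTranspose (v : Fin 3 → ℂ) : (Q v)ᴴ = Q v := by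
  ext i j
  fin_cases i <;> fin_cases j <;> simp [Q]

lemma Q_add (v w : Fin 3 → ℂ) : Q (v + w) = Q v + Q w := by
  ext i j
  fin_cases i <;> fin_cases j <;> simp [Q]

lemma eigE_eq (qo θ : ℝ) (z : ℂ) : eigE qo θ z =
    !![1, 0, 0, -(Complex.I / z * star (amp qo θ));
       0, 1, 0, 0;
       0, 0, 1, 0;
       Complex.I / z * amp qo θ, 0, 0, 1] := by
  ext i j
  fin_cases i <;> fin_cases j <;> simp [eigE, J, Q, background_eq]

lemma gam_ne_zero {qo : ℝ} {z : ℂ} (h0 : z ≠ 0) (h1 : z ≠ qo) (h2 : z ≠ -qo) :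
    gam qo z ≠ 0 := by
  rw [gam, sub_ne_zero]
  intro h
  rw [eq_div_iff (pow_ne_zero 2 h0), one_mul] at h
  rcases sq_eq_sq_iff_eq_or_eq_neg.1 h with h | h
  · exact h1 h
  · exact h2 h

lemma eigE_mul_eigInv (qo θ : ℝ) {z : ℂ} (hγ : gam qo z ≠ 0) :
    eigE qo θ z * eigInv qo θ z = 1 := by
  have h := amp_mul_star qo θ
  have hI := Complex.I_sq
  have key : (1 + (Complex.I / z) ^ 2 * (amp qo θ * star (amp qo θ))) * (gam qo z)⁻¹ = 1 := by
    have : 1 + (Complex.I / z) ^ 2 * (amp qo θ * star (amp qo θ)) = gam qo z := by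
      rw [h, div_pow, hI, gam]
      ring
    rw [this, mul_inv_cancel₀ hγ]
  rw [eigE_eq, eigInv]
  ext i j
  fin_cases i <;> fin_cases j <;>
    simp [Matrix.mul_apply, Fin.sum_univ_four] <;>
    simp only [RCLike.star_def] at key ⊢
  · linear_combination key
  · linear_combination key

/-- The columns of `E_±` are eigenvectors of `X_±`. -/
lemma spatialX_background_mul_eigE (qo θ : ℝ) {z : ℂ} (h0 : z ≠ 0) :
    spatialX qo (background qo θ) z * eigE qo θ z = eigE qo θ z * diagonal (rate qo z) := by
  have h := amp_mul_star qo θ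
  rw [eigE_eq, background_eq, spatialX, J_eq]
  have key : kk qo z = lam qo z + amp qo θ * star (amp qo θ) / z := by
    rw [h, kk, lam]
    ring
  have key2 : kk qo z = z - lam qo z := by
    rw [kk, lam]
    ring
  have hz := mul_inv_cancel₀ h0
  ext i j
  fin_cases i <;> fin_cases j <;>
    simp [Matrix.mul_apply, Fin.sum_univ_four, Q, rate] <;>
    simp only [RCLike.star_def] at key h ⊢
  · rw [key]; ring
  · rw [key2]
    linear_combination (starRingEnd ℂ) (amp qo θ) * Complex.I ^ 2 * hz +
      (starRingEnd ℂ) (amp qo θ) * Complex.I_sq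
  · rw [key2]
    linear_combination amp qo θ * Complex.I ^ 2 * hz + amp qo θ * Complex.I_sq
  · rw [key]; ring

end VNLS

namespace VNLS

/-- `φ` solves `φ_x = X φ` for the potential `u` at the real spectral parameter `s`, and
`φ = E e^{Dx} + o(1)` along the filter `l` (`atBot` or `atTop`), where `D` is the diagonal matrix of
the eigenvalues of the asymptotic coefficient matrix. -/
structure IsSpatialJost (qo θ : ℝ) (u : ℝ → Fin 3 → ℂ) (l : Filter ℝ) (s : ℝ) (φ : ℝ → Mat) :
    Prop where
  deriv : ∀ x, HasMatDerivAt φ (spatialX qo (u x) s * φ x) x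
  lim : Tendsto (fun x => φ x - eigE qo θ s * expRate qo s x) l (𝓝 0)

lemma kk_star (qo : ℝ) (z : ℂ) : star (kk qo z) = kk qo (star z) := by
  simp [kk]

lemma lam_star (qo : ℝ) (z : ℂ) : star (lam qo z) = lam qo (star z) := by
  simp [lam]

lemma star_rate (qo s : ℝ) (j : Fin 4) : star (rate qo s j) = -rate qo s j := by
  have h1 := kk_star qo s
  have h2 := lam_star qo s
  simp only [RCLike.star_def, Complex.conj_ofReal] at h1 h2
  fin_cases j <;> simp [rate, h1, h2]

lemma rate_re (qo s : ℝ) (j : Fin 4) : (rate qo s j).re = 0 := by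
  have h := congrArg Complex.re (star_rate qo s j)
  simp at h
  linarith

lemma norm_exp_rate (qo s : ℝ) (j : Fin 4) (x : ℝ) : ‖Complex.exp (rate qo s j * x)‖ = 1 := by
  rw [Complex.norm_exp, Complex.re_mul_ofReal, rate_re]
  simp

lemma mul_expRate_apply (qo : ℝ) (z : ℂ) (x : ℝ) (N : Mat) (i j : Fin 4) :
    (N * expRate qo z x) i j = N i j * Complex.exp (rate qo z j * x) := by
  rw [expRate, mul_diagonal]

lemma expRate_mul_apply (qo : ℝ) (z : ℂ) (x : ℝ) (N : Mat) (i j : Fin 4) :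
    (expRate qo z x * N) i j = Complex.exp (rate qo z i * x) * N i j := by
  rw [expRate, diagonal_mul]

lemma expRate_mul_expRate_neg (qo : ℝ) (z : ℂ) (x : ℝ) :
    expRate qo z x * expRate qo z (-x) = 1 := by
  rw [expRate, expRate, diagonal_mul_diagonal, ← diagonal_one]
  congr 1
  ext i
  rw [← Complex.exp_add]
  simp

lemma expRate_neg_mul_expRate (qo : ℝ) (z : ℂ) (x : ℝ) :
    expRate qo z (-x) * expRate qo z x = 1 := by
  simpa using expRate_mul_expRate_neg qo z (-x)

lemma expRate_conjTranspose (qo s x : ℝ) : (expRate qo s x)ᴴ = expRate qo s (-x) := by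
  rw [expRate, diagonal_conjTranspose, expRate]
  congr 1
  ext j
  have h := star_rate qo s j
  simp only [RCLike.star_def, Pi.star_apply] at h ⊢
  rw [← Complex.exp_conj]
  simp [h]

/-- For real `z` the coefficient matrix is anti-self-adjoint for the indefinite form `J`. -/
lemma spatialX_skew (qo s : ℝ) (u : Fin 3 → ℂ) :
    (spatialX qo u s)ᴴ * J + J * spatialX qo u s = 0 := by
  have h1 := kk_star qo s
  simp only [RCLike.star_def, Complex.conj_ofReal] at h1
  have h2 : star (-(Complex.I * kk qo s)) = Complex.I * kk qo s := by simp [h1]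
  rw [spatialX, conjTranspose_add, conjTranspose_smul, h2, J_conjTranspose, Q_conjTranspose,
    add_mul, mul_add, J_mul_Q, smul_mul_assoc, mul_smul_comm, neg_smul]
  abel

lemma tendsto_matrix_of_entries {α : Type*} {l : Filter α} {F : α → Mat} {A : Mat}
    (h : ∀ i j, Tendsto (fun x => F x i j) l (𝓝 (A i j))) : Tendsto F l (𝓝 A) :=
  tendsto_pi_nhds.2 fun i => tendsto_pi_nhds.2 fun j => h i j

lemma tendsto_entry {α : Type*} {l : Filter α} {F : α → Mat} {A : Mat}
    (h : Tendsto F l (𝓝 A)) (i j : Fin 4) : Tendsto (fun x => F x i j) l (𝓝 (A i j)) :=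
  tendsto_pi_nhds.1 (tendsto_pi_nhds.1 h i) j

lemma tendsto_zero_of_norm_entries {α : Type*} {l : Filter α} {F G : α → Mat}
    (hG : Tendsto G l (𝓝 0)) (h : ∀ x i j, ‖F x i j‖ = ‖G x i j‖) : Tendsto F l (𝓝 0) := by
  refine tendsto_matrix_of_entries fun i j => ?_
  rw [Matrix.zero_apply, tendsto_zero_iff_norm_tendsto_zero]
  simp only [h]
  simpa using (tendsto_entry hG i j).norm

/-- A constant matrix which differs from a convergent one by oscillating entrywise factors equals
its limit, provided the factors are `1` wherever the limit has a nonzero entry. -/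
lemma eq_of_unimodular {l : Filter ℝ} [l.NeBot] {C N : Mat} {G : ℝ → Mat}
    {c : ℝ → Fin 4 → Fin 4 → ℂ} (hC : ∀ x i j, C i j = c x i j * G x i j)
    (hc : ∀ x i j, ‖c x i j‖ = 1) (hN : ∀ x i j, c x i j * N i j = N i j)
    (hG : Tendsto G l (𝓝 N)) : C = N := by
  ext i j
  have h : ∀ x, ‖G x i j - N i j‖ = ‖C i j - N i j‖ := by
    intro x
    have e : C i j - N i j = c x i j * (G x i j - N i j) := by
      rw [hC x i j]
      linear_combination hN x i j
    rw [e, norm_mul, hc, one_mul]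
  have h1 := (tendsto_iff_norm_sub_tendsto_zero.1 (tendsto_entry hG i j))
  simp only [h] at h1
  have := tendsto_nhds_unique h1 tendsto_const_nhds
  exact sub_eq_zero.1 (norm_eq_zero.1 this.symm)

lemma eigE_gram (qo θ s : ℝ) : (eigE qo θ s)ᴴ * J * eigE qo θ s = gramN qo s := by
  have h := amp_mul_star qo θ
  have key : 1 + (Complex.I / s) ^ 2 * (amp qo θ * star (amp qo θ)) = gam qo s := by
    rw [h, div_pow, Complex.I_sq, gam]
    ring
  rw [eigE_eq, J, gramN]
  ext i j
  simp only [Matrix.mul_apply, Fin.sum_univ_four]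
  fin_cases i <;> fin_cases j <;> simp <;> simp only [RCLike.star_def] at key ⊢
  · linear_combination key
  · ring
  · ring
  · linear_combination -key

namespace IsSpatialJost

variable {qo θ : ℝ} {u : ℝ → Fin 3 → ℂ} {l : Filter ℝ} {s : ℝ} {φ ψ : ℝ → Mat}

/-- The normalized Jost solution `φ e^{-Dx}` converges. -/
lemma tendsto_mul_exp (h : IsSpatialJost qo θ u l s φ) :
    Tendsto (fun x => φ x * expRate qo s (-x)) l (𝓝 (eigE qo θ s)) := by
  rw [← tendsto_sub_nhds_zero_iff]
  refine tendsto_zero_of_norm_entries h.lim fun x i j => ?_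
  have : φ x * expRate qo s (-x) - eigE qo θ s =
      (φ x - eigE qo θ s * expRate qo s x) * expRate qo s (-x) := by
    rw [sub_mul, Matrix.mul_assoc (eigE qo θ s), expRate_mul_expRate_neg, Matrix.mul_one]
  rw [this, mul_expRate_apply, norm_mul, norm_exp_rate, mul_one]

lemma of_tendsto_mul_exp (hd : ∀ x, HasMatDerivAt φ (spatialX qo (u x) s * φ x) x)
    (h : Tendsto (fun x => φ x * expRate qo s (-x)) l (𝓝 (eigE qo θ s))) :
    IsSpatialJost qo θ u l s φ := by
  refine ⟨hd, ?_⟩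
  rw [← tendsto_sub_nhds_zero_iff] at h
  refine tendsto_zero_of_norm_entries h fun x i j => ?_
  have : φ x * expRate qo s (-x) - eigE qo θ s =
      (φ x - eigE qo θ s * expRate qo s x) * expRate qo s (-x) := by
    rw [sub_mul, Matrix.mul_assoc (eigE qo θ s), expRate_mul_expRate_neg, Matrix.mul_one]
  rw [this, mul_expRate_apply, norm_mul, norm_exp_rate, mul_one]

lemma eq_mul_exp (φ : ℝ → Mat) (x : ℝ) :
    φ x = (φ x * expRate qo s (-x)) * expRate qo s x := by
  rw [Matrix.mul_assoc, expRate_neg_mul_expRate, Matrix.mul_one]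

/-- The sesquilinear pairing of two Jost solutions normalized at the same end is independent of `x`,
hence equal to its asymptotic value. -/
theorem gram [l.NeBot] (h : IsSpatialJost qo θ u l s φ) (k : IsSpatialJost qo θ u l s ψ) (x : ℝ) :
    (φ x)ᴴ * J * ψ x = gramN qo s := by
  have hconst : ∀ y, (φ y)ᴴ * J * ψ y = (φ x)ᴴ * J * ψ x := by
    intro y
    refine eq_of_hasMatDerivAt_zero (Φ := fun y => (φ y)ᴴ * J * ψ y) (fun w => ?_) y x
    refine ((((h.deriv w).conjTranspose).mul_const J).mul (k.deriv w)).congr_deriv ?_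
    have := spatialX_skew qo s (u w)
    calc (spatialX qo (u w) s * φ w)ᴴ * J * ψ w + (φ w)ᴴ * J * (spatialX qo (u w) s * ψ w)
        = (φ w)ᴴ * ((spatialX qo (u w) s)ᴴ * J + J * spatialX qo (u w) s) * ψ w := by
          rw [conjTranspose_mul]; noncomm_ring
      _ = 0 := by rw [this]; simp
  refine eq_of_unimodular (l := l)
    (G := fun y => (φ y * expRate qo s (-y))ᴴ * J * (ψ y * expRate qo s (-y)))
    (c := fun y i j => Complex.exp (-(rate qo s i) * y) * Complex.exp (rate qo s j * y))
    (fun y i j => ?_) (fun y i j => ?_) (fun y i j => ?_) ?_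
  · rw [← hconst y]
    have e : (φ y)ᴴ * J * ψ y = expRate qo s (-y) *
        ((φ y * expRate qo s (-y))ᴴ * J * (ψ y * expRate qo s (-y))) * expRate qo s y := by
      conv_lhs => rw [eq_mul_exp (qo := qo) (s := s) φ y, eq_mul_exp (qo := qo) (s := s) ψ y]
      rw [conjTranspose_mul (φ y * expRate qo s (-y)), expRate_conjTranspose]
      simp only [Matrix.mul_assoc]
    rw [e, mul_expRate_apply, expRate_mul_apply]
    push_cast
    ring_nf
  · have := norm_exp_rate qo s i (-y)
    simp only [Complex.ofReal_neg, mul_neg] at this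
    rw [norm_mul, norm_exp_rate, neg_mul, this, mul_one]
  · rcases eq_or_ne i j with rfl | hij
    · rw [← Complex.exp_add]
      simp
    · simp [gramN, diagonal_apply_ne _ hij]
  · rw [← eigE_gram qo θ s]
    exact (((continuous_id.matrix_conjTranspose).tendsto _ |>.comp h.tendsto_mul_exp).mul
      tendsto_const_nhds).mul k.tendsto_mul_exp

end IsSpatialJost

/-- The inverse of `gramN`. -/
def gramInv (qo : ℝ) (z : ℂ) : Mat := diagonal ![(gam qo z)⁻¹, -1, -1, -(gam qo z)⁻¹]

lemma gramInv_mul_gramN {qo : ℝ} {z : ℂ} (h : gam qo z ≠ 0) : gramInv qo z * gramN qo z = 1 := by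
  rw [gramInv, gramN, diagonal_mul_diagonal, ← diagonal_one]
  congr 1
  ext i
  fin_cases i <;> simp [h]

namespace IsSpatialJost

variable {qo θ : ℝ} {u : ℝ → Fin 3 → ℂ} {l : Filter ℝ} {s : ℝ} {φ ψ : ℝ → Mat}

lemma inv_eq [l.NeBot] (h : IsSpatialJost qo θ u l s φ) (hs : gam qo s ≠ 0) (x : ℝ) :
    (φ x)⁻¹ = gramInv qo s * (φ x)ᴴ * J := by
  refine Matrix.inv_eq_left_inv ?_
  rw [Matrix.mul_assoc, Matrix.mul_assoc, ← Matrix.mul_assoc _ J, h.gram h,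
    gramInv_mul_gramN hs]

lemma isUnit_det [l.NeBot] (h : IsSpatialJost qo θ u l s φ) (hs : gam qo s ≠ 0) (x : ℝ) :
    IsUnit (φ x).det := by
  refine Matrix.isUnit_det_of_left_inverse (B := gramInv qo s * (φ x)ᴴ * J) ?_
  rw [Matrix.mul_assoc, Matrix.mul_assoc, ← Matrix.mul_assoc _ J, h.gram h,
    gramInv_mul_gramN hs]

/-- The transition matrix between two Jost solutions normalized at the same end is `N⁻¹ N = 1`. -/
theorem unique [l.NeBot] (h : IsSpatialJost qo θ u l s φ) (k : IsSpatialJost qo θ u l s ψ)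
    (hs : gam qo s ≠ 0) : φ = ψ := by
  funext x
  have h1 : (φ x)⁻¹ * ψ x = 1 := by
    rw [h.inv_eq hs, Matrix.mul_assoc, Matrix.mul_assoc, ← Matrix.mul_assoc _ J, h.gram k,
      gramInv_mul_gramN hs]
  have h2 := congrArg (φ x * ·) h1
  simp only [Matrix.mul_one, ← Matrix.mul_assoc, Matrix.mul_nonsing_inv _ (h.isUnit_det hs x),
    Matrix.one_mul] at h2
  exact h2.symm

/-- An antisymmetric-square solution `Z_x = X Z + Z Xᵀ` which decays at the end where the Jost
solution is normalized vanishes identically. -/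
theorem eq_zero_of_bilinear [l.NeBot] (h : IsSpatialJost qo θ u l s φ) (hs : gam qo s ≠ 0)
    {Z : ℝ → Mat}
    (hZ : ∀ x, HasMatDerivAt Z (spatialX qo (u x) s * Z x + Z x * (spatialX qo (u x) s)ᵀ) x)
    (h0 : Tendsto Z l (𝓝 0)) (x : ℝ) : Z x = 0 := by
  have hskewT : ∀ w, J * ((spatialX qo (u w) s)ᴴ)ᵀ + (spatialX qo (u w) s)ᵀ * J = 0 := by
    intro w
    have := congrArg Matrix.transpose (spatialX_skew qo s (u w))
    simpa [transpose_add, transpose_mul, J_transpose] using this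
  have hconst : ∀ y, (φ y)ᴴ * J * Z y * J * ((φ y)ᴴ)ᵀ = (φ x)ᴴ * J * Z x * J * ((φ x)ᴴ)ᵀ := by
    intro y
    refine eq_of_hasMatDerivAt_zero (Φ := fun y => (φ y)ᴴ * J * Z y * J * ((φ y)ᴴ)ᵀ)
      (fun w => ?_) y x
    refine ((((((h.deriv w).conjTranspose).mul_const J).mul (hZ w)).mul_const J).mul
      (h.deriv w).conjTranspose.transpose).congr_deriv ?_
    have e1 := spatialX_skew qo s (u w)
    have e2 := hskewT w
    generalize spatialX qo (u w) s = X at e1 e2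
    rw [conjTranspose_mul, transpose_mul]
    calc ((φ w)ᴴ * Xᴴ * J * Z w + (φ w)ᴴ * J * (X * Z w + Z w * Xᵀ)) * J * ((φ w)ᴴ)ᵀ +
          (φ w)ᴴ * J * Z w * J * ((Xᴴ)ᵀ * ((φ w)ᴴ)ᵀ)
        = (φ w)ᴴ * (Xᴴ * J + J * X) * Z w * J * ((φ w)ᴴ)ᵀ
          + (φ w)ᴴ * J * Z w * (J * (Xᴴ)ᵀ + Xᵀ * J) * ((φ w)ᴴ)ᵀ := by noncomm_ring
      _ = 0 := by rw [e1, e2]; simp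
  have hC : (φ x)ᴴ * J * Z x * J * ((φ x)ᴴ)ᵀ = 0 := by
    refine eq_of_unimodular (l := l)
      (G := fun y => (φ y * expRate qo s (-y))ᴴ * J * Z y * J * ((φ y * expRate qo s (-y))ᴴ)ᵀ)
      (c := fun y i j => Complex.exp (rate qo s i * (-y : ℝ)) * Complex.exp (rate qo s j * (-y : ℝ)))
      (fun y i j => ?_) (fun y i j => ?_) (fun y i j => by simp) ?_
    · rw [← hconst y]
      have e : (φ y)ᴴ * J * Z y * J * ((φ y)ᴴ)ᵀ = expRate qo s (-y) *
          ((φ y * expRate qo s (-y))ᴴ * J * Z y * J * ((φ y * expRate qo s (-y))ᴴ)ᵀ) *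
            expRate qo s (-y) := by
        conv_lhs => rw [eq_mul_exp (qo := qo) (s := s) φ y]
        rw [conjTranspose_mul (φ y * expRate qo s (-y)), transpose_mul, expRate_conjTranspose]
        have : (expRate qo s (-y))ᵀ = expRate qo s (-y) := diagonal_transpose _
        rw [this]
        simp only [Matrix.mul_assoc]
      rw [e, mul_expRate_apply, expRate_mul_apply]
      ring
    · rw [norm_mul, norm_exp_rate, norm_exp_rate, mul_one]
    · have c1 : Tendsto (fun y => (φ y * expRate qo s (-y))ᴴ) l (𝓝 (eigE qo θ s)ᴴ) :=
        ((continuous_id.matrix_conjTranspose).tendsto _).comp h.tendsto_mul_exp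
      have c2 : Tendsto (fun y => ((φ y * expRate qo s (-y))ᴴ)ᵀ) l (𝓝 ((eigE qo θ s)ᴴ)ᵀ) :=
        ((continuous_id.matrix_transpose).tendsto _).comp c1
      have := (((c1.mul (tendsto_const_nhds (x := J))).mul h0).mul
        (tendsto_const_nhds (x := J))).mul c2
      simpa using this
  have hu := h.isUnit_det hs x
  have hinv : IsUnit ((φ x)ᴴ * J).det := by
    have hJ : IsUnit J.det := Matrix.isUnit_det_of_left_inverse J_mul_J
    rw [det_mul, det_conjTranspose]
    exact hu.star.mul hJ
  have hinv2 : IsUnit (J * ((φ x)ᴴ)ᵀ).det := by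
    have : J * ((φ x)ᴴ)ᵀ = ((φ x)ᴴ * J)ᵀ := by rw [transpose_mul, J_transpose]
    rw [this, det_transpose]
    exact hinv
  calc Z x = ((φ x)ᴴ * J)⁻¹ * ((φ x)ᴴ * J * Z x * J * ((φ x)ᴴ)ᵀ) * (J * ((φ x)ᴴ)ᵀ)⁻¹ := by
        rw [show (φ x)ᴴ * J * Z x * J * ((φ x)ᴴ)ᵀ = ((φ x)ᴴ * J) * (Z x * (J * ((φ x)ᴴ)ᵀ)) by
          simp only [Matrix.mul_assoc], Matrix.nonsing_inv_mul_cancel_left _ _ hinv,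
          Matrix.mul_nonsing_inv_cancel_right _ _ hinv2]
    _ = 0 := by rw [hC]; simp

end IsSpatialJost

end VNLS

namespace VNLS

open MeasureTheory Set

/-! ### Jost solutions and their analytic continuation -/

section Volterra

variable {ι : Type} [Fintype ι] {r : ι → ℂ → ℂ} {P : ℝ → ℂ → Matrix ι ι ℂ} {S : Set ℂ}
  {v : ι → ℂ}

lemma IsVolterra.mono {p : ℝ → ℝ} (h : IsVolterra r P S p) {S' : Set ℂ} (hS : S' ⊆ S) :
    IsVolterra r P S' p :=
  ⟨h.cont, h.nonneg, h.integrable, fun z hz => h.re_nonpos z (hS hz),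
    fun z hz => h.bound z (hS hz), fun z hz => h.cont_x z (hS hz)⟩

lemma isVolterra_of_entry_bound {g : ℝ → ℝ} (hg : Continuous g) (hg0 : ∀ x, 0 ≤ g x)
    (hgi : ∀ x, IntegrableOn g (Iic x)) (hre : ∀ z ∈ S, ∀ j, (r j z).re ≤ 0)
    (hb : ∀ z ∈ S, ∀ x i j, ‖P x z i j‖ ≤ g x)
    (hc : ∀ z ∈ S, ∀ i j, Continuous fun x => P x z i j) :
    IsVolterra r P S fun x => (Fintype.card ι : ℝ) ^ 2 * g x := by
  refine ⟨hg.const_mul _, fun x => mul_nonneg (by positivity) (hg0 x),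
    fun x => (hgi x).const_mul _, hre, fun z hz x w => (norm_mulVec_le_sum _ _).trans ?_, hc⟩
  refine mul_le_mul_of_nonneg_right ?_ (norm_nonneg _)
  calc ∑ i, ∑ j, ‖P x z i j‖ ≤ ∑ _i : ι, ∑ _j : ι, g x :=
        Finset.sum_le_sum fun i _ => Finset.sum_le_sum fun j _ => hb z hz x i j
    _ = _ := by simp; ring

end Volterra

/-- The closed upper half-plane without the origin and the zeros of `γ`. -/
def closedUpper (qo : ℝ) : Set ℂ := {z | 0 ≤ z.im ∧ z ≠ 0 ∧ gam qo z ≠ 0}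

/-- The plane without the origin and the zeros of `γ`. -/
def regularPlane (qo : ℝ) : Set ℂ := {z | z ≠ 0 ∧ gam qo z ≠ 0}

/-- `f`, defined on the real axis without `0, ±qₒ`, is the boundary value of a function analytic in
the open half-plane `H`. -/
def HasExt (qo : ℝ) (H : Set ℂ) (f : ℝ → ℂ) : Prop :=
  ∃ F : ℂ → ℂ, DifferentiableOn ℂ F H ∧
    ∀ s : ℝ, s ≠ 0 → gam qo s ≠ 0 → Tendsto F (𝓝[H] (s : ℂ)) (𝓝 (f s))

lemma isOpen_upper : IsOpen upper := isOpen_lt continuous_const Complex.continuous_im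

lemma isOpen_lower : IsOpen lower := isOpen_lt Complex.continuous_im continuous_const

lemma ne_zero_of_im {z : ℂ} (h : z.im ≠ 0) : z ≠ 0 := fun h0 => h (by simp [h0])

lemma gam_ne_zero_of_im {qo : ℝ} {z : ℂ} (h : z.im ≠ 0) : gam qo z ≠ 0 :=
  gam_ne_zero (ne_zero_of_im h) (fun h1 => h (by simp [h1])) (fun h1 => h (by simp [h1]))

lemma upper_subset (qo : ℝ) : upper ⊆ closedUpper qo := fun _ hz =>
  ⟨le_of_lt hz, ne_zero_of_im (ne_of_gt hz), gam_ne_zero_of_im (ne_of_gt hz)⟩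

lemma closedUpper_subset (qo : ℝ) : closedUpper qo ⊆ regularPlane qo := fun _ hz => hz.2

lemma ofReal_mem_closedUpper {qo s : ℝ} (h0 : s ≠ 0) (h : gam qo s ≠ 0) :
    (s : ℂ) ∈ closedUpper qo :=
  ⟨by simp, Complex.ofReal_ne_zero.2 h0, h⟩

lemma differentiableOn_gam (qo : ℝ) : DifferentiableOn ℂ (gam qo) {z | z ≠ 0} := by
  unfold gam
  refine (differentiableOn_const _).sub ((differentiableOn_const _).div (by fun_prop) ?_)
  exact fun z hz => pow_ne_zero 2 hz

lemma isOpen_regularPlane (qo : ℝ) : IsOpen (regularPlane qo) := by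
  have h : IsOpen {z : ℂ | z ≠ 0} := isOpen_ne
  exact (differentiableOn_gam qo).continuousOn.isOpen_inter_preimage h
    (isOpen_ne (x := (0 : ℂ)))

lemma differentiableOn_kk (qo : ℝ) : DifferentiableOn ℂ (kk qo) {z | z ≠ 0} := by
  unfold kk
  exact (differentiableOn_id.add ((differentiableOn_const _).div differentiableOn_id
    fun z hz => hz)).div_const _

lemma differentiableOn_lam (qo : ℝ) : DifferentiableOn ℂ (lam qo) {z | z ≠ 0} := by
  unfold lam
  exact (differentiableOn_id.sub ((differentiableOn_const _).div differentiableOn_id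
    fun z hz => hz)).div_const _

lemma differentiableOn_rate (qo : ℝ) (j : Fin 4) :
    DifferentiableOn ℂ (fun z => rate qo z j) {z | z ≠ 0} := by
  have h1 := (differentiableOn_kk qo).const_mul Complex.I
  have h2 := (differentiableOn_lam qo).const_mul Complex.I
  fin_cases j
  · simpa [rate] using h2.neg
  · simpa [rate] using h1
  · simpa [rate] using h1
  · simpa [rate] using h2

lemma differentiableOn_eigE (qo θ : ℝ) (i j : Fin 4) :
    DifferentiableOn ℂ (fun z => eigE qo θ z i j) {z | z ≠ 0} := by
  simp only [eigE, Matrix.sub_apply, Matrix.smul_apply, smul_eq_mul]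
  exact (differentiableOn_const _).sub (((differentiableOn_const _).div differentiableOn_id
    fun z hz => hz).mul_const _)

lemma differentiableOn_eigInv (qo θ : ℝ) (i j : Fin 4) :
    DifferentiableOn ℂ (fun z => eigInv qo θ z i j) (regularPlane qo) := by
  have h1 : DifferentiableOn ℂ (fun z => (gam qo z)⁻¹) (regularPlane qo) :=
    ((differentiableOn_gam qo).mono fun z hz => hz.1).inv fun z hz => hz.2
  have h2 : DifferentiableOn ℂ (fun z : ℂ => Complex.I / z) (regularPlane qo) :=
    (differentiableOn_const _).div differentiableOn_id fun z hz => hz.1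
  have h3 := (h2.mul_const (star (amp qo θ))).mul h1
  have h4 := (h2.mul_const (amp qo θ)).mul h1
  fin_cases i <;> fin_cases j <;> simp [eigInv] <;> first | exact h1 | exact h3 | exact h4

section Extension

variable {ι : Type} [Fintype ι] {r : ι → ℂ → ℂ} {P : ℝ → ℂ → Matrix ι ι ℂ} {v : ι → ℂ} {qo : ℝ}

/-- The solution of a Volterra equation depending analytically on `z` is analytic for `Im z > 0`
and continuous up to the real axis. -/
lemma volterraSol_extension
    (hV : ∀ z0 ∈ closedUpper qo, ∃ B ∈ 𝓝 z0, ∃ p, IsVolterra r P (closedUpper qo ∩ B) p)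
    (hr : ∀ j, DifferentiableOn ℂ (r j) (regularPlane qo))
    (hP : ∀ x i j, DifferentiableOn ℂ (fun z => P x z i j) (regularPlane qo)) (x : ℝ) (j : ι) :
    DifferentiableOn ℂ (fun z => volterraSol r P v x z j) upper ∧
    ∀ s : ℝ, s ≠ 0 → gam qo s ≠ 0 →
      Tendsto (fun z => volterraSol r P v x z j) (𝓝[upper] (s : ℂ))
        (𝓝 (volterraSol r P v x s j)) := by
  constructor
  · intro z0 hz0
    obtain ⟨B, hB, p, h⟩ := hV z0 (upper_subset qo hz0)
    have hsub : upper ∩ interior B ⊆ closedUpper qo ∩ B :=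
      inter_subset_inter (upper_subset qo) interior_subset
    have hsub' : upper ∩ interior B ⊆ regularPlane qo :=
      fun z hz => closedUpper_subset qo (hsub hz).1
    have hopen : IsOpen (upper ∩ interior B) := isOpen_upper.inter isOpen_interior
    have := (h.mono hsub).sol_differentiableOn (v := v) hopen (fun j => (hr j).mono hsub')
      (fun x i j => (hP x i j).mono hsub') x j
    exact (this.differentiableAt (hopen.mem_nhds ⟨hz0, mem_interior_iff_mem_nhds.2 hB⟩))
      |>.differentiableWithinAt
  · intro s h0 hs
    have hmem := ofReal_mem_closedUpper h0 hs
    obtain ⟨B, hB, p, h⟩ := hV s hmem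
    have hsub : closedUpper qo ∩ B ⊆ regularPlane qo :=
      fun z hz => closedUpper_subset qo hz.1
    have := h.sol_continuousOn (v := v) (fun j => ((hr j).mono hsub).continuousOn)
      (fun x i j => ((hP x i j).mono hsub).continuousOn) x j
    have h2 := this s ⟨hmem, mem_of_mem_nhds hB⟩
    refine h2.mono_left (nhdsWithin_le_iff.2 (inter_mem ?_ (mem_nhdsWithin_of_mem_nhds hB)))
    exact mem_of_superset self_mem_nhdsWithin (upper_subset qo)

end Extension

/-- A continuous potential with `u - (0, 0, qₒe^{iθ})` integrable at `-∞`. -/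
structure DecaysLeft (qo θ : ℝ) (u : ℝ → Fin 3 → ℂ) : Prop where
  cont : Continuous u
  integrable : IntegrableOn (fun x => u x - background qo θ) (Iic 0)

/-- The perturbation `E⁻¹ (Q - Q_-) E` of the diagonalized asymptotic equation. -/
def perturb (qo θ : ℝ) (u : ℝ → Fin 3 → ℂ) (x : ℝ) (z : ℂ) : Mat :=
  eigInv qo θ z * Q (u x - background qo θ) * eigE qo θ z

lemma norm_Q_apply_le (v : Fin 3 → ℂ) (i j : Fin 4) : ‖Q v i j‖ ≤ ‖v‖ := by
  have h := norm_le_pi_norm v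
  have h0 := norm_nonneg v
  fin_cases i <;> fin_cases j <;> simp [Q] <;> apply h

lemma norm_mul_mul_apply_le (A B C : Mat) {b : ℝ} (hB : ∀ i j, ‖B i j‖ ≤ b) (i j : Fin 4) :
    ‖(A * B * C) i j‖ ≤ (∑ l, ∑ k, ‖A i k‖ * ‖C l j‖) * b := by
  rw [Matrix.mul_apply, Finset.sum_mul]
  refine (norm_sum_le _ _).trans (Finset.sum_le_sum fun l _ => ?_)
  rw [Matrix.mul_apply, Finset.sum_mul, Finset.sum_mul]
  refine (norm_sum_le _ _).trans (Finset.sum_le_sum fun k _ => ?_)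
  rw [norm_mul, norm_mul]
  have := mul_le_mul_of_nonneg_left (hB k l) (mul_nonneg (norm_nonneg (A i k)) (norm_nonneg (C l j)))
  linarith

section Potential

variable {qo θ : ℝ} {u : ℝ → Fin 3 → ℂ}

lemma DecaysLeft.integrable_norm (hu : DecaysLeft qo θ u) (x : ℝ) :
    IntegrableOn (fun x => ‖u x - background qo θ‖) (Iic x) := by
  have hc : Continuous fun x => ‖u x - background qo θ‖ := (hu.cont.sub continuous_const).norm
  have h1 : IntegrableOn (fun x => ‖u x - background qo θ‖) (Icc 0 x) :=
    hc.continuousOn.integrableOn_Icc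
  refine (IntegrableOn.union hu.integrable.norm h1).mono_set fun y hy => ?_
  rcases le_total y 0 with h | h
  · exact Or.inl h
  · exact Or.inr ⟨h, hy⟩

lemma perturb_locally_bounded (u : ℝ → Fin 3 → ℂ) {z0 : ℂ} (hz : z0 ∈ regularPlane qo) :
    ∃ B ∈ 𝓝 z0, ∃ C, 0 ≤ C ∧ ∀ z ∈ B, ∀ x i j,
      ‖perturb qo θ u x z i j‖ ≤ C * ‖u x - background qo θ‖ := by
  set f : ℂ → ℝ := fun z =>
    ∑ i, ∑ j, ∑ l, ∑ k, ‖eigInv qo θ z i k‖ * ‖eigE qo θ z l j‖ with hf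
  have hfc : ContinuousOn f (regularPlane qo) := by
    refine continuousOn_finsetSum _ fun i _ => continuousOn_finsetSum _ fun j _ =>
      continuousOn_finsetSum _ fun l _ => continuousOn_finsetSum _ fun k _ => ?_
    exact (differentiableOn_eigInv qo θ i k).continuousOn.norm.mul
      ((differentiableOn_eigE qo θ l j).continuousOn.mono fun z hz => hz.1).norm
  have hat : ContinuousAt f z0 := hfc.continuousAt ((isOpen_regularPlane qo).mem_nhds hz)
  refine ⟨{z | f z < f z0 + 1}, hat.eventually_lt continuousAt_const (by linarith), f z0 + 1,
    by positivity, fun z hz x i j => ?_⟩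
  refine (norm_mul_mul_apply_le _ _ _ (norm_Q_apply_le _) i j).trans ?_
  refine mul_le_mul_of_nonneg_right (le_trans ?_ (le_of_lt hz)) (norm_nonneg _)
  refine le_trans ?_ (Finset.single_le_sum (f := fun i => ∑ j, ∑ l, ∑ k,
    ‖eigInv qo θ z i k‖ * ‖eigE qo θ z l j‖) (fun _ _ => by positivity) (Finset.mem_univ i))
  exact Finset.single_le_sum (f := fun j => ∑ l, ∑ k,
    ‖eigInv qo θ z i k‖ * ‖eigE qo θ z l j‖) (fun _ _ => by positivity) (Finset.mem_univ j)

lemma perturb_continuous (hu : DecaysLeft qo θ u) (z : ℂ) (i j : Fin 4) :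
    Continuous fun x => perturb qo θ u x z i j := by
  have hQ : ∀ k l, Continuous fun x => Q (u x - background qo θ) k l := by
    intro k l
    have h : ∀ m, Continuous fun x => (u x - background qo θ) m := fun m =>
      (continuous_apply m).comp (hu.cont.sub continuous_const)
    have h' : ∀ m, Continuous fun x => star ((u x - background qo θ) m) := fun m => (h m).star
    fin_cases k <;> fin_cases l <;> first | exact continuous_const | apply h | apply h'
  simp only [perturb, Matrix.mul_apply]
  fun_prop

lemma perturb_differentiableOn (u : ℝ → Fin 3 → ℂ) (x : ℝ) (i j : Fin 4) :
    DifferentiableOn ℂ (fun z => perturb qo θ u x z i j) (regularPlane qo) := by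
  simp only [perturb, Matrix.mul_apply]
  refine DifferentiableOn.fun_sum fun l _ => DifferentiableOn.mul
    (DifferentiableOn.fun_sum fun k _ => (differentiableOn_eigInv qo θ i k).mul_const _) ?_
  exact (differentiableOn_eigE qo θ l j).mono fun z hz => hz.1

lemma lam_im (qo : ℝ) (z : ℂ) :
    (lam qo z).im = z.im / 2 * (1 + qo ^ 2 / Complex.normSq z) := by
  simp only [lam, div_eq_mul_inv, Complex.mul_im, Complex.sub_im, Complex.sub_re, Complex.inv_re,
    Complex.inv_im, ← Complex.ofReal_pow, Complex.ofReal_re, Complex.ofReal_im]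
  norm_num
  ring

lemma kk_im (qo : ℝ) (z : ℂ) :
    (kk qo z).im = z.im / 2 * (1 - qo ^ 2 / Complex.normSq z) := by
  simp only [kk, div_eq_mul_inv, Complex.mul_im, Complex.add_im, Complex.add_re, Complex.inv_re,
    Complex.inv_im, ← Complex.ofReal_pow, Complex.ofReal_re, Complex.ofReal_im]
  norm_num
  ring

/-- For `Im z ≥ 0` the first exponential `e^{-iλx}` decays fastest at `-∞`. -/
lemma abs_kk_im_le {z : ℂ} (hz : 0 ≤ z.im) : |(kk qo z).im| ≤ (lam qo z).im := by
  rw [lam_im, kk_im, abs_le]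
  have h1 : 0 ≤ qo ^ 2 / Complex.normSq z := div_nonneg (sq_nonneg _) (Complex.normSq_nonneg _)
  constructor <;> nlinarith [mul_nonneg hz h1]

lemma eigE_mul_perturb (θ : ℝ) (u : ℝ → Fin 3 → ℂ) {z : ℂ} (h0 : z ≠ 0) (hγ : gam qo z ≠ 0)
    (x : ℝ) :
    eigE qo θ z * (diagonal (rate qo z) + perturb qo θ u x z) =
      spatialX qo (u x) z * eigE qo θ z := by
  have h1 := spatialX_background_mul_eigE qo θ h0
  have h2 : spatialX qo (u x) z =
      spatialX qo (background qo θ) z + Q (u x - background qo θ) := by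
    rw [spatialX, spatialX, add_assoc, ← Q_add, add_sub_cancel]
  rw [h2, mul_add, ← h1, perturb, ← Matrix.mul_assoc, ← Matrix.mul_assoc,
    eigE_mul_eigInv qo θ hγ, Matrix.one_mul, add_mul]

end Potential

end VNLS

namespace VNLS

open MeasureTheory Set

lemma hasMatDerivAt_expRate (qo : ℝ) (z : ℂ) (x : ℝ) :
    HasMatDerivAt (fun x => expRate qo z x) (diagonal (rate qo z) * expRate qo z x) x := by
  intro i j
  rw [Matrix.diagonal_mul]
  rcases eq_or_ne i j with rfl | hij
  · simp only [expRate, diagonal_apply_eq]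
    have := ((hasDerivAt_id (x : ℂ)).const_mul (rate qo z i)).cexp.comp_ofReal
    simpa [mul_comm] using this
  · simpa [expRate, diagonal_apply_ne _ hij] using hasDerivAt_const x (0 : ℂ)

section Potential

variable {qo θ : ℝ} {u : ℝ → Fin 3 → ℂ}

lemma isVolterra_perturb (hu : DecaysLeft qo θ u) {S : Set ℂ} {C : ℝ} (hC : 0 ≤ C)
    (hb : ∀ z ∈ S, ∀ x i j, ‖perturb qo θ u x z i j‖ ≤ C * ‖u x - background qo θ‖) (i : Fin 4)
    (hre : ∀ z ∈ S, ∀ j, (rate qo z j - rate qo z i).re ≤ 0) :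
    IsVolterra (fun j z => rate qo z j - rate qo z i) (perturb qo θ u) S
      fun x => (Fintype.card (Fin 4) : ℝ) ^ 2 * (C * ‖u x - background qo θ‖) :=
  isVolterra_of_entry_bound ((hu.cont.sub continuous_const).norm.const_mul C)
    (fun _ => mul_nonneg hC (norm_nonneg _)) (fun x => (hu.integrable_norm x).const_mul C) hre hb
    fun z _ => perturb_continuous hu z

/-- The normalized Jost solution `E⁻¹ φ e^{-Dx}`, column by column the solution of a Volterra
equation. -/
def jostCore (qo θ : ℝ) (u : ℝ → Fin 3 → ℂ) (x : ℝ) (z : ℂ) : Mat :=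
  of fun j i => volterraSol (fun j z => rate qo z j - rate qo z i) (perturb qo θ u) (Pi.single i 1)
    x z j

/-- The Jost solution normalized at `-∞`. -/
def leftJost (qo θ : ℝ) (u : ℝ → Fin 3 → ℂ) (s x : ℝ) : Mat :=
  eigE qo θ s * jostCore qo θ u x s * expRate qo s x

lemma isVolterra_real (hu : DecaysLeft qo θ u) {s : ℝ} (h0 : s ≠ 0) (hs : gam qo s ≠ 0)
    (i : Fin 4) : ∃ p, IsVolterra (fun j z => rate qo z j - rate qo z i) (perturb qo θ u) {(s : ℂ)}
      p := by
  obtain ⟨B, hB, C, hC, hb⟩ := perturb_locally_bounded (θ := θ) u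
    (closedUpper_subset qo (ofReal_mem_closedUpper h0 hs))
  refine ⟨_, isVolterra_perturb hu hC (S := {(s : ℂ)})
    (fun z hz => hb z (mem_singleton_iff.1 hz ▸ mem_of_mem_nhds hB)) i ?_⟩
  rintro z rfl j
  rw [Complex.sub_re, rate_re, rate_re, sub_zero]

/-- On the real axis all exponentials in the Volterra kernels are oscillating, so that every column of
the Jost solution exists. -/
theorem isSpatialJost_leftJost (hu : DecaysLeft qo θ u) {s : ℝ} (h0 : s ≠ 0)
    (hs : gam qo s ≠ 0) : IsSpatialJost qo θ u atBot s (leftJost qo θ u s) := by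
  have h0' : (s : ℂ) ≠ 0 := Complex.ofReal_ne_zero.2 h0
  have hW : ∀ x, HasMatDerivAt (fun x => jostCore qo θ u x s)
      (diagonal (rate qo s) * jostCore qo θ u x s - jostCore qo θ u x s * diagonal (rate qo s)
        + perturb qo θ u x s * jostCore qo θ u x s) x := by
    intro x j i
    obtain ⟨p, h⟩ := isVolterra_real hu h0 hs i
    refine (h.hasDerivAt_sol (v := Pi.single i 1) (mem_singleton _) x j).congr_deriv ?_
    have e : (rate qo s j - rate qo s i) * (Pi.single i 1 : Fin 4 → ℂ) j = 0 := by
      rcases eq_or_ne j i with rfl | h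
      · simp
      · simp [h]
    rw [Matrix.add_apply, Matrix.sub_apply, diagonal_mul, mul_diagonal, mul_sub, e]
    simp only [jostCore, of_apply, Matrix.mul_apply, mulVec, dotProduct]
    ring
  refine IsSpatialJost.of_tendsto_mul_exp (fun x => ?_) ?_
  · refine (((hW x).const_mul (eigE qo θ s)).mul (hasMatDerivAt_expRate qo s x)).congr_deriv ?_
    have e := eigE_mul_perturb θ u h0' hs x
    rw [leftJost, show spatialX qo (u x) s * (eigE qo θ s * jostCore qo θ u x s * expRate qo s x) =
      eigE qo θ s * (diagonal (rate qo s) + perturb qo θ u x s) * jostCore qo θ u x s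
        * expRate qo s x by rw [e]; simp only [Matrix.mul_assoc]]
    noncomm_ring
  · have : ∀ x, leftJost qo θ u s x * expRate qo s (-x) = eigE qo θ s * jostCore qo θ u x s := by
      intro x
      rw [leftJost, Matrix.mul_assoc, expRate_mul_expRate_neg, Matrix.mul_one]
    simp only [this]
    have hlim : Tendsto (fun x => jostCore qo θ u x s) atBot (𝓝 1) := by
      refine tendsto_matrix_of_entries fun j i => ?_
      obtain ⟨p, h⟩ := isVolterra_real hu h0 hs i
      have := h.tendsto_sol (v := Pi.single i 1) (mem_singleton _) j
      rwa [show (Pi.single i 1 : Fin 4 → ℂ) j = (1 : Mat) j i by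
        simp [Pi.single_apply, Matrix.one_apply]] at this
    simpa using (tendsto_const_nhds (x := eigE qo θ s)).mul hlim

/-! ### The antisymmetric square of the spatial equation -/

/-- The growth rates of the antisymmetric square relative to the pair `{1, j}`. The component
`(1,1)` vanishes on antisymmetric tensors, so its rate may be set to `0`. -/
def wedgeRate (qo : ℝ) (j : Fin 4) (p : Fin 4 × Fin 4) (z : ℂ) : ℂ :=
  if p = (0, 0) then 0 else rate qo z p.1 + rate qo z p.2 - rate qo z 0 - rate qo z j

/-- The matrix of `W ↦ P W + W Pᵀ` for the perturbation `P`. -/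
def wedgePerturb (qo θ : ℝ) (u : ℝ → Fin 3 → ℂ) (x : ℝ) (z : ℂ) :
    Matrix (Fin 4 × Fin 4) (Fin 4 × Fin 4) ℂ :=
  of fun p q => perturb qo θ u x z p.1 q.1 * (1 : Mat) p.2 q.2
    + (1 : Mat) p.1 q.1 * perturb qo θ u x z p.2 q.2

/-- The tensor `e₁ ∧ e_j`, as an antisymmetric matrix. -/
def wedge (j : Fin 4) : Mat := of fun a b => if a = 0 ∧ b = j then 1 else if a = j ∧ b = 0 then -1 else 0

/-- The solution of the antisymmetric square which is asymptotic to `e₁ ∧ e_j` at `-∞`. -/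
def wedgeCore (qo θ : ℝ) (u : ℝ → Fin 3 → ℂ) (j : Fin 4) (x : ℝ) (z : ℂ) : Mat :=
  of fun a b => volterraSol (wedgeRate qo j) (wedgePerturb qo θ u) (fun p => wedge j p.1 p.2) x z
    (a, b)

lemma wedgePerturb_mulVec (x : ℝ) (z : ℂ) (w : Fin 4 × Fin 4 → ℂ) (a b : Fin 4) :
    (wedgePerturb qo θ u x z *ᵥ w) (a, b) =
      (perturb qo θ u x z * of fun a b => w (a, b)) a b
        + ((of fun a b => w (a, b)) * (perturb qo θ u x z)ᵀ) a b := by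
  simp only [mulVec, dotProduct, Fintype.sum_prod_type, wedgePerturb, of_apply, Matrix.mul_apply,
    add_mul, Finset.sum_add_distrib, Matrix.one_apply, transpose_apply, mul_ite, mul_one, mul_zero,
    ite_mul, one_mul, zero_mul, Finset.sum_ite_eq, Finset.mem_univ, if_true]
  congr 1
  rw [Finset.sum_comm]
  simp [mul_comm]

lemma isVolterra_wedge (hu : DecaysLeft qo θ u) {S : Set ℂ} {C : ℝ} (hC : 0 ≤ C)
    (hb : ∀ z ∈ S, ∀ x i j, ‖perturb qo θ u x z i j‖ ≤ C * ‖u x - background qo θ‖) (j : Fin 4)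
    (hre : ∀ z ∈ S, ∀ p, (wedgeRate qo j p z).re ≤ 0) :
    IsVolterra (wedgeRate qo j) (wedgePerturb qo θ u) S
      fun x => (Fintype.card (Fin 4 × Fin 4) : ℝ) ^ 2 * (2 * C * ‖u x - background qo θ‖) := by
  refine isVolterra_of_entry_bound ((hu.cont.sub continuous_const).norm.const_mul _)
    (fun x => by positivity) (fun x => (hu.integrable_norm x).const_mul _) hre
    (fun z hz x p q => ?_) fun z _ p q => ?_
  · have h1 : ∀ a b : Fin 4, ‖(1 : Mat) a b‖ ≤ 1 := by
      intro a b
      rw [Matrix.one_apply]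
      split_ifs <;> simp
    have h2 := hb z hz x p.1 q.1
    have h3 := hb z hz x p.2 q.2
    refine (norm_add_le _ _).trans ?_
    rw [norm_mul, norm_mul]
    have e1 := mul_le_mul h2 (h1 p.2 q.2) (norm_nonneg _) ((norm_nonneg _).trans h2)
    have e2 := mul_le_mul (h1 p.1 q.1) h3 (norm_nonneg _) zero_le_one
    linarith
  · simp only [wedgePerturb, of_apply]
    exact ((perturb_continuous hu z _ _).mul_const _).add ((perturb_continuous hu z _ _).const_mul _)

lemma wedge_antisymm (j : Fin 4) (hj : j ≠ 0) (a b : Fin 4) : wedge j a b = -wedge j b a := by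
  have h2 : ¬(0 : Fin 4) = j := Ne.symm hj
  simp only [wedge, of_apply]
  by_cases h1 : a = 0 <;> by_cases h3 : b = 0 <;> by_cases h4 : a = j <;> by_cases h5 : b = j <;>
    simp_all

lemma wedgeCore_antisymm {j : Fin 4} (hj : j ≠ 0) (x : ℝ) (z : ℂ) (a b : Fin 4) :
    wedgeCore qo θ u j x z a b = -wedgeCore qo θ u j x z b a := by
  have key : ∀ n x a b, volterraIter (wedgeRate qo j) (wedgePerturb qo θ u)
      (fun p => wedge j p.1 p.2) n x z (a, b) = -volterraIter (wedgeRate qo j)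
        (wedgePerturb qo θ u) (fun p => wedge j p.1 p.2) n x z (b, a) := by
    intro n
    induction n with
    | zero => exact fun x a b => wedge_antisymm j hj a b
    | succ n ih =>
      intro x a b
      simp only [volterraIter]
      rw [← integral_neg]
      congr 1
      funext y
      have hr : wedgeRate qo j (a, b) z = wedgeRate qo j (b, a) z := by
        simp only [wedgeRate, Prod.mk.injEq, and_comm (a := a = 0), add_comm (rate qo z a)]
      rw [hr, ← mul_neg, wedgePerturb_mulVec, wedgePerturb_mulVec]
      congr 1
      simp only [Matrix.mul_apply, of_apply, transpose_apply]
      rw [neg_add_rev, ← Finset.sum_neg_distrib, ← Finset.sum_neg_distrib]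
      congr 1
      · refine Finset.sum_congr rfl fun c _ => ?_
        rw [ih y c b]; ring
      · refine Finset.sum_congr rfl fun c _ => ?_
        rw [ih y a c]; ring
  simp only [wedgeCore, of_apply, volterraSol]
  rw [← tsum_neg]
  exact tsum_congr fun n => key n x a b

/-- For real `z`, the antisymmetric square solution is `φ₁ ∧ φ_j`. -/
theorem wedge_leftJost (hu : DecaysLeft qo θ u) {s : ℝ} (h0 : s ≠ 0) (hs : gam qo s ≠ 0)
    {j : Fin 4} (hj : j ≠ 0) {φ : ℝ → Mat} (hφ : IsSpatialJost qo θ u atBot s φ) (x : ℝ) :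
    φ x * wedge j * (φ x)ᵀ = Complex.exp ((rate qo s 0 + rate qo s j) * x) •
      (eigE qo θ s * wedgeCore qo θ u j x s * (eigE qo θ s)ᵀ) := by
  have h0' : (s : ℂ) ≠ 0 := Complex.ofReal_ne_zero.2 h0
  obtain ⟨p, hV⟩ : ∃ p, IsVolterra (wedgeRate qo j) (wedgePerturb qo θ u) {(s : ℂ)} p := by
    obtain ⟨B, hB, C, hC, hb⟩ := perturb_locally_bounded (θ := θ) u
      (closedUpper_subset qo (ofReal_mem_closedUpper h0 hs))
    refine ⟨_, isVolterra_wedge hu hC (S := {(s : ℂ)})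
      (fun z hz => hb z (mem_singleton_iff.1 hz ▸ mem_of_mem_nhds hB)) j ?_⟩
    rintro z rfl p
    rw [wedgeRate]
    split_ifs
    · simp
    · simp [rate_re]
  set W := fun x => wedgeCore qo θ u j x s with hWdef
  set e : ℝ → ℂ := fun x => Complex.exp ((rate qo s 0 + rate qo s j) * x) with he
  have hW00 : ∀ x, W x 0 0 = 0 := by
    intro x
    have := wedgeCore_antisymm (qo := qo) (θ := θ) (u := u) hj x s 0 0
    exact self_eq_neg.1 this
  have hW : ∀ x, HasMatDerivAt W (diagonal (rate qo s) * W x + W x * diagonal (rate qo s)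
      - (rate qo s 0 + rate qo s j) • W x
      + (perturb qo θ u x s * W x + W x * (perturb qo θ u x s)ᵀ)) x := by
    intro x a b
    refine (hV.hasDerivAt_sol (v := fun p => wedge j p.1 p.2) (mem_singleton _) x
      (a, b)).congr_deriv ?_
    rw [wedgePerturb_mulVec, Matrix.add_apply, Matrix.add_apply, Matrix.sub_apply,
      Matrix.add_apply, diagonal_mul, mul_diagonal, Matrix.smul_apply, smul_eq_mul]
    refine congrArg₂ (· + ·) ?_ rfl
    change wedgeRate qo j (a, b) s * (W x a b - wedge j a b) = _
    by_cases hab : a = 0 ∧ b = 0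
    · obtain ⟨rfl, rfl⟩ := hab
      rw [hW00]
      simp [wedgeRate]
    · have e1 : wedgeRate qo j (a, b) s =
          rate qo s a + rate qo s b - rate qo s 0 - rate qo s j := by
        simp [wedgeRate, hab]
      have e2 : (rate qo s a + rate qo s b - rate qo s 0 - rate qo s j) * wedge j a b = 0 := by
        simp only [wedge, of_apply]
        split_ifs with h1 h2
        · rw [h1.1, h1.2]; ring
        · rw [h2.1, h2.2]; ring
        · ring
      rw [e1, mul_sub, e2]
      ring
  have hE := eigE_mul_perturb θ u h0' hs
  have hder : ∀ x, HasMatDerivAt (fun x => e x • (eigE qo θ s * W x * (eigE qo θ s)ᵀ))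
      (spatialX qo (u x) s * (e x • (eigE qo θ s * W x * (eigE qo θ s)ᵀ))
        + (e x • (eigE qo θ s * W x * (eigE qo θ s)ᵀ)) * (spatialX qo (u x) s)ᵀ) x := by
    intro x
    have hed : HasDerivAt e ((rate qo s 0 + rate qo s j) * e x) x := by
      have := ((hasDerivAt_id (x : ℂ)).const_mul (rate qo s 0 + rate qo s j)).cexp.comp_ofReal
      simpa [he, mul_comm] using this
    have h1 := ((hW x).const_mul (eigE qo θ s)).mul_const (eigE qo θ s)ᵀ
    have hmat : spatialX qo (u x) s * (e x • (eigE qo θ s * W x * (eigE qo θ s)ᵀ))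
        + (e x • (eigE qo θ s * W x * (eigE qo θ s)ᵀ)) * (spatialX qo (u x) s)ᵀ =
        ((rate qo s 0 + rate qo s j) * e x) • (eigE qo θ s * W x * (eigE qo θ s)ᵀ)
        + e x • (eigE qo θ s * (diagonal (rate qo s) * W x + W x * diagonal (rate qo s)
          - (rate qo s 0 + rate qo s j) • W x
          + (perturb qo θ u x s * W x + W x * (perturb qo θ u x s)ᵀ)) * (eigE qo θ s)ᵀ) := by
      have hEx := hE x
      have hEt : ((diagonal (rate qo s))ᵀ + (perturb qo θ u x s)ᵀ) * (eigE qo θ s)ᵀ =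
          (eigE qo θ s)ᵀ * (spatialX qo (u x) s)ᵀ := by
        rw [← transpose_add, ← transpose_mul, hEx, transpose_mul]
      rw [diagonal_transpose] at hEt
      have l1 : spatialX qo (u x) s * (eigE qo θ s * W x * (eigE qo θ s)ᵀ) =
          eigE qo θ s * (diagonal (rate qo s) + perturb qo θ u x s) * W x * (eigE qo θ s)ᵀ := by
        rw [hEx]; simp only [Matrix.mul_assoc]
      have l2 : (eigE qo θ s * W x * (eigE qo θ s)ᵀ) * (spatialX qo (u x) s)ᵀ =
          eigE qo θ s * W x * ((diagonal (rate qo s) + (perturb qo θ u x s)ᵀ)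
            * (eigE qo θ s)ᵀ) := by
        rw [hEt]; simp only [Matrix.mul_assoc]
      rw [mul_smul_comm, smul_mul_assoc, l1, l2, ← smul_add, mul_comm (rate qo s 0 + rate qo s j),
        mul_smul, ← smul_add]
      congr 1
      simp only [mul_add, add_mul, mul_sub, sub_mul, Matrix.mul_assoc, mul_smul_comm,
        smul_mul_assoc]
      abel
    rw [hmat]
    intro a b
    exact (hed.mul (h1 a b))
  have hlimW : Tendsto W atBot (𝓝 (wedge j)) := by
    refine tendsto_matrix_of_entries fun a b => ?_
    exact hV.tendsto_sol (v := fun p => wedge j p.1 p.2) (mem_singleton _) (a, b)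
  have hφe : ∀ x, φ x * wedge j * (φ x)ᵀ = e x • ((φ x * expRate qo s (-x)) * wedge j
      * (φ x * expRate qo s (-x))ᵀ) := by
    intro x
    have h1 : expRate qo s x * wedge j * (expRate qo s x)ᵀ = e x • wedge j := by
      rw [show (expRate qo s x)ᵀ = expRate qo s x from diagonal_transpose _]
      ext a b
      rw [mul_expRate_apply, expRate_mul_apply, Matrix.smul_apply, smul_eq_mul]
      simp only [wedge, of_apply, he]
      split_ifs with h1 h2
      · rw [h1.1, h1.2, add_mul, Complex.exp_add]; ring
      · rw [h2.1, h2.2, add_mul, Complex.exp_add]; ring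
      · ring
    calc φ x * wedge j * (φ x)ᵀ
        = ((φ x * expRate qo s (-x)) * expRate qo s x) * wedge j
          * ((φ x * expRate qo s (-x)) * expRate qo s x)ᵀ := by
          rw [← IsSpatialJost.eq_mul_exp (s := s) φ x]
      _ = (φ x * expRate qo s (-x)) * (expRate qo s x * wedge j * (expRate qo s x)ᵀ)
          * (φ x * expRate qo s (-x))ᵀ := by
          rw [transpose_mul _ (expRate qo s x)]; simp only [Matrix.mul_assoc]
      _ = _ := by rw [h1, mul_smul_comm, smul_mul_assoc]
  have hzero := hφ.eq_zero_of_bilinear hs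
    (Z := fun x => φ x * wedge j * (φ x)ᵀ - e x • (eigE qo θ s * W x * (eigE qo θ s)ᵀ))
    (fun x => ?_) ?_ x
  · exact sub_eq_zero.1 hzero
  · have h1 := ((hφ.deriv x).mul_const (wedge j)).mul (hφ.deriv x).transpose
    have h2 := hder x
    have h3 : HasMatDerivAt (fun x => φ x * wedge j * (φ x)ᵀ -
        e x • (eigE qo θ s * W x * (eigE qo θ s)ᵀ)) _ x := fun a b => (h1 a b).sub (h2 a b)
    refine h3.congr_deriv (Ψ' := _) ?_
    rw [transpose_mul]
    change (_ - _ : Mat) = _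
    noncomm_ring
  · have hc1 : Tendsto (fun x => (φ x * expRate qo s (-x)) * wedge j
        * (φ x * expRate qo s (-x))ᵀ - eigE qo θ s * W x * (eigE qo θ s)ᵀ) atBot (𝓝 0) := by
      have t1 := hφ.tendsto_mul_exp
      have t2 : Tendsto (fun x => (φ x * expRate qo s (-x))ᵀ) atBot (𝓝 (eigE qo θ s)ᵀ) :=
        ((continuous_id.matrix_transpose).tendsto _).comp t1
      have t3 := ((t1.mul (tendsto_const_nhds (x := wedge j))).mul t2).sub
        (((tendsto_const_nhds (x := eigE qo θ s)).mul hlimW).mul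
          (tendsto_const_nhds (x := (eigE qo θ s)ᵀ)))
      simpa using t3
    refine tendsto_zero_of_norm_entries hc1 fun x a b => ?_
    rw [hφe, ← smul_sub, Matrix.smul_apply, smul_eq_mul, norm_mul]
    have : ‖e x‖ = 1 := by
      simp only [he, add_mul, Complex.exp_add, norm_mul, norm_exp_rate, mul_one]
    rw [this, one_mul]

end Potential

end VNLS

namespace VNLS

open MeasureTheory Set

namespace HasExt

variable {qo : ℝ} {H : Set ℂ} {f g : ℝ → ℂ}

lemma congr (hf : HasExt qo H f) (h : ∀ s : ℝ, s ≠ 0 → gam qo s ≠ 0 → f s = g s) :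
    HasExt qo H g := by
  obtain ⟨F, hF, hl⟩ := hf
  exact ⟨F, hF, fun s h0 hs => h s h0 hs ▸ hl s h0 hs⟩

lemma const (c : ℂ) : HasExt qo H fun _ => c :=
  ⟨fun _ => c, differentiableOn_const _, fun _ _ _ => tendsto_const_nhds⟩

lemma add (hf : HasExt qo H f) (hg : HasExt qo H g) : HasExt qo H fun s => f s + g s := by
  obtain ⟨F, hF, hFl⟩ := hf
  obtain ⟨G, hG, hGl⟩ := hg
  exact ⟨fun z => F z + G z, hF.add hG, fun s h0 hs => (hFl s h0 hs).add (hGl s h0 hs)⟩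

lemma mul (hf : HasExt qo H f) (hg : HasExt qo H g) : HasExt qo H fun s => f s * g s := by
  obtain ⟨F, hF, hFl⟩ := hf
  obtain ⟨G, hG, hGl⟩ := hg
  exact ⟨fun z => F z * G z, hF.mul hG, fun s h0 hs => (hFl s h0 hs).mul (hGl s h0 hs)⟩

lemma const_mul (c : ℂ) (hf : HasExt qo H f) : HasExt qo H fun s => c * f s := (const c).mul hf

lemma neg (hf : HasExt qo H f) : HasExt qo H fun s => -f s :=
  (hf.const_mul (-1)).congr fun s _ _ => by ring

lemma sub (hf : HasExt qo H f) (hg : HasExt qo H g) : HasExt qo H fun s => f s - g s :=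
  (hf.add hg.neg).congr fun s _ _ => by ring

lemma sum {α : Type*} (t : Finset α) {f : α → ℝ → ℂ} (h : ∀ a ∈ t, HasExt qo H (f a)) :
    HasExt qo H fun s => ∑ a ∈ t, f a s := by
  classical
  induction t using Finset.induction_on with
  | empty => simpa using const 0
  | insert a t ha ih =>
    simp only [Finset.sum_insert ha]
    exact (h a (Finset.mem_insert_self a t)).add
      (ih fun b hb => h b (Finset.mem_insert_of_mem hb))

lemma of_differentiableOn {F : ℂ → ℂ} (hF : DifferentiableOn ℂ F (regularPlane qo))
    (hH : H ⊆ regularPlane qo) : HasExt qo H fun s => F s := by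
  refine ⟨F, hF.mono hH, fun s h0 hs => ?_⟩
  have hmem : (s : ℂ) ∈ regularPlane qo := ⟨Complex.ofReal_ne_zero.2 h0, hs⟩
  exact ((hF.continuousOn.continuousAt ((isOpen_regularPlane qo).mem_nhds hmem)).tendsto).mono_left
    nhdsWithin_le_nhds

/-- Pullback of boundary values along a holomorphic map between half-planes. -/
lemma comp {H' : Set ℂ} (hf : HasExt qo H f) {m : ℂ → ℂ} {mr : ℝ → ℝ}
    (hm : DifferentiableOn ℂ m {z | z ≠ 0}) (hH' : ∀ z ∈ H', z ≠ 0) (hmaps : MapsTo m H' H)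
    (hr : ∀ s : ℝ, s ≠ 0 → gam qo s ≠ 0 → m s = mr s ∧ mr s ≠ 0 ∧ gam qo (mr s) ≠ 0) :
    HasExt qo H' fun s => f (mr s) := by
  obtain ⟨F, hF, hl⟩ := hf
  refine ⟨F ∘ m, hF.comp (hm.mono hH') hmaps, fun s h0 hs => ?_⟩
  obtain ⟨e, h1, h2⟩ := hr s h0 hs
  refine (hl (mr s) h1 h2).comp (tendsto_nhdsWithin_iff.2 ⟨?_, ?_⟩)
  · rw [← e]
    have : ContinuousAt m s := hm.continuousOn.continuousAt
      (isOpen_ne.mem_nhds (Complex.ofReal_ne_zero.2 h0))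
    exact this.tendsto.mono_left nhdsWithin_le_nhds
  · filter_upwards [self_mem_nhdsWithin] with z hz using hmaps hz

end HasExt

lemma upper_subset_regularPlane (qo : ℝ) : upper ⊆ regularPlane qo :=
  (upper_subset qo).trans (closedUpper_subset qo)

lemma lower_subset_regularPlane (qo : ℝ) : lower ⊆ regularPlane qo := fun _ hz =>
  ⟨ne_zero_of_im (ne_of_lt hz), gam_ne_zero_of_im (ne_of_lt hz)⟩

section Extension

variable {qo θ : ℝ} {u : ℝ → Fin 3 → ℂ} {φ : ℝ → ℝ → Mat}

lemma rate_re_eq (z : ℂ) (j : Fin 4) : (rate qo z j).re =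
    ![(lam qo z).im, -(kk qo z).im, -(kk qo z).im, -(lam qo z).im] j := by
  fin_cases j <;> simp [rate]

lemma hasExt_exp_rate {H : Set ℂ} (hH : H ⊆ regularPlane qo) (j : Fin 4) (x : ℝ) :
    HasExt qo H fun s => Complex.exp (rate qo s j * x) :=
  HasExt.of_differentiableOn (F := fun z => Complex.exp (rate qo z j * x))
    ((((differentiableOn_rate qo j).mono fun _ hz => hz.1).mul_const _).cexp) hH

lemma hasExt_eigE {H : Set ℂ} (hH : H ⊆ regularPlane qo) (i j : Fin 4) :
    HasExt qo H fun s => eigE qo θ s i j :=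
  HasExt.of_differentiableOn (F := fun z => eigE qo θ z i j)
    ((differentiableOn_eigE qo θ i j).mono fun _ hz => hz.1) hH

/-- The first column of the Jost solution normalized at `-∞` extends to `Im z > 0`. -/
theorem hasExt_jost_zero (hu : DecaysLeft qo θ u)
    (hφ : ∀ s : ℝ, s ≠ 0 → gam qo s ≠ 0 → IsSpatialJost qo θ u atBot s (φ s)) (x : ℝ)
    (i : Fin 4) : HasExt qo upper fun s => φ s x i 0 := by
  have hH := upper_subset_regularPlane qo
  have hcore : ∀ j, HasExt qo upper fun s => jostCore qo θ u x s j 0 := by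
    intro j
    refine ⟨fun z => jostCore qo θ u x z j 0, volterraSol_extension (v := Pi.single 0 1)
      (fun z0 hz0 => ?_) (fun j => ?_) (fun x i j => perturb_differentiableOn u x i j) x j⟩
    · obtain ⟨B, hB, C, hC, hb⟩ := perturb_locally_bounded (θ := θ) u (closedUpper_subset qo hz0)
      refine ⟨B, hB, _, isVolterra_perturb hu hC (fun z hz => hb z hz.2) 0 fun z hz j => ?_⟩
      have h := abs_le.1 (abs_kk_im_le (qo := qo) hz.1.1)
      rw [Complex.sub_re, rate_re_eq, rate_re_eq]
      fin_cases j <;> simp <;> linarith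
    · exact ((differentiableOn_rate qo j).sub (differentiableOn_rate qo 0)).mono fun _ hz => hz.1
  have h : HasExt qo upper fun s => (∑ j, eigE qo θ s i j * jostCore qo θ u x s j 0)
      * Complex.exp (rate qo s 0 * x) :=
    (HasExt.sum _ fun j _ => (hasExt_eigE hH i j).mul (hcore j)).mul (hasExt_exp_rate hH 0 x)
  refine h.congr fun s h0 hs => ?_
  rw [(hφ s h0 hs).unique (isSpatialJost_leftJost hu h0 hs) hs, leftJost, mul_expRate_apply,
    Matrix.mul_apply]

lemma mul_wedge_mul_transpose (M : Mat) {j : Fin 4} (hj : j ≠ 0) (a b : Fin 4) :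
    (M * wedge j * Mᵀ) a b = M a 0 * M b j - M a j * M b 0 := by
  simp only [Matrix.mul_apply, transpose_apply, wedge, of_apply, Fin.sum_univ_four]
  fin_cases j <;> simp at hj ⊢ <;> ring

/-- The `2 × 2` minors of the columns `1, 2` and `1, 3` of the Jost solution normalized at `-∞`
extend to `Im z > 0`: for these two pairs the sum of the growth rates is extremal. -/
theorem hasExt_jost_wedge (hu : DecaysLeft qo θ u)
    (hφ : ∀ s : ℝ, s ≠ 0 → gam qo s ≠ 0 → IsSpatialJost qo θ u atBot s (φ s)) (x : ℝ)
    {j : Fin 4} (hj : j = 1 ∨ j = 2) (a b : Fin 4) :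
    HasExt qo upper fun s => φ s x a 0 * φ s x b j - φ s x a j * φ s x b 0 := by
  have hH := upper_subset_regularPlane qo
  have hj0 : j ≠ 0 := by rcases hj with rfl | rfl <;> decide
  have hcore : ∀ a b, HasExt qo upper fun s => wedgeCore qo θ u j x s a b := by
    intro a b
    refine ⟨fun z => wedgeCore qo θ u j x z a b, volterraSol_extension
      (r := wedgeRate qo j) (P := wedgePerturb qo θ u) (v := fun p => wedge j p.1 p.2)
      (fun z0 hz0 => ?_) (fun p => ?_) (fun x p q => ?_) x (a, b)⟩
    · obtain ⟨B, hB, C, hC, hb⟩ := perturb_locally_bounded (θ := θ) u (closedUpper_subset qo hz0)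
      refine ⟨B, hB, _, isVolterra_wedge hu hC (fun z hz => hb z hz.2) j fun z hz p => ?_⟩
      have h := abs_le.1 (abs_kk_im_le (qo := qo) hz.1.1)
      rw [wedgeRate]
      split_ifs with hp
      · simp
      · rw [Complex.sub_re, Complex.sub_re, Complex.add_re, rate_re_eq, rate_re_eq, rate_re_eq,
          rate_re_eq]
        obtain ⟨p1, p2⟩ := p
        rcases hj with rfl | rfl <;> fin_cases p1 <;> fin_cases p2 <;> simp at hp ⊢ <;> linarith
    · unfold wedgeRate
      split_ifs
      · exact differentiableOn_const _
      · exact ((((differentiableOn_rate qo _).add (differentiableOn_rate qo _)).sub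
          (differentiableOn_rate qo 0)).sub (differentiableOn_rate qo j)).mono fun _ hz => hz.1
    · simp only [wedgePerturb, of_apply]
      exact ((perturb_differentiableOn u x _ _).mul_const _).add
        ((perturb_differentiableOn u x _ _).const_mul _)
  have h : HasExt qo upper fun s => (Complex.exp (rate qo s 0 * x) * Complex.exp (rate qo s j * x))
      * ∑ d, (∑ c, eigE qo θ s a c * wedgeCore qo θ u j x s c d) * eigE qo θ s b d :=
    ((hasExt_exp_rate hH 0 x).mul (hasExt_exp_rate hH j x)).mul (HasExt.sum _ fun d _ =>
      (HasExt.sum _ fun c _ => (hasExt_eigE hH a c).mul (hcore c d)).mul (hasExt_eigE hH b d))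
  refine h.congr fun s h0 hs => ?_
  rw [← mul_wedge_mul_transpose _ hj0, wedge_leftJost hu h0 hs hj0 (hφ s h0 hs), add_mul,
    Complex.exp_add]
  simp only [Matrix.smul_apply, smul_eq_mul, Matrix.mul_apply, transpose_apply]

end Extension

/-! ### Symmetries of the spatial equation -/

/-- A symmetry of the equation maps Jost solutions to Jost solutions if the continuous map `f`, by
which it acts on the normalized solution `φ e^{-Dx}`, carries `E` to the new `E`. -/
lemma IsSpatialJost.map_aux {qo θ θ' s s' : ℝ} {u u' : ℝ → Fin 3 → ℂ} {l : Filter ℝ} {φ : ℝ → Mat}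
    (h : IsSpatialJost qo θ u l s φ) {φ' : ℝ → Mat} {f : Mat → Mat} (hf : Continuous f)
    (hd : ∀ x, HasMatDerivAt φ' (spatialX qo (u' x) s' * φ' x) x)
    (he : f (eigE qo θ s) = eigE qo θ' s')
    (hx : ∀ x, φ' x * expRate qo s' (-x) = f (φ x * expRate qo s (-x))) :
    IsSpatialJost qo θ' u' l s' φ' := by
  refine IsSpatialJost.of_tendsto_mul_exp hd ?_
  simp only [hx]
  rw [← he]
  exact (hf.tendsto _).comp h.tendsto_mul_exp

/-- Right multiplication by this matrix exchanges the first and the last column, the new first column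
being `a` times the old last one and the new last column `b` times the old first one. -/
def swapMat (a b : ℂ) : Mat := !![0, 0, 0, b; 0, 1, 0, 0; 0, 0, 1, 0; a, 0, 0, 0]

lemma swapMat_eq (a b : ℂ) : swapMat a b =
    !![0, 0, 0, b; 0, 1, 0, 0; 0, 0, 1, 0; a, 0, 0, 0] := rfl

lemma kk_hat {qo : ℝ} (hq : qo ≠ 0) (z : ℂ) : kk qo ((qo : ℂ) ^ 2 / z) = kk qo z := by
  have : (qo : ℂ) ^ 2 ≠ 0 := pow_ne_zero 2 (Complex.ofReal_ne_zero.2 hq)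
  rw [kk, kk, div_div_cancel₀ this, add_comm]

lemma lam_hat {qo : ℝ} (hq : qo ≠ 0) (z : ℂ) : lam qo ((qo : ℂ) ^ 2 / z) = -lam qo z := by
  have : (qo : ℂ) ^ 2 ≠ 0 := pow_ne_zero 2 (Complex.ofReal_ne_zero.2 hq)
  rw [lam, lam, div_div_cancel₀ this]
  ring

lemma kk_neg (qo : ℝ) (z : ℂ) : kk qo (-z) = -kk qo z := by
  rw [kk, kk, div_neg]; ring

lemma lam_neg (qo : ℝ) (z : ℂ) : lam qo (-z) = -lam qo z := by
  rw [lam, lam, div_neg]; ring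

lemma gam_neg (qo : ℝ) (z : ℂ) : gam qo (-z) = gam qo z := by
  rw [gam, gam, neg_sq]

lemma rate_neg (qo : ℝ) (z : ℂ) (j : Fin 4) : rate qo (-z) j = -rate qo z j := by
  fin_cases j <;> simp [rate, kk_neg, lam_neg]

/-- The symmetry `z ↦ qₒ²/z`, which exchanges the two sheets `±λ`. -/
theorem IsSpatialJost.hat {qo θ s : ℝ} {u : ℝ → Fin 3 → ℂ} {l : Filter ℝ} {φ : ℝ → Mat}
    (h : IsSpatialJost qo θ u l s φ) (hq : qo ≠ 0) (hs : s ≠ 0) :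
    IsSpatialJost qo θ u l (qo ^ 2 / s) fun x => φ x *
      swapMat (Complex.I * s * amp qo θ / qo ^ 2) (-(Complex.I * s * star (amp qo θ) / qo ^ 2)) := by
  have hq' : (qo : ℂ) ≠ 0 := Complex.ofReal_ne_zero.2 hq
  have hs' : (s : ℂ) ≠ 0 := Complex.ofReal_ne_zero.2 hs
  have ecast : ((qo ^ 2 / s : ℝ) : ℂ) = (qo : ℂ) ^ 2 / s := by push_cast; rfl
  refine h.map_aux (f := fun M => M * swapMat (Complex.I * s * amp qo θ / qo ^ 2)
    (-(Complex.I * s * star (amp qo θ) / qo ^ 2))) (continuous_id.matrix_mul continuous_const)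
    (fun x => ?_) ?_ fun x => ?_
  · refine ((h.deriv x).mul_const _).congr_deriv ?_
    rw [Matrix.mul_assoc, spatialX, spatialX, ecast, kk_hat hq]
  · have hω := amp_mul_star qo θ
    rw [eigE_eq, eigE_eq, swapMat_eq, ecast]
    ext i j
    fin_cases i <;> fin_cases j <;> simp [Matrix.mul_apply, Fin.sum_univ_four] <;>
      simp only [RCLike.star_def] at hω ⊢
    all_goals field_simp
    all_goals try rw [Complex.I_sq]
    all_goals try linear_combination hω
  · have : ∀ a b : ℂ, swapMat a b * expRate qo ((qo ^ 2 / s : ℝ) : ℂ) (-x)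
        = expRate qo s (-x) * swapMat a b := by
      intro a b
      ext i j
      rw [mul_expRate_apply, expRate_mul_apply, ecast]
      fin_cases i <;> fin_cases j <;>
        simp [swapMat, rate, kk_hat hq, lam_hat hq, mul_comm]
    simp only [Matrix.mul_assoc, this]

end VNLS

namespace VNLS

open MeasureTheory Set

/-- A continuous potential with `u - (0, 0, qₒe^{iθ})` integrable at `+∞`. -/
structure DecaysRight (qo θ : ℝ) (u : ℝ → Fin 3 → ℂ) : Prop where
  cont : Continuous u
  integrable : IntegrableOn (fun x => u x - background qo θ) (Ici 0)

section Symmetry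

variable {qo θ θ' s : ℝ} {u : ℝ → Fin 3 → ℂ} {l l' : Filter ℝ} {φ : ℝ → Mat}

lemma amp_add_pi (qo θ : ℝ) : amp qo (θ + Real.pi) = -amp qo θ := by
  have h : Complex.I * ((θ + Real.pi : ℝ) : ℂ) = Complex.I * θ + Real.pi * Complex.I := by
    push_cast; ring
  rw [amp, amp, h, Complex.exp_add, Complex.exp_pi_mul_I]
  ring

lemma amp_pi_sub (qo θ : ℝ) : amp qo (Real.pi - θ) = -star (amp qo θ) := by
  have h : Complex.I * ((Real.pi - θ : ℝ) : ℂ) = -(Complex.I * θ) + Real.pi * Complex.I := by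
    push_cast; ring
  have h2 : star (Complex.exp (Complex.I * θ)) = Complex.exp (-(Complex.I * θ)) := by
    rw [RCLike.star_def, ← Complex.exp_conj]
    simp
  rw [amp, amp, star_mul', h2, h, Complex.exp_add, Complex.exp_pi_mul_I]
  simp

lemma background_neg (h : amp qo θ' = -amp qo θ) : background qo θ' = -background qo θ := by
  rw [background_eq, background_eq, h]
  ext i
  fin_cases i <;> simp

lemma background_neg_star (h : amp qo θ' = -star (amp qo θ)) :
    background qo θ' = -star (background qo θ) := by
  rw [background_eq, background_eq, h]
  ext i
  fin_cases i <;> simp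

lemma expRate_neg_neg (qo : ℝ) (z : ℂ) (x : ℝ) : expRate qo (-z) (-x) = expRate qo z x := by
  simp [expRate, rate_neg]

/-- Reversing the direction of `x` exchanges the two ends and changes the sign of `z`. -/
theorem IsSpatialJost.reverse (h : IsSpatialJost qo θ u l s φ)
    (hθ : amp qo θ' = -amp qo θ) (hl : Tendsto (fun x : ℝ => -x) l' l) :
    IsSpatialJost qo θ' (fun x => -u (-x)) l' (-s) fun x => φ (-x) := by
  refine IsSpatialJost.of_tendsto_mul_exp (fun x => ?_) ?_
  · refine ((h.deriv (-x)).comp_neg).congr_deriv ?_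
    rw [← neg_mul]
    congr 1
    rw [spatialX, spatialX, Complex.ofReal_neg, kk_neg]
    ext i j
    fin_cases i <;> fin_cases j <;> simp [J, Q]
  · have hE : eigE qo θ' ((-s : ℝ) : ℂ) = eigE qo θ s := by
      rw [eigE_eq, eigE_eq, hθ]
      push_cast
      simp [div_neg]
    rw [hE]
    refine (h.tendsto_mul_exp.comp hl).congr fun x => ?_
    simp only [Function.comp_apply, neg_neg]
    rw [Complex.ofReal_neg, expRate_neg_neg]

lemma J_mul_mul_J_apply (N : Mat) (i j : Fin 4) :
    (J * N * J) i j = (![1, -1, -1, -1] : Fin 4 → ℂ) i * (![1, -1, -1, -1] : Fin 4 → ℂ) j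
      * N i j := by
  rw [J, mul_diagonal, diagonal_mul]
  ring

/-- Complex conjugation changes the sign of `z`. -/
theorem IsSpatialJost.conj (h : IsSpatialJost qo θ u l s φ)
    (hθ : amp qo θ' = -star (amp qo θ)) :
    IsSpatialJost qo θ' (fun x => -star (u x)) l (-s) fun x => J * ((φ x)ᴴ)ᵀ * J := by
  refine h.map_aux (f := fun M => J * (Mᴴ)ᵀ * J)
    ((continuous_const.matrix_mul
      (continuous_id.matrix_conjTranspose.matrix_transpose)).matrix_mul continuous_const)
    (fun x => ?_) ?_ fun x => ?_
  · refine ((((h.deriv x).conjTranspose.transpose).const_mul J).mul_const J).congr_deriv ?_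
    have hk := kk_star qo s
    simp only [RCLike.star_def, Complex.conj_ofReal] at hk
    have hX : J * ((spatialX qo (u x) s)ᴴ)ᵀ = spatialX qo (-star (u x)) ((-s : ℝ) : ℂ) * J := by
      rw [spatialX, spatialX, Complex.ofReal_neg, kk_neg, J_eq]
      ext i j
      fin_cases i <;> fin_cases j <;> simp [Q, Matrix.mul_apply, Fin.sum_univ_four, hk]
    rw [conjTranspose_mul, transpose_mul, ← Matrix.mul_assoc J, hX]
    simp only [Matrix.mul_assoc]
  · ext i j
    rw [J_mul_mul_J_apply, eigE_eq, eigE_eq, hθ]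
    push_cast
    fin_cases i <;> fin_cases j <;> simp [div_neg] <;> ring
  · have h1 : J * expRate qo (((-s : ℝ)) : ℂ) (-x) = expRate qo s x * J := by
      rw [Complex.ofReal_neg, expRate_neg_neg, J, expRate, diagonal_mul_diagonal,
        diagonal_mul_diagonal]
      simp [mul_comm]
    have h2 : ((φ x * expRate qo s (-x))ᴴ)ᵀ = ((φ x)ᴴ)ᵀ * expRate qo s x := by
      rw [conjTranspose_mul, transpose_mul, expRate_conjTranspose, neg_neg]
      congr 1
      exact diagonal_transpose _
    rw [h2, Matrix.mul_assoc, h1]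
    simp only [Matrix.mul_assoc]

lemma DecaysLeft.conj (hu : DecaysLeft qo θ u) (hθ : amp qo θ' = -star (amp qo θ)) :
    DecaysLeft qo θ' fun x => -star (u x) := by
  have hc : Continuous fun x => -star (u x) := hu.cont.star.neg
  refine ⟨hc, ?_⟩
  refine Integrable.mono hu.integrable (hc.sub continuous_const).aestronglyMeasurable
    (Eventually.of_forall fun x => le_of_eq ?_)
  rw [background_neg_star hθ, sub_neg_eq_add, ← norm_neg, neg_add, neg_neg, ← sub_eq_add_neg,
    ← star_sub, norm_star]

lemma DecaysRight.reverse (hu : DecaysRight qo θ u) (hθ : amp qo θ' = -amp qo θ) :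
    DecaysLeft qo θ' fun x => -u (-x) := by
  have hc : Continuous fun x => -u (-x) := (hu.cont.comp continuous_neg).neg
  refine ⟨hc, ?_⟩
  have h1 : IntegrableOn (fun x => u (-x) - background qo θ) (Iic 0) := by
    have h := (Measure.measurePreserving_neg (volume : Measure ℝ)).integrableOn_comp_preimage
      (Homeomorph.neg ℝ).measurableEmbedding (f := fun x => u x - background qo θ) (s := Ici 0)
    have e : (fun x : ℝ => -x) ⁻¹' Ici 0 = Iic 0 := by
      ext x; simp
    rw [e] at h
    exact h.2 hu.integrable
  refine h1.neg.congr (Eventually.of_forall fun x => ?_)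
  simp only [Pi.neg_apply, background_neg hθ]
  abel

end Symmetry

/-! ### Columns and minors which continue to a half-plane -/

/-- The first column, the `2 × 2` minors of the columns `1, 2` and `1, 3`, and the complex conjugate
of the last column of `N` are boundary values of functions analytic in `H`. -/
structure ExtCols (qo : ℝ) (H : Set ℂ) (N : ℝ → Mat) : Prop where
  col : ∀ i, HasExt qo H fun s => N s i 0
  wedge : ∀ j : Fin 4, j = 1 ∨ j = 2 → ∀ a b,
    HasExt qo H fun s => N s a 0 * N s b j - N s a j * N s b 0
  last : ∀ i, HasExt qo H fun s => star (N s i 3)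

namespace ExtCols

variable {qo : ℝ} {H : Set ℂ} {N : ℝ → Mat}

lemma mul_diagonal (h : ExtCols qo H N) {d : ℝ → Fin 4 → ℂ}
    (h0 : ∀ j, j ≠ 3 → HasExt qo H fun s => d s j) (h3 : HasExt qo H fun s => star (d s 3)) :
    ExtCols qo H fun s => N s * diagonal (d s) := by
  refine ⟨fun i => ?_, fun j hj a b => ?_, fun i => ?_⟩
  · simp only [Matrix.mul_diagonal]
    exact (h.col i).mul (h0 0 (by decide))
  · refine ((h.wedge j hj a b).mul ((h0 0 (by decide)).mul
      (h0 j (by rcases hj with rfl | rfl <;> decide)))).congr fun s _ _ => ?_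
    simp only [Matrix.mul_diagonal]
    ring
  · simp only [Matrix.mul_diagonal, star_mul']
    exact (h.last i).mul h3

lemma of_J (h : ExtCols qo H fun s => J * N s * J) : ExtCols qo H N := by
  have hsq : ∀ i : Fin 4, (![1, -1, -1, -1] : Fin 4 → ℂ) i * (![1, -1, -1, -1] : Fin 4 → ℂ) i = 1 := by
    intro i
    fin_cases i <;> simp
  have hst : ∀ i : Fin 4, star ((![1, -1, -1, -1] : Fin 4 → ℂ) i) =
      (![1, -1, -1, -1] : Fin 4 → ℂ) i := by
    intro i
    fin_cases i <;> simp
  set e : Fin 4 → ℂ := ![1, -1, -1, -1] with he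
  refine ⟨fun i => ?_, fun j hj a b => ?_, fun i => ?_⟩
  · refine ((h.col i).const_mul (e i * e 0)).congr fun s _ _ => ?_
    rw [J_mul_mul_J_apply]
    linear_combination (e i * e i * N s i 0) * hsq 0 + N s i 0 * hsq i
  · refine ((h.wedge j hj a b).const_mul (e a * e b * (e 0 * e j))).congr fun s _ _ => ?_
    simp only [J_mul_mul_J_apply, ← he]
    linear_combination (N s a 0 * N s b j - N s a j * N s b 0) *
      ((e a * e a) * (e b * e b) * (e 0 * e 0) * hsq j + (e a * e a) * (e b * e b) * hsq 0
        + (e a * e a) * hsq b + hsq a)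
  · refine ((h.last i).const_mul (e i * e 3)).congr fun s _ _ => ?_
    simp only [J_mul_mul_J_apply, ← he, star_mul', hst]
    linear_combination (e i * e i * star (N s i 3)) * hsq 3 + star (N s i 3) * hsq i

lemma comp_neg (h : ExtCols qo upper N) : ExtCols qo lower fun s => N (-s) := by
  have key : ∀ f : ℝ → ℂ, HasExt qo upper f → HasExt qo lower fun s => f (-s) := by
    intro f hf
    refine hf.comp (m := fun z => -z) (mr := fun s => -s) (by fun_prop)
      (fun z hz => ne_zero_of_im (ne_of_lt hz)) (fun z hz => ?_) fun s h0 hs => ⟨by push_cast; rfl,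
        neg_ne_zero.2 h0, ?_⟩
    · simpa [upper, lower] using hz
    · rw [Complex.ofReal_neg, gam_neg]
      exact hs
  exact ⟨fun i => key _ (h.col i), fun j hj a b => key _ (h.wedge j hj a b),
    fun i => key _ (h.last i)⟩

end ExtCols

lemma gam_hat_ne_zero {qo : ℝ} (hq : qo ≠ 0) {z : ℂ} (h0 : z ≠ 0) (hz : gam qo z ≠ 0) :
    gam qo ((qo : ℂ) ^ 2 / z) ≠ 0 := by
  have hq' : (qo : ℂ) ≠ 0 := Complex.ofReal_ne_zero.2 hq
  intro h
  apply hz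
  have e : gam qo ((qo : ℂ) ^ 2 / z) * (-((qo : ℂ) ^ 2 / z ^ 2)) = gam qo z := by
    rw [gam, gam]
    field_simp
    ring
  rw [← e, h, zero_mul]

section Families

variable {qo θ : ℝ} {u : ℝ → Fin 3 → ℂ} {φ : ℝ → ℝ → Mat}

/-- The last column is reached by conjugation followed by `z ↦ qₒ²/z`: together they map `z` to
`-qₒ²/z`, which preserves the upper half-plane, and put the conjugate of the last column in the first
place. -/
theorem extCols_left (hq : qo ≠ 0) (hu : DecaysLeft qo θ u)
    (hφ : ∀ s : ℝ, s ≠ 0 → gam qo s ≠ 0 → IsSpatialJost qo θ u atBot s (φ s)) (x : ℝ) :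
    ExtCols qo upper fun s => φ s x := by
  refine ⟨hasExt_jost_zero hu hφ x, fun j hj => hasExt_jost_wedge hu hφ x hj, fun i => ?_⟩
  have hq2 : qo ^ 2 ≠ 0 := pow_ne_zero 2 hq
  have hq' : (qo : ℂ) ≠ 0 := Complex.ofReal_ne_zero.2 hq
  set θ' := Real.pi - θ with hθ'
  have hθ := amp_pi_sub qo θ
  have hω : amp qo θ' ≠ 0 := by
    rw [amp]
    exact mul_ne_zero hq' (Complex.exp_ne_zero _)
  -- At the point `-qₒ²/s` the conjugated Jost solution has the last column in the first place.
  set ψ : ℝ → ℝ → Mat := fun σ y => (J * ((φ (-(qo ^ 2 / σ)) y)ᴴ)ᵀ * J) *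
    swapMat (Complex.I * ((-(-(qo ^ 2 / σ)) : ℝ) : ℂ) * amp qo θ' / qo ^ 2)
      (-(Complex.I * ((-(-(qo ^ 2 / σ)) : ℝ) : ℂ) * star (amp qo θ') / qo ^ 2)) with hψ
  have hreg : ∀ σ : ℝ, σ ≠ 0 → gam qo σ ≠ 0 →
      -(qo ^ 2 / σ) ≠ 0 ∧ gam qo ((-(qo ^ 2 / σ) : ℝ) : ℂ) ≠ 0 := by
    intro σ h0 hs
    refine ⟨neg_ne_zero.2 (div_ne_zero hq2 h0), ?_⟩
    push_cast
    rw [gam_neg]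
    exact gam_hat_ne_zero hq (Complex.ofReal_ne_zero.2 h0) hs
  have hψJ : ∀ σ : ℝ, σ ≠ 0 → gam qo σ ≠ 0 →
      IsSpatialJost qo θ' (fun x => -star (u x)) atBot σ (ψ σ) := by
    intro σ h0 hs
    have hr := hreg σ h0 hs
    have h1 := ((hφ _ hr.1 hr.2).conj hθ).hat hq (neg_ne_zero.2 hr.1)
    have e : qo ^ 2 / (-(-(qo ^ 2 / σ))) = σ := by
      rw [neg_neg, div_div_cancel₀ hq2]
    rw [e] at h1
    exact h1
  have hext := (hasExt_jost_zero (hu.conj hθ) hψJ x i).comp (H' := upper)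
    (m := fun z => -((qo : ℂ) ^ 2 / z)) (mr := fun s => -(qo ^ 2 / s))
    ((differentiableOn_const _).div differentiableOn_id fun z hz => hz).neg
    (fun z hz => ne_zero_of_im (ne_of_gt hz)) (fun z hz => ?_)
    fun s h0 hs => ⟨by push_cast; rfl, hreg s h0 hs⟩
  · have hinv : HasExt qo upper fun s => (s : ℂ)⁻¹ :=
      HasExt.of_differentiableOn (F := fun z => z⁻¹)
        (differentiableOn_id.inv fun z hz => hz.1) (upper_subset_regularPlane qo)
    refine ((hext.mul hinv).const_mul ((![1, -1, -1, -1] : Fin 4 → ℂ) i *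
      (qo ^ 2 / (Complex.I * amp qo θ')))).congr fun s h0 hs => ?_
    have h0' : (s : ℂ) ≠ 0 := Complex.ofReal_ne_zero.2 h0
    have e : -(qo ^ 2 / (-(qo ^ 2 / s))) = s := by
      rw [div_neg, neg_neg, div_div_cancel₀ hq2]
    have e2 : -(-(qo ^ 2 / (-(qo ^ 2 / s)))) = -s := by rw [e]
    simp only [hψ]
    rw [e2, e, Matrix.mul_apply, Fin.sum_univ_four]
    simp only [J_mul_mul_J_apply, transpose_apply, conjTranspose_apply, Complex.ofReal_neg]
    fin_cases i <;> simp [swapMat] <;> field_simp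
  · have hz' : 0 < z.im := hz
    have hn : 0 < Complex.normSq z := Complex.normSq_pos.2 (ne_zero_of_im (ne_of_gt hz))
    have : (-((qo : ℂ) ^ 2 / z)).im = qo ^ 2 * (z.im / Complex.normSq z) := by
      rw [div_eq_mul_inv, Complex.neg_im, Complex.mul_im, ← Complex.ofReal_pow, Complex.ofReal_re,
        Complex.ofReal_im, Complex.inv_im]
      ring
    change 0 < (-((qo : ℂ) ^ 2 / z)).im
    rw [this]
    have : 0 < qo ^ 2 := by positivity
    positivity

/-- Conjugation changes the sign of `z`, hence exchanges the half-planes. -/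
theorem extCols_left_conj (hq : qo ≠ 0) (hu : DecaysLeft qo θ u)
    (hφ : ∀ s : ℝ, s ≠ 0 → gam qo s ≠ 0 → IsSpatialJost qo θ u atBot s (φ s)) (x : ℝ) :
    ExtCols qo lower fun s => ((φ s x)ᴴ)ᵀ := by
  have h := (extCols_left hq (hu.conj (amp_pi_sub qo θ))
    (φ := fun s x => J * ((φ (-s) x)ᴴ)ᵀ * J) (fun s h0 hs => ?_) x).comp_neg
  · simp only [neg_neg] at h
    exact h.of_J
  · have := (hφ (-s) (neg_ne_zero.2 h0) (by rwa [Complex.ofReal_neg, gam_neg])).conj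
      (amp_pi_sub qo θ)
    rwa [neg_neg] at this

lemma isSpatialJost_reversed
    (hφ : ∀ s : ℝ, s ≠ 0 → gam qo s ≠ 0 → IsSpatialJost qo θ u atTop s (φ s)) (s : ℝ)
    (h0 : s ≠ 0) (hs : gam qo s ≠ 0) :
    IsSpatialJost qo (θ + Real.pi) (fun x => -u (-x)) atBot s fun x => φ (-s) (-x) := by
  have := (hφ (-s) (neg_ne_zero.2 h0) (by rwa [Complex.ofReal_neg, gam_neg])).reverse
    (amp_add_pi qo θ) tendsto_neg_atBot_atTop
  rwa [neg_neg] at this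

/-- Reversing `x` exchanges the two ends and changes the sign of `z`. -/
theorem extCols_right (hq : qo ≠ 0) (hu : DecaysRight qo θ u)
    (hφ : ∀ s : ℝ, s ≠ 0 → gam qo s ≠ 0 → IsSpatialJost qo θ u atTop s (φ s)) (x : ℝ) :
    ExtCols qo lower fun s => φ s x := by
  have h := (extCols_left hq (hu.reverse (amp_add_pi qo θ)) (isSpatialJost_reversed hφ)
    (-x)).comp_neg
  simpa only [neg_neg] using h

/-- Reversal and conjugation together exchange the two ends and fix `z`. -/
theorem extCols_right_conj (hq : qo ≠ 0) (hu : DecaysRight qo θ u)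
    (hφ : ∀ s : ℝ, s ≠ 0 → gam qo s ≠ 0 → IsSpatialJost qo θ u atTop s (φ s)) (x : ℝ) :
    ExtCols qo upper fun s => ((φ s x)ᴴ)ᵀ := by
  have hr := isSpatialJost_reversed hφ
  have hu' := (hu.reverse (amp_add_pi qo θ)).conj (amp_pi_sub qo (θ + Real.pi))
  have h := extCols_left hq hu' (φ := fun s x => J * ((φ s (-x))ᴴ)ᵀ * J) (fun s h0 hs => ?_) (-x)
  · simp only [neg_neg] at h
    exact h.of_J
  · have := (hr (-s) (neg_ne_zero.2 h0) (by rwa [Complex.ofReal_neg, gam_neg])).conj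
      (amp_pi_sub qo (θ + Real.pi))
    simpa only [neg_neg] using this

/-- Existence of the Jost solution normalized at `+∞`. -/
theorem exists_isSpatialJost_right (hu : DecaysRight qo θ u) {s : ℝ} (h0 : s ≠ 0)
    (hs : gam qo s ≠ 0) : ∃ ψ, IsSpatialJost qo θ u atTop s ψ := by
  have h := (isSpatialJost_leftJost (hu.reverse (amp_add_pi qo θ)) (s := -s) (neg_ne_zero.2 h0)
    (by rwa [Complex.ofReal_neg, gam_neg])).reverse (θ' := θ) (l' := atTop)
    (by rw [amp_add_pi, neg_neg]) tendsto_neg_atTop_atBot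
  simp only [neg_neg] at h
  exact ⟨_, h⟩

end Families

/-! ### The determinant of the Jost solutions -/

/-- Liouville's formula. -/
lemma hasDerivAt_det {Φ : ℝ → Mat} {X : Mat} {x : ℝ} (h : HasMatDerivAt Φ (X * Φ x) x) :
    HasDerivAt (fun y => (Φ y).det) (X.trace * (Φ x).det) x := by
  have e : ∀ y, (Φ y).det = ∑ σ : Equiv.Perm (Fin 4), (Equiv.Perm.sign σ : ℂ) *
      ∏ i, Φ y i (σ i) := by
    intro y
    rw [← det_transpose, det_apply']
    rfl
  have h1 : HasDerivAt (fun y => ∑ σ : Equiv.Perm (Fin 4), (Equiv.Perm.sign σ : ℂ) *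
      ∏ i, Φ y i (σ i)) (∑ σ : Equiv.Perm (Fin 4), (Equiv.Perm.sign σ : ℂ) *
      ∑ i, (∏ k ∈ Finset.univ.erase i, Φ x k (σ k)) • (X * Φ x) i (σ i)) x :=
    HasDerivAt.fun_sum fun σ _ => (HasDerivAt.fun_finsetProd fun i _ => h i (σ i)).const_mul _
  simp only [e]
  refine h1.congr_deriv ?_
  rw [← e x]
  have h2 : ∀ i, ∑ σ : Equiv.Perm (Fin 4), (Equiv.Perm.sign σ : ℂ) *
      ((∏ k ∈ Finset.univ.erase i, Φ x k (σ k)) • (X * Φ x) i (σ i)) = X i i * (Φ x).det := by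
    intro i
    have h3 := det_updateRow_sum (Φ x) i (X i)
    rw [smul_eq_mul] at h3
    rw [← h3, ← det_transpose, det_apply']
    refine Finset.sum_congr rfl fun σ _ => ?_
    congr 1
    rw [← Finset.mul_prod_erase _ _ (Finset.mem_univ i), smul_eq_mul, mul_comm]
    congr 1
    · simp [Matrix.mul_apply]
    · refine Finset.prod_congr rfl fun k hk => ?_
      simp [(Finset.mem_erase.1 hk).1]
  simp only [Finset.mul_sum]
  rw [Finset.sum_comm]
  simp only [h2]
  rw [← Finset.sum_mul]
  rfl

/-- The trace of `X` is `2ik`, and `det E_± = γ` fixes the constant in Liouville's formula. -/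
theorem IsSpatialJost.det_eq {qo θ s : ℝ} {u : ℝ → Fin 3 → ℂ} {l : Filter ℝ} [l.NeBot]
    {φ : ℝ → Mat} (h : IsSpatialJost qo θ u l s φ) (x : ℝ) :
    (φ x).det = gam qo s * Complex.exp (2 * Complex.I * kk qo s * x) := by
  have htr : ∀ x, (spatialX qo (u x) s).trace = 2 * Complex.I * kk qo s := by
    intro x
    simp [spatialX, Matrix.trace, Fin.sum_univ_four, J, Q]
    ring
  have hdet : ∀ x, (φ x * expRate qo s (-x)).det =
      (φ x).det * Complex.exp (-(2 * Complex.I * kk qo s * x)) := by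
    intro x
    rw [det_mul, expRate, det_diagonal, Fin.prod_univ_four, ← Complex.exp_add, ← Complex.exp_add,
      ← Complex.exp_add]
    congr 2
    simp [rate]
    ring
  have hconst : ∀ y, (φ y * expRate qo s (-y)).det = (φ x * expRate qo s (-x)).det := by
    intro y
    have hd : ∀ y, HasDerivAt (fun y => (φ y * expRate qo s (-y)).det) 0 y := by
      intro y
      simp only [hdet]
      have h1 := hasDerivAt_det (h.deriv y)
      have h2 := ((hasDerivAt_id (y : ℂ)).const_mul (-(2 * Complex.I * kk qo s))).cexp.comp_ofReal
      rw [htr] at h1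
      have h3 := h1.mul h2
      simp only [neg_mul, id] at h3
      refine h3.congr_deriv ?_
      ring
    exact is_const_of_deriv_eq_zero (fun y => (hd y).differentiableAt) (fun y => (hd y).deriv) y x
  have hlim : Tendsto (fun y => (φ y * expRate qo s (-y)).det) l (𝓝 (eigE qo θ s).det) :=
    ((continuous_id.matrix_det).tendsto _).comp h.tendsto_mul_exp
  simp only [hconst] at hlim
  have hE : (eigE qo θ s).det = gam qo s := by
    have hω := amp_mul_star qo θ
    rw [eigE_eq, gam, ← hω]
    simp [det_succ_row_zero, Fin.sum_univ_succ, Fin.succAbove]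
    linear_combination ((s : ℂ)⁻¹ ^ 2 * (starRingEnd ℂ) (amp qo θ) * amp qo θ) * Complex.I_sq
  have := tendsto_nhds_unique tendsto_const_nhds hlim
  rw [hdet, hE] at this
  rw [← this, mul_assoc, ← Complex.exp_add]
  simp

end VNLS

namespace VNLS

open MeasureTheory Set

/-! ### Minors of the scattering matrix -/

lemma minor_two (N : Mat) (i k j l : Fin 4) :
    minor N ![i, k] ![j, l] = N i j * N k l - N i l * N k j := by
  rw [minor, det_fin_two]
  rfl

lemma minor_one (N : Mat) (i j : Fin 4) : minor N ![i] ![j] = N i j := by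
  rw [minor, det_unique]
  rfl

lemma minor_three (N : Mat) (i j k a b c : Fin 4) : minor N ![i, j, k] ![a, b, c] =
    N i a * N j b * N k c - N i a * N j c * N k b - N i b * N j a * N k c + N i b * N j c * N k a
      + N i c * N j a * N k b - N i c * N j b * N k a := by
  rw [minor, det_fin_three]
  rfl

lemma succAbove_three : (3 : Fin 4).succAbove = ![0, 1, 2] := by
  funext i; fin_cases i <;> rfl

lemma succAbove_two : (2 : Fin 4).succAbove = ![0, 1, 3] := by
  funext i; fin_cases i <;> rfl

lemma succAbove_one : (1 : Fin 4).succAbove = ![0, 2, 3] := by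
  funext i; fin_cases i <;> rfl

lemma succAbove_zero' : (0 : Fin 4).succAbove = ![1, 2, 3] := by
  funext i; fin_cases i <;> rfl

/-- The minors of order three are the entries of the inverse, up to the determinant. -/
lemma det_submatrix_succAbove {N : Mat} (h : N.det ≠ 0) (i j : Fin 4) :
    (N.submatrix j.succAbove i.succAbove).det = (-1) ^ (j + i : ℕ) * (N.det * N⁻¹ i j) := by
  have h1 := adjugate_fin_succ_eq_det_submatrix N i j
  have h2 : adjugate N i j = N.det * N⁻¹ i j := by
    rw [Matrix.inv_def, Matrix.smul_apply, Ring.inverse_eq_inv', smul_eq_mul, ← mul_assoc,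
      mul_inv_cancel₀ h, one_mul]
  rw [← h2, h1, ← mul_assoc, ← pow_add, ← two_mul, pow_mul]
  simp

lemma minor_mul_two (G M : Mat) (i k j l : Fin 4) :
    minor (G * M) ![i, k] ![j, l] = (1 / 2) * ∑ a, ∑ b, (G i a * G k b - G k a * G i b) *
      (M a j * M b l - M a l * M b j) := by
  rw [minor_two]
  simp only [Matrix.mul_apply, Fin.sum_univ_four]
  ring

/-- The third auxiliary eigenfunction is a combination of products of `2 × 2` minors of `G` and
`3 × 3` minors of `M`. -/
lemma aux3_mul (G M : Mat) {P : Fin 4 → Fin 4 → ℂ} {Y : Fin 4 → ℂ}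
    (hP : ∀ a b, G 0 a * G 1 b - G 1 a * G 0 b = P a b)
    (hY : ∀ m : Fin 4, (M.submatrix m.succAbove (3 : Fin 4).succAbove).det = Y m) :
    aux3 M (G * M) = ![P 1 2 * Y 3 + P 1 3 * Y 2 + P 2 3 * Y 1,
      -(P 0 2 * Y 3) - P 0 3 * Y 2 + P 2 3 * Y 0, P 0 1 * Y 3 - P 0 3 * Y 1 - P 1 3 * Y 0,
      P 0 1 * Y 2 + P 0 2 * Y 1 + P 1 2 * Y 0] := by
  have y0 := hY 0
  have y1 := hY 1
  have y2 := hY 2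
  have y3 := hY 3
  rw [succAbove_three] at y0 y1 y2 y3
  rw [succAbove_zero'] at y0
  rw [succAbove_one] at y1
  rw [succAbove_two] at y2
  simp only [det_fin_three, submatrix_apply] at y0 y1 y2 y3
  rw [← y0, ← y1, ← y2, ← y3]
  simp only [← hP]
  funext i
  simp only [aux3, minor_two, Matrix.mul_apply, Fin.sum_univ_four]
  fin_cases i <;> simp [Matrix.col_apply] <;> ring

section Scattering

variable {qo : ℝ} {H : Set ℂ} {φ ψ : ℝ → Mat} {D : ℝ → ℂ}

lemma hasExt_gam_inv (hH : H ⊆ regularPlane qo) : HasExt qo H fun s => (gam qo s)⁻¹ :=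
  HasExt.of_differentiableOn (F := fun z => (gam qo z)⁻¹)
    (((differentiableOn_gam qo).mono fun _ hz => hz.1).inv fun _ hz => hz.2) hH

lemma inv_apply_eq {M : Mat} {z : ℂ} (h : M⁻¹ = gramInv qo z * Mᴴ * J) (i a : Fin 4) :
    M⁻¹ i a = (![(gam qo z)⁻¹, -1, -1, -(gam qo z)⁻¹] : Fin 4 → ℂ) i * star (M a i)
      * (![1, -1, -1, -1] : Fin 4 → ℂ) a := by
  rw [h, J, Matrix.mul_diagonal, gramInv, Matrix.diagonal_mul, conjTranspose_apply]

lemma hasExt_inv_row_zero (hH : H ⊆ regularPlane qo)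
    (hψ : ExtCols qo H fun s => ((ψ s)ᴴ)ᵀ)
    (hψi : ∀ s : ℝ, s ≠ 0 → gam qo s ≠ 0 → (ψ s)⁻¹ = gramInv qo s * (ψ s)ᴴ * J) (a : Fin 4) :
    HasExt qo H fun s => (ψ s)⁻¹ 0 a := by
  refine (((hasExt_gam_inv hH).mul (hψ.col a)).const_mul
    ((![1, -1, -1, -1] : Fin 4 → ℂ) a)).congr fun s h0 hs => ?_
  rw [inv_apply_eq (hψi s h0 hs)]
  simp only [transpose_apply, conjTranspose_apply, cons_val_zero]
  ring

lemma hasExt_inv_rows (hH : H ⊆ regularPlane qo)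
    (hψ : ExtCols qo H fun s => ((ψ s)ᴴ)ᵀ)
    (hψi : ∀ s : ℝ, s ≠ 0 → gam qo s ≠ 0 → (ψ s)⁻¹ = gramInv qo s * (ψ s)ᴴ * J) {k : Fin 4}
    (hk : k = 1 ∨ k = 2) (a b : Fin 4) :
    HasExt qo H fun s => (ψ s)⁻¹ 0 a * (ψ s)⁻¹ k b - (ψ s)⁻¹ k a * (ψ s)⁻¹ 0 b := by
  refine (((hasExt_gam_inv hH).mul (hψ.wedge k hk a b)).const_mul
    (-((![1, -1, -1, -1] : Fin 4 → ℂ) a * (![1, -1, -1, -1] : Fin 4 → ℂ) b))).congr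
      fun s h0 hs => ?_
  simp only [inv_apply_eq (hψi s h0 hs)]
  rcases hk with rfl | rfl <;> simp only [transpose_apply, conjTranspose_apply] <;> simp <;> ring

lemma hasExt_inv_row_three (hH : H ⊆ regularPlane qo) (hφ : ExtCols qo H φ)
    (hφi : ∀ s : ℝ, s ≠ 0 → gam qo s ≠ 0 → (φ s)⁻¹ = gramInv qo s * (φ s)ᴴ * J) (a : Fin 4) :
    HasExt qo H fun s => (φ s)⁻¹ 3 a := by
  refine (((hasExt_gam_inv hH).mul (hφ.last a)).const_mul
    (-(![1, -1, -1, -1] : Fin 4 → ℂ) a)).congr fun s h0 hs => ?_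
  rw [inv_apply_eq (hφi s h0 hs)]
  simp
  ring

lemma hasExt_scat_entry (hH : H ⊆ regularPlane qo) (hφ : ExtCols qo H φ)
    (hψ : ExtCols qo H fun s => ((ψ s)ᴴ)ᵀ)
    (hψi : ∀ s : ℝ, s ≠ 0 → gam qo s ≠ 0 → (ψ s)⁻¹ = gramInv qo s * (ψ s)ᴴ * J) :
    HasExt qo H fun s => minor ((ψ s)⁻¹ * φ s) ![0] ![0] := by
  simp only [minor_one, Matrix.mul_apply]
  exact HasExt.sum _ fun a _ => (hasExt_inv_row_zero hH hψ hψi a).mul (hφ.col a)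

lemma hasExt_scat_minor_two (hH : H ⊆ regularPlane qo) (hφ : ExtCols qo H φ)
    (hψ : ExtCols qo H fun s => ((ψ s)ᴴ)ᵀ)
    (hψi : ∀ s : ℝ, s ≠ 0 → gam qo s ≠ 0 → (ψ s)⁻¹ = gramInv qo s * (ψ s)ᴴ * J) {k l : Fin 4}
    (hk : k = 1 ∨ k = 2) (hl : l = 1 ∨ l = 2) :
    HasExt qo H fun s => minor ((ψ s)⁻¹ * φ s) ![0, k] ![0, l] := by
  simp only [minor_mul_two]
  exact (HasExt.sum _ fun a _ => HasExt.sum _ fun b _ =>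
    (hasExt_inv_rows hH hψ hψi hk a b).mul (hφ.wedge l hl a b)).const_mul _

lemma hasExt_scat_minor_three (hH : H ⊆ regularPlane qo) (hφ : ExtCols qo H φ)
    (hψ : ExtCols qo H fun s => ((ψ s)ᴴ)ᵀ)
    (hφi : ∀ s : ℝ, s ≠ 0 → gam qo s ≠ 0 → (φ s)⁻¹ = gramInv qo s * (φ s)ᴴ * J)
    (hu : ∀ s : ℝ, s ≠ 0 → gam qo s ≠ 0 → IsUnit (ψ s).det)
    (hdet : ∀ s : ℝ, s ≠ 0 → gam qo s ≠ 0 → (φ s).det = (ψ s).det) :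
    HasExt qo H fun s => minor ((ψ s)⁻¹ * φ s) ![0, 1, 2] ![0, 1, 2] := by
  have h : HasExt qo H fun s => ∑ a, (φ s)⁻¹ 3 a * star (((ψ s)ᴴ)ᵀ a 3) :=
    HasExt.sum _ fun a _ => (hasExt_inv_row_three hH hφ hφi a).mul (hψ.last a)
  refine h.congr fun s h0 hs => ?_
  have hd : ((ψ s)⁻¹ * φ s).det = 1 := by
    rw [det_mul, hdet s h0 hs, ← det_mul, Matrix.nonsing_inv_mul _ (hu s h0 hs), det_one]
  have hinv : ((ψ s)⁻¹ * φ s)⁻¹ = (φ s)⁻¹ * ψ s := by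
    rw [Matrix.mul_inv_rev, Matrix.nonsing_inv_nonsing_inv _ (hu s h0 hs)]
  have := det_submatrix_succAbove (N := (ψ s)⁻¹ * φ s) (by rw [hd]; exact one_ne_zero) 3 3
  rw [succAbove_three, hd, hinv] at this
  rw [minor, this, Matrix.mul_apply]
  norm_num

lemma hasExt_aux2 (hH : H ⊆ regularPlane qo) (hφ : ExtCols qo H φ)
    (hψ : ExtCols qo H fun s => ((ψ s)ᴴ)ᵀ)
    (hψi : ∀ s : ℝ, s ≠ 0 → gam qo s ≠ 0 → (ψ s)⁻¹ = gramInv qo s * (ψ s)ᴴ * J) (i : Fin 4) :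
    HasExt qo H fun s => aux2 (φ s) ((ψ s)⁻¹ * φ s) i := by
  have h : HasExt qo H fun s => ∑ a, (ψ s)⁻¹ 0 a * (φ s a 0 * φ s i 1 - φ s a 1 * φ s i 0) :=
    HasExt.sum _ fun a _ => (hasExt_inv_row_zero hH hψ hψi a).mul (hφ.wedge 1 (Or.inl rfl) a i)
  refine h.congr fun s _ _ => ?_
  simp only [aux2, Pi.sub_apply, Pi.smul_apply, smul_eq_mul, Matrix.mul_apply, Matrix.col_apply,
    Fin.sum_univ_four]
  ring

lemma hasExt_aux3 (hH : H ⊆ regularPlane qo) (hφ : ExtCols qo H φ)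
    (hψ : ExtCols qo H fun s => ((ψ s)ᴴ)ᵀ)
    (hφi : ∀ s : ℝ, s ≠ 0 → gam qo s ≠ 0 → (φ s)⁻¹ = gramInv qo s * (φ s)ᴴ * J)
    (hψi : ∀ s : ℝ, s ≠ 0 → gam qo s ≠ 0 → (ψ s)⁻¹ = gramInv qo s * (ψ s)ᴴ * J)
    (hu : ∀ s : ℝ, s ≠ 0 → gam qo s ≠ 0 → IsUnit (φ s).det)
    (hD : HasExt qo H fun s => (φ s).det) (i : Fin 4) :
    HasExt qo H fun s => aux3 (φ s) ((ψ s)⁻¹ * φ s) i := by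
  have hY : ∀ m : Fin 4, HasExt qo H fun s =>
      ((φ s).submatrix m.succAbove (3 : Fin 4).succAbove).det := by
    intro m
    refine ((hD.mul (hasExt_inv_row_three hH hφ hφi m)).const_mul
      ((-1) ^ ((m : ℕ) + ((3 : Fin 4) : ℕ)))).congr fun s h0 hs => ?_
    rw [det_submatrix_succAbove (hu s h0 hs).ne_zero]
  have hP := hasExt_inv_rows hH hψ hψi (k := 1) (Or.inl rfl)
  simp only [aux3_mul (ψ _)⁻¹ (φ _) (fun _ _ => rfl) (fun _ => rfl)]
  fin_cases i
  · exact (((hP 1 2).mul (hY 3)).add ((hP 1 3).mul (hY 2))).add ((hP 2 3).mul (hY 1))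
  · exact ((((hP 0 2).mul (hY 3)).neg).sub ((hP 0 3).mul (hY 2))).add ((hP 2 3).mul (hY 0))
  · exact (((hP 0 1).mul (hY 3)).sub ((hP 0 3).mul (hY 1))).sub ((hP 1 3).mul (hY 0))
  · exact (((hP 0 1).mul (hY 2)).add ((hP 0 2).mul (hY 1))).add ((hP 1 2).mul (hY 0))

end Scattering

end VNLS

namespace VNLS

open Set

/-! ### Compatible linear systems in two variables -/

/-- If `∂F/∂x = G` is jointly continuous, the first-order Taylor remainder of `F` in `x` is `o(h)`
uniformly for the parameter in a compact set. -/
lemma exists_uniform_remainder {V : Type*} [NormedAddCommGroup V] [NormedSpace ℝ V]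
    {F G : ℝ → ℝ → V} (hF : ∀ ξ τ, HasDerivAt (fun y => F y τ) (G ξ τ) ξ)
    (hG : Continuous fun p : ℝ × ℝ => G p.1 p.2) {K : Set ℝ} (hK : IsCompact K) (x : ℝ) {ε : ℝ}
    (hε : 0 < ε) :
    ∃ δ > 0, ∀ ξ, |ξ - x| < δ → ∀ τ ∈ K, ‖F ξ τ - F x τ - (ξ - x) • G x τ‖ ≤ ε * |ξ - x| := by
  have hopen : IsOpen {p : ℝ × ℝ | ‖G p.1 p.2 - G x p.2‖ < ε} :=
    isOpen_lt ((hG.sub (hG.comp (continuous_const.prodMk continuous_snd))).norm) continuous_const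
  obtain ⟨U, V', hU, -, hxU, hKV, hUV⟩ := generalized_tube_lemma (isCompact_singleton (x := x)) hK
    hopen (by rintro ⟨a, b⟩ ⟨ha, -⟩; obtain rfl : a = x := ha; simpa using hε)
  obtain ⟨δ, hδ, hball⟩ := Metric.isOpen_iff.1 hU x (hxU rfl)
  refine ⟨δ, hδ, fun ξ hξ τ hτ => ?_⟩
  have hd : ∀ y ∈ Metric.ball x δ, HasDerivWithinAt (fun y => F y τ - (y - x) • G x τ)
      (G y τ - G x τ) (Metric.ball x δ) y := by
    intro y _
    have := (hF y τ).sub (((hasDerivAt_id y).sub_const x).smul_const (G x τ))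
    rw [one_smul] at this
    exact this.hasDerivWithinAt
  have h := (convex_ball x δ).norm_image_sub_le_of_norm_hasDerivWithin_le (C := ε) hd
    (fun y hy => (hUV (mk_mem_prod (hball hy) (hKV hτ)) : _ < ε).le)
    (Metric.mem_ball_self hδ) (by rwa [Metric.mem_ball, Real.dist_eq])
  rw [sub_self, zero_smul, sub_zero, Real.norm_eq_abs] at h
  convert h using 2
  abel

section Compatible

variable {ι : Type} [Fintype ι]

lemma exists_mulVec_bound {T : ℝ → ℝ → Matrix ι ι ℂ}
    (hT : ∀ i j, Continuous fun p : ℝ × ℝ => T p.1 p.2 i j) (x : ℝ) {K : Set ℝ}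
    (hK : IsCompact K) :
    ∃ C, 0 ≤ C ∧ ∀ ξ, |ξ - x| ≤ 1 → ∀ τ ∈ K, ∀ w : ι → ℂ, ‖T ξ τ *ᵥ w‖ ≤ C * ‖w‖ := by
  have hc : Continuous fun p : ℝ × ℝ => ∑ i, ∑ j, ‖T p.1 p.2 i j‖ :=
    continuous_finsetSum _ fun i _ => continuous_finsetSum _ fun j _ => (hT i j).norm
  obtain ⟨C, hC⟩ := ((isCompact_closedBall x 1).prod hK).bddAbove_image hc.continuousOn
  refine ⟨max C 0, le_max_right _ _, fun ξ hξ τ hτ w => (norm_mulVec_le_sum _ w).trans ?_⟩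
  gcongr
  refine le_max_of_le_left (hC ⟨(ξ, τ), ⟨?_, hτ⟩, rfl⟩)
  rwa [Metric.mem_closedBall, Real.dist_eq]

lemma HasDerivAt.mulVec {A : ℝ → Matrix ι ι ℂ} {A' : Matrix ι ι ℂ} {w : ℝ → ι → ℂ} {w' : ι → ℂ}
    {t : ℝ} (hA : ∀ i j, HasDerivAt (fun s => A s i j) (A' i j) t) (hw : HasDerivAt w w' t) :
    HasDerivAt (fun s => A s *ᵥ w s) (A' *ᵥ w t + A t *ᵥ w') t := by
  refine hasDerivAt_pi.2 fun i => ?_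
  simp only [Matrix.mulVec, dotProduct, Pi.add_apply, ← Finset.sum_add_distrib]
  exact HasDerivAt.fun_sum fun j _ => (hA i j).mul (hasDerivAt_pi.1 hw j)

/-- Under the zero-curvature condition, a family of solutions of `y_t = T y` which solves
`y_x = X y` at the initial time solves it at all times: the remainder
`y(ξ,τ) - y(x,τ) - (ξ - x) X y(x,τ)` satisfies, up to an error `o(ξ - x)`, the linear equation
`D_τ = T(ξ,τ) D`. -/
theorem hasDerivAt_of_zeroCurvature {X T T' X' : ℝ → ℝ → Matrix ι ι ℂ}
    (hX : ∀ x t i j, HasDerivAt (fun s => X x s i j) (X' x t i j) t)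
    (hT : ∀ x t i j, HasDerivAt (fun y => T y t i j) (T' x t i j) x)
    (hTc : ∀ i j, Continuous fun p : ℝ × ℝ => T p.1 p.2 i j)
    (hTc' : ∀ i j, Continuous fun p : ℝ × ℝ => T' p.1 p.2 i j)
    (hflat : ∀ x t, X' x t + X x t * T x t = T' x t + T x t * X x t)
    {y : ℝ → ℝ → ι → ℂ} (hy : ∀ x t, HasDerivAt (y x) (T x t *ᵥ y x t) t)
    (h0 : ∀ x, HasDerivAt (fun ξ => y ξ 0) (X x 0 *ᵥ y x 0) x) (x t : ℝ) :
    HasDerivAt (fun ξ => y ξ t) (X x t *ᵥ y x t) x := by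
  set F : ℝ → ℝ → ι → ℂ := fun ξ τ =>
    T ξ τ *ᵥ (y x τ + (ξ - x) • (X x τ *ᵥ y x τ)) with hF
  set G : ℝ → ℝ → ι → ℂ := fun ξ τ =>
    T' ξ τ *ᵥ (y x τ + (ξ - x) • (X x τ *ᵥ y x τ)) + T ξ τ *ᵥ (X x τ *ᵥ y x τ) with hG
  have hFG : ∀ ξ τ, HasDerivAt (fun y => F y τ) (G ξ τ) ξ := by
    intro ξ τ
    have h1 : HasDerivAt (fun ξ => y x τ + (ξ - x) • (X x τ *ᵥ y x τ)) (X x τ *ᵥ y x τ) ξ := by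
      have := (((hasDerivAt_id ξ).sub_const x).smul_const (X x τ *ᵥ y x τ)).const_add (y x τ)
      rwa [one_smul] at this
    exact HasDerivAt.mulVec (A := fun ξ => T ξ τ) (hT ξ τ) h1
  have hXy : ∀ τ, HasDerivAt (fun τ => X x τ *ᵥ y x τ)
      (X' x τ *ᵥ y x τ + X x τ *ᵥ (T x τ *ᵥ y x τ)) τ := fun τ =>
    HasDerivAt.mulVec (hX x τ) (hy x τ)
  have hyc : Continuous (y x) := continuous_iff_continuousAt.2 fun τ => (hy x τ).continuousAt
  have hXyc : Continuous fun τ => X x τ *ᵥ y x τ :=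
    continuous_iff_continuousAt.2 fun τ => (hXy τ).continuousAt
  have hm : ∀ S : ℝ → ℝ → Matrix ι ι ℂ, (∀ i j, Continuous fun p : ℝ × ℝ => S p.1 p.2 i j) →
      Continuous fun p : ℝ × ℝ => S p.1 p.2 := fun S hS =>
    continuous_pi fun i => continuous_pi fun j => hS i j
  have hGc : Continuous fun p : ℝ × ℝ => G p.1 p.2 := by
    have hX2 := hXyc.comp (continuous_snd (X := ℝ) (Y := ℝ))
    have hw : Continuous fun p : ℝ × ℝ => y x p.2 + (p.1 - x) • (X x p.2 *ᵥ y x p.2) :=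
      (hyc.comp continuous_snd).add ((continuous_fst.sub continuous_const).smul hX2)
    exact ((hm T' hTc').matrix_mulVec hw).add ((hm T hTc).matrix_mulVec hX2)
  have hG0 : ∀ τ, G x τ = X' x τ *ᵥ y x τ + X x τ *ᵥ (T x τ *ᵥ y x τ) := by
    intro τ
    simp only [hG, sub_self, zero_smul, add_zero, Matrix.mulVec_mulVec, ← Matrix.add_mulVec,
      hflat x τ]
  obtain ⟨K, hK0, hK⟩ := exists_mulVec_bound hTc x (isCompact_uIcc (a := 0) (b := t))
  obtain ⟨C, hC0, hC⟩ := gronwallBound_le_mul hK0 (abs_nonneg t)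
  rw [hasDerivAt_iff_isLittleO, Asymptotics.isLittleO_iff]
  intro c hc
  set ε : ℝ := c / (2 * (C + 1)) with hε
  have hε0 : 0 < ε := by positivity
  obtain ⟨δ, hδ, hrem⟩ := exists_uniform_remainder hFG hGc (isCompact_uIcc (a := 0) (b := t)) x hε0
  have hinit := Asymptotics.isLittleO_iff.1 (hasDerivAt_iff_isLittleO.1 (h0 x)) hε0
  filter_upwards [hinit, Metric.ball_mem_nhds x (lt_min hδ one_pos)] with ξ hξ0 hξ
  rw [Metric.mem_ball, Real.dist_eq, lt_min_iff] at hξ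
  set D : ℝ → ι → ℂ := fun τ => y ξ τ - y x τ - (ξ - x) • (X x τ *ᵥ y x τ) with hD
  have hDd : ∀ τ, HasDerivAt D (T ξ τ *ᵥ D τ + (F ξ τ - F x τ - (ξ - x) • G x τ)) τ := by
    intro τ
    have := ((hy ξ τ).sub (hy x τ)).sub ((hXy τ).const_smul (ξ - x))
    refine this.congr_deriv ?_
    rw [hG0]
    simp only [hD, hF, sub_self, zero_smul, Matrix.mulVec_sub, Matrix.mulVec_add, Matrix.mulVec_zero]
    abel
  have hb := norm_le_gronwallBound_uIcc hDd (K := K) (ε := ε * |ξ - x|) (t := t) hξ0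
    fun τ hτ => (norm_add_le _ _).trans (add_le_add (hK ξ hξ.2.le τ hτ _) (hrem ξ hξ.1 τ hτ))
  have h2 := hb.trans (hC _ _)
  rw [Real.norm_eq_abs, abs_of_nonneg (by positivity : 0 ≤ ε * |ξ - x|)] at h2
  refine h2.trans ?_
  rw [Real.norm_eq_abs]
  have h3 : C * (2 * ε) ≤ c := by
    rw [hε]
    have : C * (2 * (c / (2 * (C + 1)))) = c * (C / (C + 1)) := by field_simp
    rw [this]
    exact mul_le_of_le_one_right hc.le ((div_le_one (by positivity)).2 (by linarith))
  calc C * (ε * |ξ - x| + ε * |ξ - x|) = C * (2 * ε) * |ξ - x| := by ring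
    _ ≤ c * |ξ - x| := by gcongr

/-- If the coefficients of `y_t = T y` converge locally uniformly in `t`, solutions which are
asymptotic at the initial time to bounded solutions of the limiting equation remain so. -/
theorem tendsto_sub_of_tendsto_coeff {l : Filter ℝ} {T : ℝ → ℝ → Matrix ι ι ℂ} {T₀ : Matrix ι ι ℂ}
    (hT : ∀ i j, TendstoLocallyUniformly (fun x t => T x t i j) (fun _ => T₀ i j) l)
    {y e : ℝ → ℝ → ι → ℂ} (hy : ∀ x t, HasDerivAt (y x) (T x t *ᵥ y x t) t)
    (he : ∀ x t, HasDerivAt (e x) (T₀ *ᵥ e x t) t) {B : ℝ} (hB : ∀ x t, ‖e x t‖ ≤ B)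
    (h0 : Tendsto (fun x => y x 0 - e x 0) l (𝓝 0)) (t : ℝ) :
    Tendsto (fun x => y x t - e x t) l (𝓝 0) := by
  rcases l.eq_or_neBot with rfl | hl
  · exact tendsto_bot
  have hB0 : 0 ≤ B := (norm_nonneg _).trans (hB 0 0)
  set n : ℝ := (Fintype.card ι : ℝ) with hn
  have hsmall : ∀ ε > 0, ∀ᶠ x in l, ∀ τ ∈ uIcc 0 t, ∑ i, ∑ j, ‖(T x τ - T₀) i j‖ ≤ n * (n * ε) := by
    intro ε hε
    have h : ∀ i j, ∀ᶠ x in l, ∀ τ ∈ uIcc 0 t, dist (T₀ i j) (T x τ i j) < ε := fun i j =>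
      Metric.tendstoUniformlyOn_iff.1
        (tendstoLocallyUniformly_iff_forall_isCompact.1 (hT i j) _ isCompact_uIcc) ε hε
    filter_upwards [eventually_all.2 fun i => eventually_all.2 (h i)] with x hx τ hτ
    have : ∀ i j, ‖(T x τ - T₀) i j‖ ≤ ε := fun i j => by
      rw [Matrix.sub_apply, norm_sub_rev, ← dist_eq_norm]
      exact (hx i j τ hτ).le
    calc ∑ i, ∑ j, ‖(T x τ - T₀) i j‖ ≤ ∑ _i : ι, ∑ _j : ι, ε :=
          Finset.sum_le_sum fun i _ => Finset.sum_le_sum fun j _ => this i j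
      _ = n * (n * ε) := by simp [hn]
  set K : ℝ := n * (n * 1) + ∑ i, ∑ j, ‖T₀ i j‖ with hKdef
  have hK0 : 0 ≤ K := by positivity
  obtain ⟨C, hC0, hC⟩ := gronwallBound_le_mul hK0 (abs_nonneg t)
  rw [Metric.tendsto_nhds]
  intro c hc
  set ε : ℝ := c / (2 * (C + 1) * (n * n * B + 1)) with hε
  have hε0 : 0 < ε := by positivity
  filter_upwards [hsmall 1 one_pos, hsmall ε hε0, Metric.tendsto_nhds.1 h0 ε hε0] with x h1 h2 h3
  rw [dist_zero_right] at h3 ⊢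
  have hd : ∀ τ, HasDerivAt (fun τ => y x τ - e x τ)
      (T x τ *ᵥ (y x τ - e x τ) + (T x τ - T₀) *ᵥ e x τ) τ := by
    intro τ
    refine ((hy x τ).sub (he x τ)).congr_deriv ?_
    rw [Matrix.mulVec_sub, Matrix.sub_mulVec]
    abel
  have hb := norm_le_gronwallBound_uIcc hd (K := K) (ε := n * (n * ε) * B) (t := t) h3.le
    fun τ hτ => ?_
  · have hb2 := hb.trans (hC _ _)
    rw [abs_of_nonneg hε0.le, abs_of_nonneg (by positivity : 0 ≤ n * (n * ε) * B)] at hb2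
    refine hb2.trans_lt ?_
    have e1 : C * (ε + n * (n * ε) * B) = c / 2 * (C / (C + 1)) := by
      rw [hε]
      field_simp
      ring
    rw [e1]
    have : C / (C + 1) ≤ 1 := (div_le_one (by positivity)).2 (by linarith)
    nlinarith
  · refine (norm_add_le _ _).trans (add_le_add ((norm_mulVec_le_sum _ _).trans ?_)
      ((norm_mulVec_le_sum _ _).trans ?_))
    · refine mul_le_mul_of_nonneg_right ?_ (norm_nonneg _)
      refine le_trans ?_ (add_le_add_left (h1 τ hτ) _)
      simp only [← Finset.sum_add_distrib]
      refine Finset.sum_le_sum fun i _ => Finset.sum_le_sum fun j _ => ?_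
      simpa using norm_add_le ((T x τ - T₀) i j) (T₀ i j)
    · exact mul_le_mul (h2 τ hτ) (hB x τ) (norm_nonneg _) (by positivity)

end Compatible

end VNLS

namespace VNLS

open Set

/-! ### The Lax pair of a solution of the vector NLS equation -/

lemma HasMatDerivAt.Q {v : ℝ → Fin 3 → ℂ} {v' : Fin 3 → ℂ} {x : ℝ} (h : HasDerivAt v v' x) :
    HasMatDerivAt (fun y => Q (v y)) (Q v') x := by
  have h' := hasDerivAt_pi.1 h
  intro i j
  fin_cases i <;> fin_cases j <;>
    first
      | exact hasDerivAt_const _ _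
      | exact h' _
      | exact (h' _).star

lemma HasMatDerivAt.add {Φ Ψ : ℝ → Mat} {Φ' Ψ' : Mat} {x : ℝ} (h : HasMatDerivAt Φ Φ' x)
    (k : HasMatDerivAt Ψ Ψ' x) : HasMatDerivAt (fun y => Φ y + Ψ y) (Φ' + Ψ') x :=
  fun i j => (h i j).add (k i j)

lemma HasMatDerivAt.sub {Φ Ψ : ℝ → Mat} {Φ' Ψ' : Mat} {x : ℝ} (h : HasMatDerivAt Φ Φ' x)
    (k : HasMatDerivAt Ψ Ψ' x) : HasMatDerivAt (fun y => Φ y - Ψ y) (Φ' - Ψ') x :=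
  fun i j => (h i j).sub (k i j)

lemma HasMatDerivAt.const_smul {Φ : ℝ → Mat} {Φ' : Mat} {x : ℝ} (c : ℂ)
    (h : HasMatDerivAt Φ Φ' x) : HasMatDerivAt (fun y => c • Φ y) (c • Φ') x :=
  fun i j => (h i j).const_mul c

/-- The coefficient matrix `T` as a function of the potential `v` and its derivative `w`. -/
def temporalT (qo : ℝ) (v w : Fin 3 → ℂ) (z : ℂ) : Mat :=
  (2 * Complex.I * kk qo z ^ 2) • J
    - Complex.I • (J * (Q w - Q v ^ 2 + ((qo : ℂ) ^ 2) • (1 : Mat))) - (2 * kk qo z) • Q v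

/-- The commutator of the coefficient matrices, for arbitrary scalar weights. -/
lemma lax_commutator (α β δ η c : ℂ) (v w : Fin 3 → ℂ) :
    (α • J + Q v) * (β • J + δ • (J * (Q w - Q v ^ 2 + c • (1 : Mat))) - η • Q v) -
      (β • J + δ • (J * (Q w - Q v ^ 2 + c • (1 : Mat))) - η • Q v) * (α • J + Q v) =
    (2 * α * δ) • Q w - (2 * α * η + 2 * β) • (J * Q v) - δ • (J * (Q w * Q v + Q v * Q w))
      + (2 * δ) • (J * (Q v ^ 2 * Q v - c • Q v)) := by
  have h1 := J_mul_Q v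
  have h2 := J_mul_Q w
  have h1' : ∀ N : Mat, J * (Q v * N) = -(Q v * (J * N)) := fun N => by
    rw [← Matrix.mul_assoc, h1, Matrix.neg_mul, Matrix.mul_assoc]
  have h2' : ∀ N : Mat, J * (Q w * N) = -(Q w * (J * N)) := fun N => by
    rw [← Matrix.mul_assoc, h2, Matrix.neg_mul, Matrix.mul_assoc]
  simp only [pow_two, add_mul, mul_add, sub_mul, mul_sub, smul_mul_assoc, mul_smul_comm,
    Matrix.mul_assoc, h1, h1', h2, h2', J_mul_J, Matrix.mul_one, mul_neg, neg_mul, neg_neg,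
    smul_add, smul_sub, smul_neg, smul_smul]
  module

lemma Q_sq_mul_Q (v : Fin 3 → ℂ) : Q v ^ 2 * Q v = (((∑ l, ‖v l‖ ^ 2 : ℝ)) : ℂ) • Q v := by
  have h : (((∑ l, ‖v l‖ ^ 2 : ℝ)) : ℂ) = ∑ l, v l * star (v l) := by
    push_cast
    exact Finset.sum_congr rfl fun l _ => (Complex.mul_conj' (v l)).symm
  rw [h, pow_two]
  ext i j
  fin_cases i <;> fin_cases j <;>
    simp [Fin.sum_univ_three, Q, -mul_eq_mul_left_iff, -mul_eq_mul_right_iff] <;> ring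

/-- The vector NLS equation in matrix form. -/
lemma Q_of_equation {qo : ℝ} {v vt vxx : Fin 3 → ℂ}
    (h : ∀ j, Complex.I * vt j + vxx j
      - 2 * (((∑ l, ‖v l‖ ^ 2) - qo ^ 2 : ℝ) : ℂ) * v j = 0) :
    Q vt = -(Complex.I • (J * Q vxx)) +
      (2 * Complex.I) • (J * (Q v ^ 2 * Q v - ((qo : ℂ) ^ 2) • Q v)) := by
  rw [Q_sq_mul_Q]
  rw [Complex.ofReal_sub, Complex.ofReal_pow] at h
  have hr : star ((∑ l, ‖v l‖ ^ 2 : ℝ) : ℂ) = ((∑ l, ‖v l‖ ^ 2 : ℝ) : ℂ) := Complex.conj_ofReal _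
  have hro : star (qo : ℂ) = qo := Complex.conj_ofReal _
  generalize ((∑ l, ‖v l‖ ^ 2 : ℝ) : ℂ) = n at h hr ⊢
  have h1 : ∀ j, vt j = Complex.I * vxx j - 2 * Complex.I * (n - (qo : ℂ) ^ 2) * v j := fun j => by
    linear_combination (-Complex.I) * h j + vt j * Complex.I_sq
  have h2 : ∀ j, star (vt j) = -(Complex.I * star (vxx j)) +
      2 * Complex.I * (n - (qo : ℂ) ^ 2) * star (v j) := fun j => by
    have hI : star Complex.I = -Complex.I := Complex.conj_I
    have h2' : star (2 : ℂ) = 2 := by simp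
    rw [h1]
    simp only [star_sub, star_mul', star_pow, hr, hro, hI, h2']
    ring
  ext i j
  fin_cases i <;> fin_cases j <;>
    simp [J_eq, Q] <;>
    first
      | (rw [h1]; ring1)
      | (have := h2 0; simp only [RCLike.star_def] at this; rw [this]; ring1)
      | (have := h2 1; simp only [RCLike.star_def] at this; rw [this]; ring1)
      | (have := h2 2; simp only [RCLike.star_def] at this; rw [this]; ring1)

/-- The zero-curvature condition is the vector NLS equation. -/
lemma zeroCurvature {qo : ℝ} {v vt vx vxx : Fin 3 → ℂ}
    (h : ∀ j, Complex.I * vt j + vxx j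
      - 2 * (((∑ l, ‖v l‖ ^ 2) - qo ^ 2 : ℝ) : ℂ) * v j = 0) (z : ℂ) :
    Q vt + spatialX qo v z * temporalT qo v vx z =
      (-Complex.I) • (J * (Q vxx - (Q vx * Q v + Q v * Q vx))) - (2 * kk qo z) • Q vx
        + temporalT qo v vx z * spatialX qo v z := by
  have hc := lax_commutator (-(Complex.I * kk qo z)) (2 * Complex.I * kk qo z ^ 2) (-Complex.I)
    (2 * kk qo z) ((qo : ℂ) ^ 2) v vx
  rw [neg_smul Complex.I, ← sub_eq_add_neg] at hc
  change spatialX qo v z * temporalT qo v vx z - temporalT qo v vx z * spatialX qo v z = _ at hc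
  rw [← sub_eq_iff_eq_add, add_sub_assoc, hc, Q_of_equation h,
    show 2 * -(Complex.I * kk qo z) * -Complex.I = -(2 * kk qo z) by
      linear_combination 2 * kk qo z * Complex.I_sq,
    show 2 * -(Complex.I * kk qo z) * (2 * kk qo z) + 2 * (2 * Complex.I * kk qo z ^ 2) = 0 by ring]
  simp only [mul_sub, mul_add]
  module

/-- The eigenvalues of the limit of `T`. -/
def rateT (qo : ℝ) (z : ℂ) : Fin 4 → ℂ :=
  ![2 * Complex.I * kk qo z * lam qo z, -(Complex.I * (kk qo z ^ 2 + lam qo z ^ 2)),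
    -(Complex.I * (kk qo z ^ 2 + lam qo z ^ 2)), -(2 * Complex.I * kk qo z * lam qo z)]

/-- The columns of `E_±` are eigenvectors of the limit of `T`. -/
lemma temporalT_background_mul_eigE {qo θ : ℝ} {z : ℂ} (h0 : z ≠ 0) :
    temporalT qo (background qo θ) 0 z * eigE qo θ z = eigE qo θ z *
      diagonal (rateT qo z) := by
  set P : Mat := diagonal ![0, 1, 1, 0] with hP
  have hkl : (qo : ℂ) ^ 2 = kk qo z ^ 2 - lam qo z ^ 2 := by
    rw [kk, lam]
    field_simp
    ring
  have hT : temporalT qo (background qo θ) 0 z =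
      (-(2 * kk qo z)) • spatialX qo (background qo θ) z + (Complex.I * (qo : ℂ) ^ 2) • P := by
    have h1 := amp_mul_star qo θ
    have h2 := star_amp_mul qo θ
    have hQ : Q (background qo θ) ^ 2 = ((qo : ℂ) ^ 2) • (1 - P) := by
      rw [background_eq, hP, pow_two (Q _)]
      simp only [RCLike.star_def] at h1 h2
      ext i j
      fin_cases i <;> fin_cases j <;> simp [Q, h1, h2]
    have hJP : J * P = -P := by
      rw [J, hP, diagonal_mul_diagonal]
      ext i j
      fin_cases i <;> fin_cases j <;> simp
    have hQ0 : Q 0 = 0 := by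
      ext i j
      fin_cases i <;> fin_cases j <;> simp [Q]
    rw [temporalT, spatialX, hQ, hQ0, show (0 : Mat) - ((qo : ℂ) ^ 2) • (1 - P) +
      ((qo : ℂ) ^ 2) • (1 : Mat) = ((qo : ℂ) ^ 2) • P by module, mul_smul_comm, hJP]
    module
  have hPE : P * eigE qo θ z = eigE qo θ z * P := by
    rw [eigE_eq, hP]
    ext i j
    simp only [diagonal_mul, mul_diagonal]
    fin_cases i <;> fin_cases j <;> simp
  rw [hT, add_mul, smul_mul_assoc, smul_mul_assoc, spatialX_background_mul_eigE qo θ h0, hPE,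
    ← mul_smul_comm, ← mul_smul_comm, ← mul_add]
  congr 1
  rw [hP, hkl, ← diagonal_smul, ← diagonal_smul, diagonal_add]
  congr 1
  ext j
  fin_cases j <;> simp [rate, rateT]
  all_goals ring

lemma I_mul_phase (qo x t : ℝ) (z : ℂ) (j : Fin 4) :
    Complex.I * phase qo x t z j = rate qo z j * x + rateT qo z j * t := by
  fin_cases j <;> simp [phase, rate, rateT] <;> ring

lemma expPhase_zero (qo x : ℝ) (z : ℂ) : expPhase qo Complex.I x 0 z = expRate qo z x := by
  simp [expPhase, expRate, I_mul_phase]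

lemma expPhase_eq_mul (qo x t : ℝ) (z : ℂ) :
    expPhase qo Complex.I x t z = expRate qo z x * expPhase qo Complex.I 0 t z := by
  rw [expPhase, expRate, expPhase, diagonal_mul_diagonal]
  congr 1
  ext j
  rw [← Complex.exp_add, I_mul_phase, I_mul_phase]
  simp

lemma norm_exp_I_phase (qo x t s : ℝ) (j : Fin 4) :
    ‖Complex.exp (Complex.I * phase qo x t s j)‖ = 1 := by
  have h1 := kk_star qo s
  have h2 := lam_star qo s
  simp only [RCLike.star_def, Complex.conj_ofReal] at h1 h2
  have h : ((phase qo x t s j).im) = 0 := by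
    rw [← Complex.conj_eq_iff_im]
    fin_cases j <;> simp [phase, h1, h2, map_ofNat (starRingEnd ℂ) 2]
  rw [Complex.norm_exp]
  simp [h]

lemma expPhase_mul_neg (qo x t : ℝ) (z : ℂ) :
    expPhase qo Complex.I x t z * expPhase qo (-Complex.I) x t z = 1 := by
  rw [expPhase, expPhase, diagonal_mul_diagonal, ← diagonal_one]
  congr 1
  ext j
  rw [← Complex.exp_add]
  simp

lemma expPhase_neg_mul (qo x t : ℝ) (z : ℂ) :
    expPhase qo (-Complex.I) x t z * expPhase qo Complex.I x t z = 1 := by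
  rw [expPhase, expPhase, diagonal_mul_diagonal, ← diagonal_one]
  congr 1
  ext j
  rw [← Complex.exp_add]
  simp

end VNLS

namespace VNLS

open Set

/-! ### Existence of the Jost eigenfunctions -/

lemma tendstoLocallyUniformly_const_iff {V : Type*} [SeminormedAddCommGroup V] {F : ℝ → ℝ → V}
    {c : V} {l : Filter ℝ} : TendstoLocallyUniformly F (fun _ => c) l ↔
      ∀ t, Tendsto (fun p : ℝ × ℝ => F p.1 p.2) (l ×ˢ 𝓝 t) (𝓝 c) := by
  rw [tendstoLocallyUniformly_iff_forall_tendsto]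
  refine forall_congr' fun t => ?_
  rw [nhds_eq_comap_uniformity (x := c), tendsto_comap_iff]
  rfl

section Partial

variable {V : Type*} [NormedAddCommGroup V] [NormedSpace ℝ V] {g : ℝ × ℝ → V}

lemma hasDerivAt_partial_fst (hg : Differentiable ℝ g) (x t : ℝ) :
    HasDerivAt (fun y => g (y, t)) (fderiv ℝ g (x, t) (1, 0)) x :=
  (hg (x, t)).hasFDerivAt.comp_hasDerivAt x ((hasDerivAt_id x).prodMk (hasDerivAt_const x t))

lemma hasDerivAt_partial_snd (hg : Differentiable ℝ g) (x t : ℝ) :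
    HasDerivAt (fun s => g (x, s)) (fderiv ℝ g (x, t) (0, 1)) t :=
  (hg (x, t)).hasFDerivAt.comp_hasDerivAt t ((hasDerivAt_const t x).prodMk (hasDerivAt_id t))

end Partial

section Potential

variable {qo θm θp : ℝ} {q : ℝ → ℝ → Fin 3 → ℂ}

/-- The partial derivatives of a solution which occur in the Lax pair. -/
lemma IsSolution.exists_partials (hq : IsSolution qo θm θp q) :
    ∃ qx qxx qt : ℝ → ℝ → Fin 3 → ℂ,
      (∀ x t, deriv (fun y => q y t) x = qx x t) ∧
      (∀ x t, HasDerivAt (fun y => q y t) (qx x t) x) ∧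
      (∀ x t, HasDerivAt (fun y => qx y t) (qxx x t) x) ∧
      (∀ x t, HasDerivAt (fun s => q x s) (qt x t) t) ∧
      (Continuous fun p : ℝ × ℝ => q p.1 p.2) ∧ (Continuous fun p : ℝ × ℝ => qx p.1 p.2) ∧
      (Continuous fun p : ℝ × ℝ => qxx p.1 p.2) ∧
      ∀ x t j, Complex.I * qt x t j + qxx x t j
        - 2 * (((∑ l, ‖q x t l‖ ^ 2) - qo ^ 2 : ℝ) : ℂ) * q x t j = 0 := by
  set f : ℝ × ℝ → Fin 3 → ℂ := fun p => q p.1 p.2 with hf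
  have h2 : ContDiff ℝ 2 f := hq.smooth
  have h1 : ContDiff ℝ 1 fun p => fderiv ℝ f p (1, 0) :=
    (h2.fderiv_right (m := 1) (by norm_num)).clm_apply contDiff_const
  have h0 : Continuous fun p => fderiv ℝ (fun p => fderiv ℝ f p (1, 0)) p (1, 0) :=
    (h1.continuous_fderiv (by norm_num)).clm_apply continuous_const
  have d2 := h2.differentiable (by norm_num)
  have d1 := h1.differentiable (by norm_num)
  have e1 : ∀ x t, HasDerivAt (fun y => q y t) (fderiv ℝ f (x, t) (1, 0)) x := fun x t =>
    hasDerivAt_partial_fst d2 x t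
  have e2 : ∀ x t, HasDerivAt (fun y => fderiv ℝ f (y, t) (1, 0))
      (fderiv ℝ (fun p => fderiv ℝ f p (1, 0)) (x, t) (1, 0)) x := fun x t =>
    hasDerivAt_partial_fst d1 x t
  have e3 : ∀ x t, HasDerivAt (fun s => q x s) (fderiv ℝ f (x, t) (0, 1)) t := fun x t =>
    hasDerivAt_partial_snd d2 x t
  refine ⟨fun x t => fderiv ℝ f (x, t) (1, 0),
    fun x t => fderiv ℝ (fun p => fderiv ℝ f p (1, 0)) (x, t) (1, 0),
    fun x t => fderiv ℝ f (x, t) (0, 1), fun x t => (e1 x t).deriv, e1, e2, e3, h2.continuous,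
    h1.continuous, h0, fun x t j => ?_⟩
  have h := hq.eqn x t j
  have a1 : deriv (fun y => q y t j) = fun y => fderiv ℝ f (y, t) (1, 0) j :=
    funext fun y => (hasDerivAt_pi.1 (e1 y t) j).deriv
  rw [(hasDerivAt_pi.1 (e3 x t) j).deriv, a1, (hasDerivAt_pi.1 (e2 x t) j).deriv] at h
  exact h

lemma continuous_Q : Continuous Q := by
  refine continuous_pi fun i => continuous_pi fun j => ?_
  fin_cases i <;> fin_cases j <;> simp [Q] <;> fun_prop

lemma continuous_temporalT (qo : ℝ) (z : ℂ) {α : Type*} [TopologicalSpace α]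
    {v w : α → Fin 3 → ℂ} (hv : Continuous v) (hw : Continuous w) :
    Continuous fun p => temporalT qo (v p) (w p) z := by
  have h1 : Continuous fun p => Q (v p) := continuous_Q.comp hv
  have h2 : Continuous fun p => Q (w p) := continuous_Q.comp hw
  have h3 : Continuous fun p => J * (Q (w p) - Q (v p) ^ 2 + ((qo : ℂ) ^ 2) • (1 : Mat)) :=
    continuous_const.matrix_mul ((h2.sub (h1.pow 2)).add continuous_const)
  exact (continuous_const.sub (h3.const_smul Complex.I)).sub (h1.const_smul (2 * kk qo z))

/-- The derivative `T_x`, in terms of the potential `v` and its derivatives `w`, `r`. -/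
def temporalTDeriv (qo : ℝ) (v w r : Fin 3 → ℂ) (z : ℂ) : Mat :=
  (-Complex.I) • (J * (Q r - (Q w * Q v + Q v * Q w))) - (2 * kk qo z) • Q w

lemma hasMatDerivAt_temporalT (qo : ℝ) (z : ℂ) {v w : ℝ → Fin 3 → ℂ} {r : Fin 3 → ℂ} {x : ℝ}
    (hv : HasDerivAt v (w x) x) (hw : HasDerivAt w r x) :
    HasMatDerivAt (fun y => temporalT qo (v y) (w y) z) (temporalTDeriv qo (v x) (w x) r z) x := by
  have a1 := HasMatDerivAt.Q hv
  have a2 := HasMatDerivAt.Q hw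
  have a3 := ((HasMatDerivAt.const ((2 * Complex.I * kk qo z ^ 2) • J) x).sub
    ((((a2.sub (a1.mul a1)).add (HasMatDerivAt.const (((qo : ℂ) ^ 2) • (1 : Mat)) x)).const_mul
      J).const_smul Complex.I)).sub (a1.const_smul (2 * kk qo z))
  simp only [← pow_two] at a3
  refine a3.congr_deriv ?_
  rw [temporalTDeriv]
  simp only [mul_sub, mul_add, add_zero]
  module

lemma continuous_temporalTDeriv (qo : ℝ) (z : ℂ) {α : Type*} [TopologicalSpace α]
    {v w r : α → Fin 3 → ℂ} (hv : Continuous v) (hw : Continuous w) (hr : Continuous r) :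
    Continuous fun p => temporalTDeriv qo (v p) (w p) (r p) z := by
  have b1 := continuous_Q.comp hv
  have b2 := continuous_Q.comp hw
  have b3 := continuous_Q.comp hr
  have h3 : Continuous fun p => J * (Q (r p) - (Q (w p) * Q (v p) + Q (v p) * Q (w p))) :=
    continuous_const.matrix_mul (b3.sub ((b2.matrix_mul b1).add (b1.matrix_mul b2)))
  exact (h3.const_smul (-Complex.I)).sub (b2.const_smul (2 * kk qo z))

lemma eigE_mul_expPhase_apply (qo θ x t : ℝ) (z : ℂ) (i j : Fin 4) :
    (eigE qo θ z * expPhase qo Complex.I x t z) i j =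
      eigE qo θ z i j * Complex.exp (Complex.I * phase qo x t z j) := by
  rw [expPhase, mul_diagonal]

lemma hasDerivAt_eigE_mul_expPhase {qo θ : ℝ} {z : ℂ} (h0 : z ≠ 0) (x t : ℝ) (j : Fin 4) :
    HasDerivAt (fun t => (eigE qo θ z * expPhase qo Complex.I x t z).col j)
      (temporalT qo (background qo θ) 0 z *ᵥ
        (eigE qo θ z * expPhase qo Complex.I x t z).col j) t := by
  refine hasDerivAt_pi.2 fun i => ?_
  have hE := congrFun (congrFun (temporalT_background_mul_eigE (qo := qo) (θ := θ) h0) i) j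
  rw [mul_diagonal, Matrix.mul_apply] at hE
  simp only [Matrix.mulVec, dotProduct, Matrix.col_apply, eigE_mul_expPhase_apply]
  have h1 : HasDerivAt (fun t : ℝ => Complex.exp (Complex.I * phase qo x t z j))
      (Complex.exp (Complex.I * phase qo x t z j) * rateT qo z j) t := by
    simp only [I_mul_phase]
    refine HasDerivAt.cexp ?_
    simpa using ((Complex.ofRealCLM.hasDerivAt (x := t)).const_mul (rateT qo z j)).const_add
      (rate qo z j * x)
  refine (h1.const_mul (eigE qo θ z i j)).congr_deriv ?_
  simp only [← mul_assoc, ← Finset.sum_mul, hE]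
  ring

lemma norm_eigE_mul_expPhase_col_le (qo θ x t s : ℝ) (j : Fin 4) :
    ‖(eigE qo θ s * expPhase qo Complex.I x t s).col j‖ ≤ ‖(eigE qo θ s).col j‖ := by
  refine (pi_norm_le_iff_of_nonneg (norm_nonneg _)).2 fun i => ?_
  rw [Matrix.col_apply, eigE_mul_expPhase_apply, norm_mul, norm_exp_I_phase, mul_one]
  exact norm_le_pi_norm ((eigE qo θ s).col j) i

/-- A Jost solution at the initial time, evolved by the second equation of the Lax pair, is a
simultaneous Jost solution, if the Lax pair is flat and has the right limits. -/
theorem exists_isJost_of_flat {θ : ℝ} {l : Filter ℝ} {s : ℝ} {T T' X' : ℝ → ℝ → Mat} (h0 : s ≠ 0)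
    (hlaxT : ∀ x t, laxT qo q s x t = T x t)
    (hX : ∀ x t, HasMatDerivAt (fun t => spatialX qo (q x t) s) (X' x t) t)
    (hT : ∀ x t, HasMatDerivAt (fun y => T y t) (T' x t) x)
    (hTc : ∀ i j, Continuous fun p : ℝ × ℝ => T p.1 p.2 i j)
    (hTc' : ∀ i j, Continuous fun p : ℝ × ℝ => T' p.1 p.2 i j)
    (hflat : ∀ x t, X' x t + spatialX qo (q x t) s * T x t =
      T' x t + T x t * spatialX qo (q x t) s)
    (hTl : ∀ i j, TendstoLocallyUniformly (fun x t => T x t i j)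
      (fun _ => temporalT qo (background qo θ) 0 s i j) l)
    {φ : ℝ → Mat} (hφ : IsSpatialJost qo θ (fun x => q x 0) l s φ) :
    ∃ Φ, IsJost qo q θ l s Φ := by
  have hs : (s : ℂ) ≠ 0 := Complex.ofReal_ne_zero.2 h0
  choose Y hY0 hYd using fun (x : ℝ) (j : Fin 4) => exists_linearODE (A := fun t => T x t)
    (fun i k => (hTc i k).comp (continuous_const.prodMk continuous_id)) (fun i => φ x i j)
  have hYt : ∀ j x t, HasDerivAt (Y x j) (T x t *ᵥ Y x j t) t :=
    fun j x t => hasDerivAt_pi.2 (hYd x j t)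
  have hYx : ∀ j x t, HasDerivAt (fun ξ => Y ξ j t) (laxX qo q s x t *ᵥ Y x j t) x := by
    intro j
    refine hasDerivAt_of_zeroCurvature (X := fun x t => spatialX qo (q x t) s) (X' := X')
      (T := T) (T' := T') (y := fun x => Y x j) hX hT hTc hTc' hflat (hYt j) fun x => ?_
    have := fun i => hφ.deriv x i j
    simp only [hY0]
    exact hasDerivAt_pi.2 this
  have hYl : ∀ j t, Tendsto (fun x => Y x j t -
      (eigE qo θ s * expPhase qo Complex.I x t s).col j) l (𝓝 0) := by
    intro j t
    refine tendsto_sub_of_tendsto_coeff hTl (y := fun x => Y x j)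
      (e := fun x t => (eigE qo θ s * expPhase qo Complex.I x t s).col j) (hYt j)
      (fun x t => hasDerivAt_eigE_mul_expPhase hs x t j)
      (fun x t => norm_eigE_mul_expPhase_col_le qo θ x t s j) ?_ t
    refine tendsto_pi_nhds.2 fun i => ?_
    have := tendsto_entry hφ.lim i j
    simp only [← expPhase_zero] at this
    simp only [hY0]
    exact this
  refine ⟨fun x t => of fun i j => Y x j t i, fun x t i j => ?_, fun x t i j => ?_, fun t => ?_⟩
  · exact hasDerivAt_pi.1 (hYx j x t) i
  · rw [hlaxT]
    exact hasDerivAt_pi.1 (hYt j x t) i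
  · exact tendsto_matrix_of_entries fun i j => tendsto_pi_nhds.1 (hYl j t) i

lemma tendstoLocallyUniformly_temporalT {qx : ℝ → ℝ → Fin 3 → ℂ} {θ : ℝ} {l : Filter ℝ}
    (hl : TendstoLocallyUniformly (fun x t => q x t) (fun _ => background qo θ) l)
    (hl' : TendstoLocallyUniformly (fun x t => qx x t) (fun _ => 0) l) (z : ℂ) (i j : Fin 4) :
    TendstoLocallyUniformly (fun x t => temporalT qo (q x t) (qx x t) z i j)
      (fun _ => temporalT qo (background qo θ) 0 z i j) l := by
  rw [tendstoLocallyUniformly_const_iff] at hl hl' ⊢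
  intro t
  have hc : Tendsto (fun p : (Fin 3 → ℂ) × (Fin 3 → ℂ) => temporalT qo p.1 p.2 z)
      (𝓝 (background qo θ, 0)) (𝓝 (temporalT qo (background qo θ) 0 z)) :=
    (continuous_temporalT qo z continuous_fst continuous_snd).tendsto (background qo θ, 0)
  have h := hc.comp ((hl t).prodMk_nhds (hl' t))
  exact tendsto_entry (F := fun p : ℝ × ℝ => temporalT qo (q p.1 p.2) (qx p.1 p.2) z) h i j

/-- The zero-curvature condition, which is the vector NLS equation, and the limit of `T` at infinity are
all that the temporal evolution of a spatial Jost solution needs. -/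
theorem exists_isJost (hq : IsSolution qo θm θp q) {θ : ℝ} {l : Filter ℝ}
    (hl : TendstoLocallyUniformly (fun x t => q x t) (fun _ => background qo θ) l)
    (hl' : TendstoLocallyUniformly (fun x t => deriv (fun y => q y t) x) (fun _ => 0) l)
    {s : ℝ} (h0 : s ≠ 0) {φ : ℝ → Mat} (hφ : IsSpatialJost qo θ (fun x => q x 0) l s φ) :
    ∃ Φ, IsJost qo q θ l s Φ := by
  obtain ⟨qx, qxx, qt, hdx, hqx, hqxx, hqt, cq, cqx, cqxx, heq⟩ := hq.exists_partials
  simp only [hdx] at hl'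
  have hTc := continuous_temporalT qo s cq cqx
  have hTc' := continuous_temporalTDeriv qo s cq cqx cqxx
  refine exists_isJost_of_flat (T := fun x t => temporalT qo (q x t) (qx x t) s)
    (T' := fun x t => temporalTDeriv qo (q x t) (qx x t) (qxx x t) s)
    (X' := fun x t => Q (qt x t)) h0 (fun x t => by rw [laxT, hdx, temporalT])
    (fun x t => ?_) (fun x t => hasMatDerivAt_temporalT qo s (hqx x t) (hqxx x t))
    (fun i j => hTc.matrix_elem i j) (fun i j => hTc'.matrix_elem i j)
    (fun x t => zeroCurvature (heq x t) s) (tendstoLocallyUniformly_temporalT hl hl' s) hφ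
  refine ((HasMatDerivAt.const ((-(Complex.I * kk qo s)) • J) t).add
    (HasMatDerivAt.Q (hqt x t))).congr_deriv ?_
  rw [zero_add]

/-- At a fixed time a Jost eigenfunction is, up to the constant diagonal factor `e^{iΘ(0,t)}`, the
Jost solution of the spatial equation. -/
lemma IsJost.isSpatialJost {θ s : ℝ} {l : Filter ℝ} {Φ : ℝ → ℝ → Mat}
    (h : IsJost qo q θ l s Φ) (t : ℝ) :
    IsSpatialJost qo θ (fun x => q x t) l s
      fun x => Φ x t * expPhase qo (-Complex.I) 0 t s := by
  refine ⟨fun x => ?_, ?_⟩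
  · have h1 : HasMatDerivAt (fun x => Φ x t) (laxX qo q s x t * Φ x t) x := h.1 x t
    refine (h1.mul_const _).congr_deriv ?_
    rw [Matrix.mul_assoc]
    rfl
  · have h1 := (h.2.2 t).mul (tendsto_const_nhds (x := expPhase qo (-Complex.I) 0 t s))
    rw [Matrix.zero_mul] at h1
    refine h1.congr fun x => ?_
    rw [sub_mul, expPhase_eq_mul, Matrix.mul_assoc, Matrix.mul_assoc (expRate _ _ _),
      expPhase_mul_neg, Matrix.mul_one]

end Potential

end VNLS

namespace VNLS

open MeasureTheory Set

/-! ### Scattering data -/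

lemma differentiableOn_phase (qo x t : ℝ) (j : Fin 4) :
    DifferentiableOn ℂ (fun z => phase qo x t z j) {z | z ≠ 0} := by
  have hk := differentiableOn_kk qo
  have hl := differentiableOn_lam qo
  have h1 : DifferentiableOn ℂ
      (fun z => -(lam qo z * x) + 2 * kk qo z * lam qo z * t) {z | z ≠ 0} :=
    ((hl.mul_const _).neg).add (((hk.const_mul 2).mul hl).mul_const _)
  have h2 : DifferentiableOn ℂ
      (fun z => kk qo z * x - (kk qo z ^ 2 + lam qo z ^ 2) * t) {z | z ≠ 0} :=
    (hk.mul_const _).sub (((hk.pow 2).add (hl.pow 2)).mul_const _)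
  fin_cases j
  · exact h1
  · exact h2
  · exact h2
  · exact h1.neg

lemma hasExt_exp_phase {qo : ℝ} {H : Set ℂ} (hH : H ⊆ regularPlane qo) (c : ℂ) (x t : ℝ)
    (j : Fin 4) : HasExt qo H fun s => Complex.exp (c * phase qo x t s j) :=
  HasExt.of_differentiableOn (F := fun z => Complex.exp (c * phase qo x t z j))
    ((((differentiableOn_phase qo x t j).mono fun _ hz => hz.1).const_mul c).cexp) hH

lemma star_phase (qo x t s : ℝ) (j : Fin 4) : star (phase qo x t s j) = phase qo x t s j := by
  have h1 := kk_star qo s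
  have h2 := lam_star qo s
  simp only [RCLike.star_def, Complex.conj_ofReal] at h1 h2
  fin_cases j <;> simp [phase, h1, h2]

lemma star_exp_I_phase (qo x t s : ℝ) (j : Fin 4) :
    star (Complex.exp (Complex.I * phase qo x t s j)) =
      Complex.exp (-Complex.I * phase qo x t s j) := by
  have h := star_phase qo x t s j
  simp only [RCLike.star_def] at h ⊢
  rw [← Complex.exp_conj, map_mul, Complex.conj_I, h]

lemma expPhase_conjTranspose (qo x t s : ℝ) :
    (expPhase qo Complex.I x t s)ᴴ = expPhase qo (-Complex.I) x t s := by
  rw [expPhase, diagonal_conjTranspose, expPhase]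
  congr 1
  ext j
  exact star_exp_I_phase qo x t s j

lemma expPhase_origin (qo : ℝ) (c z : ℂ) : expPhase qo c 0 0 z = 1 := by
  rw [expPhase, ← diagonal_one]
  congr 1
  ext j
  fin_cases j <;> simp [phase]

lemma extCols_mul_expPhase {qo : ℝ} {H : Set ℂ} (hH : H ⊆ regularPlane qo) {N : ℝ → Mat} {t : ℝ}
    (h : ExtCols qo H fun s => N s * expPhase qo (-Complex.I) 0 t s) : ExtCols qo H N := by
  have h1 := h.mul_diagonal (d := fun s j => Complex.exp (Complex.I * phase qo 0 t s j))
    (fun j _ => hasExt_exp_phase hH _ 0 t j) (by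
      simp only [star_exp_I_phase]
      exact hasExt_exp_phase hH _ 0 t 3)
  have e : ∀ s : ℝ, N s * expPhase qo (-Complex.I) 0 t s *
      diagonal (fun j => Complex.exp (Complex.I * phase qo 0 t s j)) = N s := fun s => by
    rw [Matrix.mul_assoc]
    exact (congrArg (N s * ·) (expPhase_neg_mul qo 0 t s)).trans (Matrix.mul_one _)
  simpa only [e] using h1

lemma extCols_conj_mul_expPhase {qo : ℝ} {H : Set ℂ} (hH : H ⊆ regularPlane qo) {N : ℝ → Mat}
    {t : ℝ} (h : ExtCols qo H fun s => ((N s * expPhase qo (-Complex.I) 0 t s)ᴴ)ᵀ) :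
    ExtCols qo H fun s => ((N s)ᴴ)ᵀ := by
  have h1 := h.mul_diagonal (d := fun s j => Complex.exp (-Complex.I * phase qo 0 t s j))
    (fun j _ => hasExt_exp_phase hH _ 0 t j) (by
      simp only [← star_exp_I_phase, star_star]
      exact hasExt_exp_phase hH _ 0 t 3)
  have e : ∀ s : ℝ, ((N s * expPhase qo (-Complex.I) 0 t s)ᴴ)ᵀ *
      diagonal (fun j => Complex.exp (-Complex.I * phase qo 0 t s j)) = ((N s)ᴴ)ᵀ := fun s => by
    rw [← expPhase_conjTranspose, conjTranspose_mul, conjTranspose_conjTranspose, transpose_mul]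
    have : (expPhase qo Complex.I 0 t s)ᵀ = expPhase qo Complex.I 0 t s := diagonal_transpose _
    rw [this, Matrix.mul_assoc]
    exact (congrArg (((N s)ᴴ)ᵀ * ·) (expPhase_mul_neg qo 0 t s)).trans (Matrix.mul_one _)
  simpa only [e] using h1

/-- Two fundamental solutions of the same linear equation differ by a constant matrix. -/
lemma inv_mul_eq_const {Φ Ψ X : ℝ → Mat} {G : Mat} (hΦ : ∀ x, HasMatDerivAt Φ (X x * Φ x) x)
    (hΨ : ∀ x, HasMatDerivAt Ψ (X x * Ψ x) x) (hu : ∀ x, IsUnit (Φ x).det)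
    (hinv : ∀ x, (Φ x)⁻¹ = G * (Φ x)ᴴ * J) (x y : ℝ) :
    (Φ x)⁻¹ * Ψ x = (Φ y)⁻¹ * Ψ y := by
  refine eq_of_hasMatDerivAt_zero (Φ := fun x => (Φ x)⁻¹ * Ψ x) (fun x => ?_) x y
  obtain ⟨C', hC'⟩ : ∃ C', HasMatDerivAt (fun x => (Φ x)⁻¹ * Ψ x) C' x := by
    simp only [hinv]
    exact ⟨_, (((hΦ x).conjTranspose.const_mul G).mul_const J).mul (hΨ x)⟩
  have h1 := (hΦ x).mul hC'
  have e : ∀ x, Φ x * ((Φ x)⁻¹ * Ψ x) = Ψ x := fun x => by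
    rw [← Matrix.mul_assoc, Matrix.mul_nonsing_inv _ (hu x), Matrix.one_mul]
  simp only [e, Matrix.mul_assoc] at h1
  have h2 : X x * Ψ x + Φ x * C' = X x * Ψ x := by
    ext i j
    exact (h1 i j).unique (hΨ x i j)
  have h3 : Φ x * C' = 0 := by simpa using h2
  have h4 : C' = 0 := by
    have := congrArg ((Φ x)⁻¹ * ·) h3
    simpa [← Matrix.mul_assoc, Matrix.nonsing_inv_mul _ (hu x)] using this
  rw [h4] at hC'
  exact hC'

namespace IsJost

variable {qo θ θ' s : ℝ} {q : ℝ → ℝ → Fin 3 → ℂ} {l l' : Filter ℝ} {Φ Ψ : ℝ → ℝ → Mat}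

/-- The pairing `φ† J φ` equals `N` at all times, since the factors `e^{±iΘ(0,t)}` are unitary and
commute with `N`. -/
theorem gram [l.NeBot] (h : IsJost qo q θ l s Φ) (x t : ℝ) :
    (Φ x t)ᴴ * J * Φ x t = gramN qo s := by
  have h1 := (h.isSpatialJost t).gram (h.isSpatialJost t) x
  have e : Φ x t = Φ x t * expPhase qo (-Complex.I) 0 t s * expPhase qo Complex.I 0 t s := by
    rw [Matrix.mul_assoc, expPhase_neg_mul, Matrix.mul_one]
  rw [e, conjTranspose_mul _ (expPhase qo Complex.I 0 t s), expPhase_conjTranspose]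
  calc _ = expPhase qo (-Complex.I) 0 t s * ((Φ x t * expPhase qo (-Complex.I) 0 t s)ᴴ * J *
        (Φ x t * expPhase qo (-Complex.I) 0 t s)) * expPhase qo Complex.I 0 t s := by
        simp only [Matrix.mul_assoc]
    _ = gramN qo s * (expPhase qo (-Complex.I) 0 t s * expPhase qo Complex.I 0 t s) := by
        rw [h1, ← Matrix.mul_assoc]
        congr 1
        rw [expPhase, gramN, diagonal_mul_diagonal, diagonal_mul_diagonal]
        simp only [mul_comm]
    _ = gramN qo s := by rw [expPhase_neg_mul, Matrix.mul_one]

lemma left_inverse [l.NeBot] (h : IsJost qo q θ l s Φ) (hs : gam qo s ≠ 0) (x t : ℝ) :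
    gramInv qo s * (Φ x t)ᴴ * J * Φ x t = 1 := by
  rw [Matrix.mul_assoc, Matrix.mul_assoc, ← Matrix.mul_assoc _ J, h.gram, gramInv_mul_gramN hs]

lemma inv_eq [l.NeBot] (h : IsJost qo q θ l s Φ) (hs : gam qo s ≠ 0) (x t : ℝ) :
    (Φ x t)⁻¹ = gramInv qo s * (Φ x t)ᴴ * J :=
  Matrix.inv_eq_left_inv (h.left_inverse hs x t)

lemma isUnit_det [l.NeBot] (h : IsJost qo q θ l s Φ) (hs : gam qo s ≠ 0) (x t : ℝ) :
    IsUnit (Φ x t).det :=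
  Matrix.isUnit_det_of_left_inverse (h.left_inverse hs x t)

lemma det_eq [l.NeBot] (h : IsJost qo q θ l s Φ) (x t : ℝ) :
    (Φ x t).det = gam qo s * Complex.exp (2 * Complex.I * kk qo s * x) *
      Complex.exp (2 * Complex.I * phase qo 0 t s 1) := by
  have e : Φ x t = Φ x t * expPhase qo (-Complex.I) 0 t s * expPhase qo Complex.I 0 t s := by
    rw [Matrix.mul_assoc, expPhase_neg_mul, Matrix.mul_one]
  rw [e, det_mul, (h.isSpatialJost t).det_eq, expPhase, det_diagonal, Fin.prod_univ_four,
    ← Complex.exp_add, ← Complex.exp_add, ← Complex.exp_add]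
  congr 2
  simp only [phase]
  simp
  ring

/-- The scattering matrix is independent of `x` and `t`. -/
theorem inv_mul_eq [l.NeBot] (h : IsJost qo q θ l s Φ) (k : IsJost qo q θ' l' s Ψ)
    (hs : gam qo s ≠ 0) (x t : ℝ) : (Φ x t)⁻¹ * Ψ x t = (Φ 0 0)⁻¹ * Ψ 0 0 := by
  have h1 := inv_mul_eq_const (Φ := fun x => Φ x t) (Ψ := fun x => Ψ x t)
    (X := fun x => laxX qo q s x t) (fun x => h.1 x t) (fun x => k.1 x t)
    (fun x => h.isUnit_det hs x t) (fun x => h.inv_eq hs x t) x 0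
  have h2 := inv_mul_eq_const (Φ := Φ 0) (Ψ := Ψ 0)
    (X := fun t => laxT qo q s 0 t) (fun t => h.2.1 0 t) (fun t => k.2.1 0 t)
    (fun t => h.isUnit_det hs 0 t) (fun t => h.inv_eq hs 0 t) t 0
  exact h1.trans h2

end IsJost

namespace IsSolution

variable {qo θm θp : ℝ} {q : ℝ → ℝ → Fin 3 → ℂ}

lemma decaysLeft (hq : IsSolution qo θm θp q) (t : ℝ) : DecaysLeft qo θm fun x => q x t :=
  ⟨hq.smooth.continuous.comp (continuous_id.prodMk continuous_const), hq.integrable_left t⟩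

lemma decaysRight (hq : IsSolution qo θm θp q) (t : ℝ) : DecaysRight qo θp fun x => q x t :=
  ⟨hq.smooth.continuous.comp (continuous_id.prodMk continuous_const), hq.integrable_right t⟩

end IsSolution

namespace Data

variable {d : Data} {s : ℝ}

lemma Regular.ne_zero (h : d.Regular s) : s ≠ 0 := h.1

lemma Regular.gam_ne_zero (h : d.Regular s) : gam d.qo s ≠ 0 :=
  VNLS.gam_ne_zero (Complex.ofReal_ne_zero.2 h.1) (by exact_mod_cast h.2.1)
    (by exact_mod_cast h.2.2)

lemma Valid.isJost_phiMinus (hd : d.Valid) (h0 : s ≠ 0) (hs : gam d.qo s ≠ 0) :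
    IsJost d.qo d.q d.θm atBot s fun x t => d.phiMinus x t s :=
  Classical.epsilon_spec (exists_isJost hd.2 hd.2.tendsto_left hd.2.deriv_left h0
    (isSpatialJost_leftJost (hd.2.decaysLeft 0) h0 hs))

lemma Valid.isJost_phiPlus (hd : d.Valid) (h0 : s ≠ 0) (hs : gam d.qo s ≠ 0) :
    IsJost d.qo d.q d.θp atTop s fun x t => d.phiPlus x t s := by
  obtain ⟨ψ, hψ⟩ := exists_isSpatialJost_right (hd.2.decaysRight 0) h0 hs
  exact Classical.epsilon_spec (exists_isJost hd.2 hd.2.tendsto_right hd.2.deriv_right h0 hψ)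

lemma Valid.qo_ne_zero (hd : d.Valid) : d.qo ≠ 0 := hd.1.ne'

lemma Valid.extCols_phiMinus (hd : d.Valid) (x t : ℝ) :
    ExtCols d.qo upper fun s => d.phiMinus x t s :=
  extCols_mul_expPhase (upper_subset_regularPlane _) (t := t) <|
    extCols_left (φ := fun s x => d.phiMinus x t s * expPhase d.qo (-Complex.I) 0 t s)
      hd.qo_ne_zero (hd.2.decaysLeft t)
      (fun _ h0 hs => (hd.isJost_phiMinus h0 hs).isSpatialJost t) x

lemma Valid.extCols_phiMinus_conj (hd : d.Valid) (x t : ℝ) :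
    ExtCols d.qo lower fun s => ((d.phiMinus x t s)ᴴ)ᵀ :=
  extCols_conj_mul_expPhase (lower_subset_regularPlane _) (t := t) <|
    extCols_left_conj (φ := fun s x => d.phiMinus x t s * expPhase d.qo (-Complex.I) 0 t s)
      hd.qo_ne_zero (hd.2.decaysLeft t)
      (fun _ h0 hs => (hd.isJost_phiMinus h0 hs).isSpatialJost t) x

lemma Valid.extCols_phiPlus (hd : d.Valid) (x t : ℝ) :
    ExtCols d.qo lower fun s => d.phiPlus x t s :=
  extCols_mul_expPhase (lower_subset_regularPlane _) (t := t) <|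
    extCols_right (φ := fun s x => d.phiPlus x t s * expPhase d.qo (-Complex.I) 0 t s)
      hd.qo_ne_zero (hd.2.decaysRight t)
      (fun _ h0 hs => (hd.isJost_phiPlus h0 hs).isSpatialJost t) x

lemma Valid.extCols_phiPlus_conj (hd : d.Valid) (x t : ℝ) :
    ExtCols d.qo upper fun s => ((d.phiPlus x t s)ᴴ)ᵀ :=
  extCols_conj_mul_expPhase (upper_subset_regularPlane _) (t := t) <|
    extCols_right_conj (φ := fun s x => d.phiPlus x t s * expPhase d.qo (-Complex.I) 0 t s)
      hd.qo_ne_zero (hd.2.decaysRight t)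
      (fun _ h0 hs => (hd.isJost_phiPlus h0 hs).isSpatialJost t) x

lemma Valid.scatA_eq (hd : d.Valid) (h0 : s ≠ 0) (hs : gam d.qo s ≠ 0) (x t : ℝ) :
    d.scatA s = (d.phiPlus x t s)⁻¹ * d.phiMinus x t s :=
  ((hd.isJost_phiPlus h0 hs).inv_mul_eq (hd.isJost_phiMinus h0 hs) hs x t).symm

lemma Valid.scatB_eq (hd : d.Valid) (h0 : s ≠ 0) (hs : gam d.qo s ≠ 0) (x t : ℝ) :
    d.scatB s = (d.phiMinus x t s)⁻¹ * d.phiPlus x t s := by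
  rw [scatB, hd.scatA_eq h0 hs x t, Matrix.mul_inv_rev, Matrix.nonsing_inv_nonsing_inv _
    ((hd.isJost_phiPlus h0 hs).isUnit_det hs x t)]

lemma Valid.phiMinus_eq (hd : d.Valid) (h0 : s ≠ 0) (hs : gam d.qo s ≠ 0) (x t : ℝ) :
    d.phiMinus x t s = d.phiPlus x t s * d.scatA s := by
  rw [hd.scatA_eq h0 hs x t, ← Matrix.mul_assoc,
    Matrix.mul_nonsing_inv _ ((hd.isJost_phiPlus h0 hs).isUnit_det hs x t), Matrix.one_mul]

lemma Valid.det_phi_eq (hd : d.Valid) (h0 : s ≠ 0) (hs : gam d.qo s ≠ 0) (x t : ℝ) :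
    (d.phiMinus x t s).det = (d.phiPlus x t s).det := by
  rw [(hd.isJost_phiMinus h0 hs).det_eq x t, (hd.isJost_phiPlus h0 hs).det_eq x t]

lemma Valid.det_scatA (hd : d.Valid) (h0 : s ≠ 0) (hs : gam d.qo s ≠ 0) :
    (d.scatA s).det = 1 := by
  have hu := (hd.isJost_phiPlus h0 hs).isUnit_det hs 0 0
  rw [hd.scatA_eq h0 hs 0 0, det_mul, hd.det_phi_eq h0 hs, ← det_mul,
    Matrix.nonsing_inv_mul _ hu, det_one]

/-- The scattering matrix is unitary for the indefinite form `N = E_±† J E_±`. -/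
lemma Valid.scatA_gram (hd : d.Valid) (h0 : s ≠ 0) (hs : gam d.qo s ≠ 0) :
    (d.scatA s)ᴴ * gramN d.qo s * d.scatA s = gramN d.qo s := by
  have h1 := (hd.isJost_phiPlus h0 hs).gram 0 0
  have h2 := (hd.isJost_phiMinus h0 hs).gram 0 0
  simp only [hd.phiMinus_eq h0 hs 0 0] at h2
  calc (d.scatA s)ᴴ * gramN d.qo s * d.scatA s
      = (d.phiPlus 0 0 s * d.scatA s)ᴴ * J * (d.phiPlus 0 0 s * d.scatA s) := by
        rw [← h1, conjTranspose_mul]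
        simp only [Matrix.mul_assoc]
    _ = gramN d.qo s := h2

lemma Valid.scatB_eq_gram (hd : d.Valid) (h0 : s ≠ 0) (hs : gam d.qo s ≠ 0) :
    d.scatB s = gramInv d.qo s * (d.scatA s)ᴴ * gramN d.qo s :=
  Matrix.inv_eq_left_inv (by
    rw [Matrix.mul_assoc, Matrix.mul_assoc, ← Matrix.mul_assoc _ (gramN _ _),
      hd.scatA_gram h0 hs, gramInv_mul_gramN hs])

/-- The factor by which the Jost eigenfunctions at `s` and `ŝ` differ. -/
lemma Valid.phi_hat (hd : d.Valid) (h0 : s ≠ 0) (hs : gam d.qo s ≠ 0) :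
    d.phiMinus 0 0 (d.hat s) = d.phiMinus 0 0 s *
      swapMat (Complex.I * s * amp d.qo d.θm / d.qo ^ 2)
        (-(Complex.I * s * star (amp d.qo d.θm) / d.qo ^ 2)) ∧
    d.phiPlus 0 0 (d.hat s) = d.phiPlus 0 0 s *
      swapMat (Complex.I * s * amp d.qo d.θp / d.qo ^ 2)
        (-(Complex.I * s * star (amp d.qo d.θp) / d.qo ^ 2)) := by
  have hq := hd.qo_ne_zero
  have h0' : d.hat s ≠ 0 := div_ne_zero (pow_ne_zero 2 hq) h0
  have hs' : gam d.qo (d.hat s) ≠ 0 := by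
    have := gam_hat_ne_zero hq (Complex.ofReal_ne_zero.2 h0) hs
    simpa [hat] using this
  have h1 := ((hd.isJost_phiMinus h0 hs).isSpatialJost 0).hat hq h0
  have h2 := (hd.isJost_phiMinus h0' hs').isSpatialJost 0
  have h3 := ((hd.isJost_phiPlus h0 hs).isSpatialJost 0).hat hq h0
  have h4 := (hd.isJost_phiPlus h0' hs').isSpatialJost 0
  have e1 := congrFun (h2.unique h1 hs') 0
  have e2 := congrFun (h4.unique h3 hs') 0
  simpa only [expPhase_origin, Matrix.mul_one] using And.intro e1 e2

end Data

end VNLS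

namespace VNLS

/-! ### The algebra of the jump relation -/

/-- Jacobi's identity for a complementary pair of `2 × 2` minors of a matrix and its inverse. -/
lemma minor_eq_minor_inv {A B : Mat} (hA : A.det = 1) (hAB : A * B = 1) :
    minor A ![2, 3] ![2, 3] = minor B ![0, 1] ![0, 1] ∧
    minor A ![1, 3] ![2, 3] = -minor B ![0, 1] ![0, 2] := by
  have hcol : ∀ i k, ∑ m, A i m * B m k = (1 : Mat) i k := fun i k => by
    rw [← hAB, Matrix.mul_apply]
  -- multiplying `A` by the columns `B e₀, B e_k, e₂, e₃` gives the columns `e₀, e_k, A e₂, A e₃`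
  have key : ∀ k, (of ![(1 : Mat).col 0, (1 : Mat).col k, A.col 2, A.col 3])ᵀ =
      A * (of ![B.col 0, B.col k, (1 : Mat).col 2, (1 : Mat).col 3])ᵀ := by
    intro k
    ext i j
    rw [Matrix.mul_apply]
    fin_cases j
    · exact (hcol i 0).symm
    · exact (hcol i k).symm
    · simp [Matrix.one_apply]
    · simp [Matrix.one_apply]
  have hdet : ∀ k, (of ![(1 : Mat).col 0, (1 : Mat).col k, A.col 2, A.col 3]).det =
      (of ![B.col 0, B.col k, (1 : Mat).col 2, (1 : Mat).col 3]).det := fun k => by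
    rw [← det_transpose, key, det_mul, hA, one_mul, det_transpose]
  have h1 := hdet 1
  have h2 := hdet 2
  constructor
  · rw [minor_two, minor_two]
    simp [det_succ_row_zero, Fin.sum_univ_succ, Matrix.one_apply, Fin.succAbove] at h1
    linear_combination h1
  · rw [minor_two, minor_two]
    simp [det_succ_row_zero, Fin.sum_univ_succ, Matrix.one_apply, Fin.succAbove] at h2
    linear_combination -h2

section Algebra

variable {A : Mat} {qo s : ℝ}

lemma gramInv_mul_gramN_apply (M : Mat) (z : ℂ) (i j : Fin 4) :
    (gramInv qo z * Mᴴ * gramN qo z) i j =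
      (![(gam qo z)⁻¹, -1, -1, -(gam qo z)⁻¹] : Fin 4 → ℂ) i * star (M j i) *
        (![gam qo z, -1, -1, -gam qo z] : Fin 4 → ℂ) j := by
  rw [gramN, mul_diagonal, gramInv, diagonal_mul, conjTranspose_apply]

/-- The principal minors of order three and the leading minor of `A⁻¹`. -/
lemma minor_three_eq (hA : A.det = 1) :
    minor A ![0, 1, 2] ![0, 1, 2] = A⁻¹ 3 3 ∧ minor A ![0, 1, 3] ![0, 1, 2] = -A⁻¹ 3 2 ∧
    minor A ![1, 2, 3] ![1, 2, 3] = A⁻¹ 0 0 := by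
  have h := det_submatrix_succAbove (N := A) (by rw [hA]; exact one_ne_zero)
  refine ⟨?_, ?_, ?_⟩
  · have := h 3 3
    rw [succAbove_three, hA] at this
    rw [minor, this]
    norm_num
  · have := h 3 2
    rw [succAbove_three, succAbove_two, hA] at this
    rw [minor, this]
    norm_num
  · have := h 0 0
    rw [succAbove_zero', hA] at this
    rw [minor, this]
    norm_num

/-- The factor `U` in `M⁺ = φ₊ U e^{-iΘ}`. -/
def jumpU (r1 r2 r3 a κ : ℂ) : Mat := !![1, 0, 0, 0; r1, 1, 0, 0; r2, 0, 1, 0; r3, a, κ, 1]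

/-- The factor `V` in `M⁻ = φ₊ V e^{-iΘ}`. -/
def jumpV (v b w1 w2 w3 : ℂ) : Mat := !![1, v, b, w1; 0, 1, 0, w2; 0, 0, 1, w3; 0, 0, 0, 1]

lemma aux2_mul_left (Φ A : Mat) : aux2 (Φ * A) A = Φ *ᵥ aux2 A A := by
  funext i
  simp only [aux2, Pi.sub_apply, Pi.smul_apply, smul_eq_mul, Matrix.col_apply, Matrix.mul_apply,
    Matrix.mulVec, dotProduct, Fin.sum_univ_four]
  ring

lemma aux3_mul_left (Φ A : Mat) : aux3 (Φ * A) A = Φ *ᵥ aux3 A A := by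
  funext i
  simp only [aux3, Pi.add_apply, Pi.sub_apply, Pi.smul_apply, smul_eq_mul, Matrix.col_apply,
    Matrix.mul_apply, Matrix.mulVec, dotProduct, Fin.sum_univ_four]
  ring

lemma aux2_self (A : Mat) : aux2 A A =
    ![0, minor A ![0, 1] ![0, 1], minor A ![0, 2] ![0, 1], minor A ![0, 3] ![0, 1]] := by
  funext i
  simp only [aux2, minor_two, Pi.sub_apply, Pi.smul_apply, smul_eq_mul, Matrix.col_apply]
  fin_cases i <;> simp
  ring

lemma aux3_self (A : Mat) : aux3 A A =
    ![0, 0, minor A ![0, 1, 2] ![0, 1, 2], minor A ![0, 1, 3] ![0, 1, 2]] := by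
  funext i
  simp only [aux3, minor_two, minor_three, Pi.add_apply, Pi.sub_apply, Pi.smul_apply, smul_eq_mul,
    Matrix.col_apply]
  fin_cases i <;> simp <;> ring

/-- The boundary values of the columns of `M⁺ e^{iΘ}` in terms of `φ₊`. -/
lemma plus_columns (Φ : Mat) (h1 : A 0 0 ≠ 0) (h2 : minor A ![0, 1] ![0, 1] ≠ 0)
    (h3 : minor A ![0, 1, 2] ![0, 1, 2] ≠ 0) :
    (of ![(A 0 0)⁻¹ • (Φ * A).col 0,
      (minor A ![0, 1] ![0, 1])⁻¹ • (aux2 (Φ * A) A -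
        (minor A ![0, 2] ![0, 1] / minor A ![0, 1, 2] ![0, 1, 2]) • aux3 (Φ * A) A),
      (minor A ![0, 1, 2] ![0, 1, 2])⁻¹ • aux3 (Φ * A) A, Φ.col 3])ᵀ =
    Φ * jumpU (A 1 0 / A 0 0) (A 2 0 / A 0 0) (A 3 0 / A 0 0)
      (minor A ![0, 3] ![0, 1] / minor A ![0, 1] ![0, 1] -
        minor A ![0, 1, 3] ![0, 1, 2] / minor A ![0, 1, 2] ![0, 1, 2] *
          (minor A ![0, 2] ![0, 1] / minor A ![0, 1] ![0, 1]))
      (minor A ![0, 1, 3] ![0, 1, 2] / minor A ![0, 1, 2] ![0, 1, 2]) := by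
  rw [aux2_mul_left, aux3_mul_left, aux2_self, aux3_self]
  generalize minor A ![0, 1] ![0, 1] = m12 at h2 ⊢
  generalize minor A ![0, 1, 2] ![0, 1, 2] = m123 at h3 ⊢
  ext i j
  fin_cases j <;>
    simp [jumpU, Matrix.mul_apply, Fin.sum_univ_four, Matrix.mulVec, dotProduct] <;>
    field_simp
  ring

/-- The boundary values of the columns of `M⁻ e^{iΘ}` in terms of `φ₊`. -/
lemma minus_columns (Φ : Mat) {B : Mat} (h1 : B 0 0 ≠ 0) (h2 : minor B ![0, 1] ![0, 1] ≠ 0)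
    (h3 : A 3 3 ≠ 0) :
    (of ![Φ.col 0, (B 0 0)⁻¹ • aux2 Φ B,
      (minor B ![0, 1] ![0, 1])⁻¹ • (aux3 Φ B - (-minor B ![0, 1] ![0, 2] / B 0 0) • aux2 Φ B),
      (A 3 3)⁻¹ • (Φ * A).col 3])ᵀ =
    Φ * jumpV (-(B 0 1 / B 0 0)) (minor B ![0, 1] ![1, 2] / minor B ![0, 1] ![0, 1] -
        B 0 1 / B 0 0 * (minor B ![0, 1] ![0, 2] / minor B ![0, 1] ![0, 1]))
      (A 0 3 / A 3 3) (A 1 3 / A 3 3) (A 2 3 / A 3 3) := by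
  simp only [aux2, aux3]
  generalize minor B ![0, 1] ![0, 1] = m12 at h2 ⊢
  ext i j
  fin_cases j <;>
    simp [jumpV, Matrix.mul_apply, Fin.sum_univ_four] <;>
    field_simp <;> ring

end Algebra

end VNLS

namespace VNLS

/-- The factorization of the jump matrix, as an identity in independent variables. -/
lemma jumpU_eq_jumpV_mul (r1 r2 r3 h1 h2 h3 γ c e p a b k r1' h2' : ℂ) (hce : c * e = -k) :
    jumpU r1 r2 r3 a (-(e * h2')) = jumpV (r1' / γ) b (-(p * h3)) (-(c * h1)) (-(c * h2)) * (1 -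
      !![r1 * r1' / γ + b * (r2 + c * h2 * r3) - p * r3 * h3 + c / γ * r1' * h1 * r3,
          r1' / γ - a * (p * h3 - c / γ * r1' * h1 - b * c * h2),
          b + e * h2' * (p * h3 - c / γ * r1' * h1 - c * b * h2),
          -(p * h3) + c / γ * r1' * h1 + c * b * h2;
        -r1 - c * h1 * r3, -(c * a * h1), -(k * h1 * h2'), -(c * h1);
        -r2 - c * h2 * r3, -(c * a * h2), -(k * (h2 * h2')), -(c * h2);
        -r3, -a, e * h2', 0]) := by
  rw [mul_sub, Matrix.mul_one]
  ext i j
  simp only [jumpU, jumpV, Matrix.mul_apply, Fin.sum_univ_four, Matrix.sub_apply]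
  obtain rfl : k = -(c * e) := by rw [hce, neg_neg]
  fin_cases i <;> fin_cases j <;> simp <;> ring

namespace Data

variable {d : Data} {s : ℝ}

lemma Regular.hat (hd : d.Valid) (h : d.Regular s) : d.hat s ≠ 0 ∧ gam d.qo (d.hat s) ≠ 0 := by
  refine ⟨div_ne_zero (pow_ne_zero 2 hd.qo_ne_zero) h.1, ?_⟩
  have := gam_hat_ne_zero hd.qo_ne_zero (Complex.ofReal_ne_zero.2 h.1) h.gam_ne_zero
  simpa [Data.hat] using this

lemma Regular.regular_hat (hd : d.Valid) (h : d.Regular s) : d.Regular (d.hat s) := by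
  obtain ⟨h0, h1⟩ := h.hat hd
  have hq : (d.qo : ℂ) ≠ 0 := Complex.ofReal_ne_zero.2 hd.qo_ne_zero
  refine ⟨h0, fun h => h1 ?_, fun h => h1 ?_⟩ <;> rw [h, gam] <;> simp [hq]

lemma Valid.scatA_hat (hd : d.Valid) (h : d.Regular s) :
    swapMat (Complex.I * s * d.qp / d.qo ^ 2) (-(Complex.I * s * star d.qp / d.qo ^ 2)) *
      d.scatA (d.hat s) = d.scatA s *
      swapMat (Complex.I * s * amp d.qo d.θm / d.qo ^ 2)
        (-(Complex.I * s * star (amp d.qo d.θm) / d.qo ^ 2)) := by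
  obtain ⟨h0, h1⟩ := h.hat hd
  obtain ⟨e1, e2⟩ := hd.phi_hat h.1 h.gam_ne_zero
  have hu := (hd.isJost_phiPlus h.1 h.gam_ne_zero).isUnit_det h.gam_ne_zero 0 0
  have e3 := hd.phiMinus_eq h0 h1 0 0
  rw [e1, e2, hd.phiMinus_eq h.1 h.gam_ne_zero 0 0] at e3
  have e4 := congrArg ((d.phiPlus 0 0 s)⁻¹ * ·) e3
  simp only [Matrix.mul_assoc] at e4
  rw [Matrix.nonsing_inv_mul_cancel_left _ _ hu, Matrix.nonsing_inv_mul_cancel_left _ _ hu] at e4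
  exact e4.symm

/-- The first column of the scattering matrix at `ŝ` is a multiple of its last column at `s`. -/
lemma Valid.scatA_hat_col (hd : d.Valid) (h : d.Regular s) :
    ∃ μ : ℂ, μ ≠ 0 ∧ d.scatA (d.hat s) 1 0 = μ * d.scatA s 1 3 ∧
      d.scatA (d.hat s) 2 0 = μ * d.scatA s 2 3 ∧
      Complex.I * s * d.qp / d.qo ^ 2 * d.scatA (d.hat s) 0 0 = μ * d.scatA s 3 3 ∧
      -(Complex.I * s * star d.qp / d.qo ^ 2) * d.scatA (d.hat s) 3 0 = μ * d.scatA s 0 3 := by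
  have hW := hd.scatA_hat h
  have hq : (d.qo : ℂ) ≠ 0 := Complex.ofReal_ne_zero.2 hd.qo_ne_zero
  have hs : (s : ℂ) ≠ 0 := Complex.ofReal_ne_zero.2 h.1
  refine ⟨Complex.I * s * amp d.qo d.θm / d.qo ^ 2, ?_, ?_, ?_, ?_, ?_⟩
  · simp [amp, hq, hs, Complex.exp_ne_zero]
  all_goals rw [mul_comm (_ / _) (d.scatA s _ _)]
  · simpa [swapMat, Matrix.mul_apply, Fin.sum_univ_four] using congrFun (congrFun hW 1) 0
  · simpa [swapMat, Matrix.mul_apply, Fin.sum_univ_four] using congrFun (congrFun hW 2) 0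
  · simpa [swapMat, Matrix.mul_apply, Fin.sum_univ_four] using congrFun (congrFun hW 3) 0
  · simpa [swapMat, Matrix.mul_apply, Fin.sum_univ_four] using congrFun (congrFun hW 0) 0

lemma Valid.scatB_apply (hd : d.Valid) (h0 : s ≠ 0) (hs : gam d.qo s ≠ 0) (i j : Fin 4) :
    d.scatB s i j = (![(gam d.qo s)⁻¹, -1, -1, -(gam d.qo s)⁻¹] : Fin 4 → ℂ) i *
      star (d.scatA s j i) * (![gam d.qo s, -1, -1, -gam d.qo s] : Fin 4 → ℂ) j := by
  rw [hd.scatB_eq_gram h0 hs, gramInv_mul_gramN_apply]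

/-- The denominators of `M⁻` are nonzero where those of `M⁺` are. -/
lemma Valid.denominators (hd : d.Valid) (h : d.Regular s) (hn : d.NonSingular s) :
    d.scatA s 0 0 ≠ 0 ∧ d.scatB s 0 0 ≠ 0 ∧ minor (d.scatB s) ![0, 1] ![0, 1] ≠ 0 ∧
      d.scatA s 3 3 ≠ 0 := by
  have hγ := h.gam_ne_zero
  obtain ⟨n1, n2, n3⟩ := hn
  rw [minor_one] at n1
  have hB := hd.scatB_apply h.1 hγ
  refine ⟨n1, ?_, ?_, ?_⟩
  · rw [hB]
    simpa [hγ] using n1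
  · intro h0
    apply n2
    rw [minor_two] at h0 ⊢
    simp only [hB] at h0
    apply star_injective
    rw [star_sub, star_mul', star_mul', star_zero]
    simp at h0 ⊢
    field_simp at h0
    linear_combination h0
  · rw [(minor_three_eq (hd.det_scatA h.1 hγ)).1] at n3
    change d.scatB s 3 3 ≠ 0 at n3
    rw [hB] at n3
    intro h0
    apply n3
    rw [h0]
    simp

/-- The relation `U = V (1 - L)` between the factors of `M⁺` and `M⁻`. The symmetry `s ↦ ŝ` turns
the last column of `A` into reflection coefficients at `ŝ`, and the unitarity of `A` expresses the
inverse matrix `B` through `A`. -/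
theorem Valid.jump_factors (hd : d.Valid) (h : d.Regular s) (hn : d.NonSingular s) :
    jumpU (d.scatA s 1 0 / d.scatA s 0 0) (d.scatA s 2 0 / d.scatA s 0 0)
      (d.scatA s 3 0 / d.scatA s 0 0)
      (minor (d.scatA s) ![0, 3] ![0, 1] / minor (d.scatA s) ![0, 1] ![0, 1] -
        minor (d.scatA s) ![0, 1, 3] ![0, 1, 2] / minor (d.scatA s) ![0, 1, 2] ![0, 1, 2] *
          (minor (d.scatA s) ![0, 2] ![0, 1] / minor (d.scatA s) ![0, 1] ![0, 1]))
      (minor (d.scatA s) ![0, 1, 3] ![0, 1, 2] / minor (d.scatA s) ![0, 1, 2] ![0, 1, 2]) =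
    jumpV (-(d.scatB s 0 1 / d.scatB s 0 0))
      (minor (d.scatB s) ![0, 1] ![1, 2] / minor (d.scatB s) ![0, 1] ![0, 1] -
        d.scatB s 0 1 / d.scatB s 0 0 *
          (minor (d.scatB s) ![0, 1] ![0, 2] / minor (d.scatB s) ![0, 1] ![0, 1]))
      (d.scatA s 0 3 / d.scatA s 3 3) (d.scatA s 1 3 / d.scatA s 3 3)
      (d.scatA s 2 3 / d.scatA s 3 3) * (1 - d.L s) := by
  have hγ := h.gam_ne_zero
  have hs : (s : ℂ) ≠ 0 := Complex.ofReal_ne_zero.2 h.1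
  have hq : (d.qo : ℂ) ≠ 0 := Complex.ofReal_ne_zero.2 hd.qo_ne_zero
  have hqp : d.qp ≠ 0 := mul_ne_zero hq (Complex.exp_ne_zero _)
  have hqs : star d.qp * d.qp = (d.qo : ℂ) ^ 2 := star_amp_mul d.qo d.θp
  have hqp' : star d.qp ≠ 0 := star_ne_zero.2 hqp
  have hI := Complex.I_sq
  obtain ⟨n1, n2, n3, n4⟩ := hd.denominators h hn
  obtain ⟨μ, hμ, e1, e2, e0, e3⟩ := hd.scatA_hat_col h
  obtain ⟨hh0, hhγ⟩ := h.hat hd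
  have hB := hd.scatB_apply h.1 hγ
  have hA0 : d.scatA (d.hat s) 0 0 ≠ 0 := by
    intro h0
    rw [h0, mul_zero] at e0
    exact mul_ne_zero hμ n4 e0.symm
  -- the last column of `A` in terms of the reflection coefficients at `ŝ`
  have e0' : d.scatA s 3 3 = Complex.I * s * d.qp / d.qo ^ 2 * d.scatA (d.hat s) 0 0 / μ := by
    rw [e0]
    field_simp
  have w1 : d.scatA s 1 3 / d.scatA s 3 3 =
      -(Complex.I * star d.qp / s * d.rho1 (d.hat s)) := by
    rw [rho1, e1, e0', ← hqs]
    field_simp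
    linear_combination d.scatA s 1 3 * hI
  have w2 : d.scatA s 2 3 / d.scatA s 3 3 =
      -(Complex.I * star d.qp / s * d.rho2 (d.hat s)) := by
    rw [rho2, e2, e0', ← hqs]
    field_simp
    linear_combination d.scatA s 2 3 * hI
  have w3 : d.scatA s 0 3 / d.scatA s 3 3 = -(star d.qp / d.qp * d.rho3 (d.hat s)) := by
    have e3' : d.scatA s 0 3 = -(Complex.I * s * star d.qp / d.qo ^ 2) *
        d.scatA (d.hat s) 3 0 / μ := by
      rw [e3]
      field_simp
    rw [rho3, e0', e3']
    field_simp
  have v1 : -(d.scatB s 0 1 / d.scatB s 0 0) = star (d.rho1 s) / gam d.qo s := by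
    rw [hB, hB, rho1, star_div₀]
    have := star_ne_zero.2 n1
    simp at this ⊢
    field_simp
  have hκ : minor (d.scatA s) ![0, 1, 3] ![0, 1, 2] / minor (d.scatA s) ![0, 1, 2] ![0, 1, 2] =
      -(Complex.I * d.qp / (s * gam d.qo s) * star (d.rho2 (d.hat s))) := by
    obtain ⟨m1, m2, -⟩ := minor_three_eq (hd.det_scatA h.1 hγ)
    rw [m1, m2]
    change -d.scatB s 3 2 / d.scatB s 3 3 = _
    have w2' := congrArg star w2
    rw [star_div₀, star_neg, star_mul', star_div₀, star_mul', star_star] at w2'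
    rw [hB, hB]
    have hst : star (s : ℂ) = s := Complex.conj_ofReal s
    have hIs : star Complex.I = -Complex.I := Complex.conj_I
    rw [hst, hIs] at w2'
    have h33 := star_ne_zero.2 n4
    rw [div_eq_iff h33] at w2'
    rw [w2']
    generalize star (d.scatA s 3 3) = w at h33 ⊢
    simp
    field_simp
  have hρ : -(Complex.I * d.qp / (s * gam d.qo s) * star (d.rho2 (d.hat s))) =
      s / (Complex.I * star d.qp) * d.rhoBar2 (d.hat s) := by
    have hB' := hd.scatB_apply hh0 hhγ
    have hγh : gam d.qo (d.hat s) = -(gam d.qo s * s ^ 2 / d.qo ^ 2) := by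
      rw [Data.hat, gam, gam]
      push_cast
      field_simp
      ring
    rw [rhoBar2, hB', hB', hγh, rho2, star_div₀]
    have hw := star_ne_zero.2 hA0
    generalize star (d.scatA (d.hat s) 0 0) = w at hw ⊢
    generalize star (d.scatA (d.hat s) 2 0) = w'
    simp only [Matrix.cons_val]
    rw [← hqs]
    field_simp
    linear_combination (-w') * hI
  rw [hκ]
  have ha : minor (d.scatA s) ![0, 3] ![0, 1] / minor (d.scatA s) ![0, 1] ![0, 1] -
      -(Complex.I * d.qp / (s * gam d.qo s) * star (d.rho2 (d.hat s))) *
        (minor (d.scatA s) ![0, 2] ![0, 1] / minor (d.scatA s) ![0, 1] ![0, 1]) = d.a s := by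
    rw [hρ, Data.a]
  have hb : minor (d.scatB s) ![0, 1] ![1, 2] / minor (d.scatB s) ![0, 1] ![0, 1] -
      d.scatB s 0 1 / d.scatB s 0 0 *
        (minor (d.scatB s) ![0, 1] ![0, 2] / minor (d.scatB s) ![0, 1] ![0, 1]) = d.b s := rfl
  rw [ha, hb, v1, w1, w2, w3]
  have hce : Complex.I * star d.qp / s * (Complex.I * d.qp / (s * gam d.qo s)) =
      -((d.qo : ℂ) ^ 2 / (s ^ 2 * gam d.qo s)) := by
    rw [← hqs]
    field_simp
    linear_combination hI
  have hL := jumpU_eq_jumpV_mul (d.rho1 s) (d.rho2 s) (d.rho3 s) (d.rho1 (d.hat s))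
    (d.rho2 (d.hat s)) (d.rho3 (d.hat s)) (gam d.qo s) (Complex.I * star d.qp / s)
    (Complex.I * d.qp / (s * gam d.qo s)) (star d.qp / d.qp) (d.a s) (d.b s)
    ((d.qo : ℂ) ^ 2 / (s ^ 2 * gam d.qo s)) (star (d.rho1 s)) (star (d.rho2 (d.hat s))) hce
  refine hL.trans ?_
  congr 2
  have hn : ∀ w : ℂ, w * star w = ((‖w‖ ^ 2 : ℝ) : ℂ) := fun w => by
    push_cast
    exact Complex.mul_conj' w
  rw [hn, hn]
  rfl

/-- Without reflection, unitarity annihilates the off-diagonal entries of the first row of `A(s)`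
and, by the symmetry `s ↦ ŝ`, of its last row and column. -/
theorem Valid.L_eq_zero (hd : d.Valid) (h : d.Regular s) (hn : d.NonSingular s)
    (hr : d.rho1 s = 0 ∧ d.rho2 s = 0 ∧ d.rho3 s = 0)
    (hr' : d.rho1 (d.hat s) = 0 ∧ d.rho2 (d.hat s) = 0 ∧ d.rho3 (d.hat s) = 0) : d.L s = 0 := by
  have hγ := h.gam_ne_zero
  have hs : (s : ℂ) ≠ 0 := Complex.ofReal_ne_zero.2 h.1
  have hq : (d.qo : ℂ) ≠ 0 := Complex.ofReal_ne_zero.2 hd.qo_ne_zero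
  have hqp : d.qp ≠ 0 := mul_ne_zero hq (Complex.exp_ne_zero _)
  have hqp' : star d.qp ≠ 0 := star_ne_zero.2 hqp
  obtain ⟨n1, n2, n3, n4⟩ := hd.denominators h hn
  obtain ⟨μ, hμ, e1, e2, e0, e3⟩ := hd.scatA_hat_col h
  obtain ⟨hh0, hhγ⟩ := h.hat hd
  have hB := hd.scatB_apply h.1 hγ
  have hB' := hd.scatB_apply hh0 hhγ
  have hA0 : d.scatA (d.hat s) 0 0 ≠ 0 := by
    intro h0
    rw [h0, mul_zero] at e0
    exact mul_ne_zero hμ n4 e0.symm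
  have z1 : d.scatA s 1 0 = 0 := (div_eq_zero_iff.1 hr.1).resolve_right n1
  have z2 : d.scatA s 2 0 = 0 := (div_eq_zero_iff.1 hr.2.1).resolve_right n1
  have z3 : d.scatA s 3 0 = 0 := (div_eq_zero_iff.1 hr.2.2).resolve_right n1
  have y1 : d.scatA (d.hat s) 1 0 = 0 := (div_eq_zero_iff.1 hr'.1).resolve_right hA0
  have y2 : d.scatA (d.hat s) 2 0 = 0 := (div_eq_zero_iff.1 hr'.2.1).resolve_right hA0
  have y3 : d.scatA (d.hat s) 3 0 = 0 := (div_eq_zero_iff.1 hr'.2.2).resolve_right hA0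
  have x1 : d.scatA s 1 3 = 0 := by simpa [y1, hμ] using e1.symm
  have x2 : d.scatA s 2 3 = 0 := by simpa [y2, hμ] using e2.symm
  have x0 : d.scatA s 0 3 = 0 := by simpa [y3, hμ] using e3.symm
  have x3 : d.scatA s 3 1 = 0 := by
    have hg := congrFun (congrFun (hd.scatA_gram h.1 hγ) 3) 1
    simp [Matrix.mul_apply, Fin.sum_univ_four, gramN, x0, x1, x2, n4, hγ] at hg
    exact hg
  have ha : d.a s = 0 := by
    have hbar : d.rhoBar2 (d.hat s) = 0 := by
      rw [rhoBar2, hB', y2]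
      simp
    rw [Data.a, hbar, minor_two, x3, z3]
    simp
  have hb : d.b s = 0 := by
    have hb1 : d.scatB s 0 1 = 0 := by
      rw [hB, z1]
      simp
    have hb2 : d.scatB s 0 2 = 0 := by
      rw [hB, z2]
      simp
    rw [Data.b, rhoBar1, minor_two, hb1, hb2]
    simp
  ext i j
  simp only [Data.L, ha, hb, hr.1, hr.2.1, hr.2.2, hr'.1, hr'.2.1, hr'.2.2]
  fin_cases i <;> fin_cases j <;> simp

end Data

end VNLS

namespace VNLS

/-! ### Analytic extension and boundary values -/

section

variable {d : Data} {H : Set ℂ}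

lemma IsExtension.meromorphicAt (hH : IsOpen H) {f : ℝ → ℂ} {F : ℂ → ℂ}
    (h : IsExtension d H f F) {z : ℂ} (hz : z ∈ H) : MeromorphicAt F z :=
  (h.1.analyticAt (hH.mem_nhds hz)).meromorphicAt

lemma IsExtension.meromorphicAt_apply (hH : IsOpen H) {f : ℝ → Fin 4 → ℂ} {F : ℂ → Fin 4 → ℂ}
    (h : IsExtension d H f F) {z : ℂ} (hz : z ∈ H) (i : Fin 4) :
    MeromorphicAt (fun z => F z i) z :=
  ((differentiableOn_pi.1 h.1 i).analyticAt (hH.mem_nhds hz)).meromorphicAt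

end

namespace Data

variable {d : Data} {H : Set ℂ}

lemma isExtension_ext {f : ℝ → ℂ} (h : HasExt d.qo H f) : IsExtension d H f (ext d H f) := by
  obtain ⟨F, hF, hl⟩ := h
  exact Classical.epsilon_spec (p := IsExtension d H f)
    ⟨F, hF, fun s hs => hl s hs.ne_zero hs.gam_ne_zero⟩

lemma isExtension_ext_pi {f : ℝ → Fin 4 → ℂ} (h : ∀ i, HasExt d.qo H fun s => f s i) :
    IsExtension d H f (ext d H f) := by
  choose F hF hl using h
  exact Classical.epsilon_spec (p := IsExtension d H f) ⟨fun z i => F i z,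
    differentiableOn_pi.2 hF, fun s hs => tendsto_pi_nhds.2 fun i =>
      hl i s hs.ne_zero hs.gam_ne_zero⟩

lemma expPhase_meromorphicAt (qo : ℝ) (c : ℂ) (x t : ℝ) (j : Fin 4) {z : ℂ} (hz : z ≠ 0) :
    MeromorphicAt (fun z => Complex.exp (c * phase qo x t z j)) z :=
  ((((differentiableOn_phase qo x t j).const_mul c).cexp).analyticAt
    (isOpen_ne.mem_nhds hz)).meromorphicAt

lemma tendsto_expPhase (qo : ℝ) (c : ℂ) (x t : ℝ) {z : ℂ} (hz : z ≠ 0) :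
    Tendsto (expPhase qo c x t) (𝓝[H] z) (𝓝 (expPhase qo c x t z)) := by
  refine tendsto_matrix_of_entries fun i j => ?_
  simp only [expPhase, diagonal_apply]
  split_ifs
  · have h := ((((differentiableOn_phase qo x t i).const_mul c).cexp).continuousOn.continuousAt
      (isOpen_ne.mem_nhds hz)).tendsto
    exact h.mono_left nhdsWithin_le_nhds
  · exact tendsto_const_nhds

lemma Valid.hasExt_det (hd : d.Valid) (hH : H ⊆ regularPlane d.qo) (x t : ℝ) :
    HasExt d.qo H fun s => (d.phiPlus x t s).det := by
  have hg : HasExt d.qo H fun s => gam d.qo s := HasExt.of_differentiableOn (F := gam d.qo)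
    ((differentiableOn_gam d.qo).mono fun _ hz => hz.1) hH
  refine ((hg.mul (hasExt_exp_phase hH (2 * Complex.I) x 0 1)).mul
    (hasExt_exp_phase hH (2 * Complex.I) 0 t 1)).congr fun s h0 hs => ?_
  rw [(hd.isJost_phiPlus h0 hs).det_eq x t]
  simp [phase, mul_assoc]

/-- The minors of `A` which extend to `Im z < 0`, in terms of the complementary minors of `B`. -/
lemma Valid.minors_scatA (hd : d.Valid) {s : ℝ} (h0 : s ≠ 0) (hs : gam d.qo s ≠ 0) :
    minor (d.scatA s) ![3] ![3] = minor (d.scatB s) ![0, 1, 2] ![0, 1, 2] ∧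
    minor (d.scatA s) ![2, 3] ![2, 3] = minor (d.scatB s) ![0, 1] ![0, 1] ∧
    minor (d.scatA s) ![1, 2, 3] ![1, 2, 3] = d.scatB s 0 0 ∧
    minor (d.scatA s) ![1, 3] ![2, 3] = -minor (d.scatB s) ![0, 1] ![0, 2] := by
  have hA := hd.det_scatA h0 hs
  have hu : IsUnit (d.scatA s).det := by rw [hA]; exact isUnit_one
  have hB : (d.scatB s).det = 1 := by rw [scatB, det_nonsing_inv, hA, Ring.inverse_one]
  have hBA : (d.scatB s)⁻¹ = d.scatA s := Matrix.nonsing_inv_nonsing_inv _ hu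
  obtain ⟨j1, j2⟩ := minor_eq_minor_inv hA (Matrix.mul_nonsing_inv _ hu)
  refine ⟨?_, j1, (minor_three_eq hA).2.2, j2⟩
  rw [(minor_three_eq hB).1, hBA, minor_one]

lemma Valid.isExtension_upper_minors (hd : d.Valid) :
    IsExtension d upper (fun s => minor (d.scatA s) ![0] ![0]) (d.minorExt upper ![0] ![0]) ∧
    IsExtension d upper (fun s => minor (d.scatA s) ![0, 1] ![0, 1])
      (d.minorExt upper ![0, 1] ![0, 1]) ∧
    IsExtension d upper (fun s => minor (d.scatA s) ![0, 1, 2] ![0, 1, 2])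
      (d.minorExt upper ![0, 1, 2] ![0, 1, 2]) ∧
    IsExtension d upper (fun s => minor (d.scatA s) ![0, 2] ![0, 1])
      (d.minorExt upper ![0, 2] ![0, 1]) := by
  have hH := upper_subset_regularPlane d.qo
  have h1 := hd.extCols_phiMinus 0 0
  have h2 := hd.extCols_phiPlus_conj 0 0
  have i1 := fun s h0 hs => (hd.isJost_phiMinus (s := s) h0 hs).inv_eq hs 0 0
  have i2 := fun s h0 hs => (hd.isJost_phiPlus (s := s) h0 hs).inv_eq hs 0 0
  exact ⟨isExtension_ext (hasExt_scat_entry hH h1 h2 i2),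
    isExtension_ext (hasExt_scat_minor_two hH h1 h2 i2 (Or.inl rfl) (Or.inl rfl)),
    isExtension_ext (hasExt_scat_minor_three hH h1 h2 i1
      (fun s h0 hs => (hd.isJost_phiPlus h0 hs).isUnit_det hs 0 0)
      fun s h0 hs => hd.det_phi_eq h0 hs 0 0),
    isExtension_ext (hasExt_scat_minor_two hH h1 h2 i2 (Or.inr rfl) (Or.inl rfl))⟩

lemma Valid.isExtension_upper_columns (hd : d.Valid) (x t : ℝ) :
    IsExtension d upper (fun s => (d.phiMinus x t s).col 0) (d.phiMinus1 x t) ∧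
    IsExtension d upper (fun s => aux2 (d.phiMinus x t s) (d.scatA s)) (d.chi2Plus x t) ∧
    IsExtension d upper (fun s => aux3 (d.phiMinus x t s) (d.scatA s)) (d.chi3Plus x t) ∧
    IsExtension d upper (fun s => (d.phiPlus x t s).col 3) (d.phiPlus4 x t) := by
  have hH := upper_subset_regularPlane d.qo
  have h1 := hd.extCols_phiMinus x t
  have h2 := hd.extCols_phiPlus_conj x t
  have i1 := fun s h0 hs => (hd.isJost_phiMinus (s := s) h0 hs).inv_eq hs x t
  have i2 := fun s h0 hs => (hd.isJost_phiPlus (s := s) h0 hs).inv_eq hs x t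
  refine ⟨isExtension_ext_pi h1.col, isExtension_ext_pi fun i => ?_,
    isExtension_ext_pi fun i => ?_, isExtension_ext_pi fun i => ?_⟩
  · refine (hasExt_aux2 hH h1 h2 i2 i).congr fun s h0 hs => ?_
    rw [hd.scatA_eq h0 hs x t]
  · refine (hasExt_aux3 hH h1 h2 i1 i2
      (fun s h0 hs => (hd.isJost_phiMinus h0 hs).isUnit_det hs x t) (((hd.hasExt_det hH x t).congr
        fun s h0 hs => (hd.det_phi_eq h0 hs x t).symm)) i).congr fun s h0 hs => ?_
    rw [hd.scatA_eq h0 hs x t]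
  · refine (h2.last i).congr fun s _ _ => ?_
    simp

lemma Valid.isExtension_lower_minors (hd : d.Valid) :
    IsExtension d lower (fun s => minor (d.scatA s) ![3] ![3]) (d.minorExt lower ![3] ![3]) ∧
    IsExtension d lower (fun s => minor (d.scatA s) ![2, 3] ![2, 3])
      (d.minorExt lower ![2, 3] ![2, 3]) ∧
    IsExtension d lower (fun s => minor (d.scatA s) ![1, 2, 3] ![1, 2, 3])
      (d.minorExt lower ![1, 2, 3] ![1, 2, 3]) ∧
    IsExtension d lower (fun s => minor (d.scatA s) ![1, 3] ![2, 3])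
      (d.minorExt lower ![1, 3] ![2, 3]) := by
  have hH := lower_subset_regularPlane d.qo
  have h1 := hd.extCols_phiPlus 0 0
  have h2 := hd.extCols_phiMinus_conj 0 0
  have i1 := fun s h0 hs => (hd.isJost_phiPlus (s := s) h0 hs).inv_eq hs 0 0
  have i2 := fun s h0 hs => (hd.isJost_phiMinus (s := s) h0 hs).inv_eq hs 0 0
  refine ⟨isExtension_ext ?_, isExtension_ext ?_, isExtension_ext ?_, isExtension_ext ?_⟩
  · refine (hasExt_scat_minor_three hH h1 h2 i1
      (fun s h0 hs => (hd.isJost_phiMinus h0 hs).isUnit_det hs 0 0)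
      fun s h0 hs => (hd.det_phi_eq h0 hs 0 0).symm).congr fun s h0 hs => ?_
    rw [← hd.scatB_eq h0 hs 0 0, (hd.minors_scatA h0 hs).1]
  · refine (hasExt_scat_minor_two hH h1 h2 i2 (Or.inl rfl) (Or.inl rfl)).congr fun s h0 hs => ?_
    rw [← hd.scatB_eq h0 hs 0 0, (hd.minors_scatA h0 hs).2.1]
  · refine (hasExt_scat_entry hH h1 h2 i2).congr fun s h0 hs => ?_
    rw [← hd.scatB_eq h0 hs 0 0, (hd.minors_scatA h0 hs).2.2.1, minor_one]
  · refine (hasExt_scat_minor_two hH h1 h2 i2 (Or.inl rfl) (Or.inr rfl)).neg.congr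
      fun s h0 hs => ?_
    rw [← hd.scatB_eq h0 hs 0 0, (hd.minors_scatA h0 hs).2.2.2]

lemma Valid.isExtension_lower_columns (hd : d.Valid) (x t : ℝ) :
    IsExtension d lower (fun s => (d.phiPlus x t s).col 0) (d.phiPlus1 x t) ∧
    IsExtension d lower (fun s => aux2 (d.phiPlus x t s) (d.scatB s)) (d.chi2Minus x t) ∧
    IsExtension d lower (fun s => aux3 (d.phiPlus x t s) (d.scatB s)) (d.chi3Minus x t) ∧
    IsExtension d lower (fun s => (d.phiMinus x t s).col 3) (d.phiMinus4 x t) := by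
  have hH := lower_subset_regularPlane d.qo
  have h1 := hd.extCols_phiPlus x t
  have h2 := hd.extCols_phiMinus_conj x t
  have i1 := fun s h0 hs => (hd.isJost_phiPlus (s := s) h0 hs).inv_eq hs x t
  have i2 := fun s h0 hs => (hd.isJost_phiMinus (s := s) h0 hs).inv_eq hs x t
  refine ⟨isExtension_ext_pi h1.col, isExtension_ext_pi fun i => ?_,
    isExtension_ext_pi fun i => ?_, isExtension_ext_pi fun i => ?_⟩
  · refine (hasExt_aux2 hH h1 h2 i2 i).congr fun s h0 hs => ?_
    rw [hd.scatB_eq h0 hs x t]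
  · refine (hasExt_aux3 hH h1 h2 i1 i2
      (fun s h0 hs => (hd.isJost_phiPlus h0 hs).isUnit_det hs x t) (hd.hasExt_det hH x t) i).congr
      fun s h0 hs => ?_
    rw [hd.scatB_eq h0 hs x t]
  · refine (h2.last i).congr fun s _ _ => ?_
    simp

lemma meromorphicAt_combination {A B C : ℂ → ℂ} {v w : ℂ → Fin 4 → ℂ} {z : ℂ} {i : Fin 4}
    (hA : MeromorphicAt A z) (hB : MeromorphicAt B z) (hC : MeromorphicAt C z)
    (hv : MeromorphicAt (fun z => v z i) z) (hw : MeromorphicAt (fun z => w z i) z) :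
    MeromorphicAt (fun z => ((A z)⁻¹ • (v z - (B z / C z) • w z)) i) z :=
  hA.inv.mul (hv.sub ((hB.div hC).mul hw))

lemma Valid.meromorphicAt_MPlus (hd : d.Valid) (x t : ℝ) (i j : Fin 4) {z : ℂ} (hz : z ∈ upper) :
    MeromorphicAt (fun z => d.MPlus x t z i j) z := by
  obtain ⟨m1, m12, m123, m13⟩ := hd.isExtension_upper_minors
  obtain ⟨c1, c2, c3, c4⟩ := hd.isExtension_upper_columns x t
  have k1 := m1.meromorphicAt isOpen_upper hz
  have k12 := m12.meromorphicAt isOpen_upper hz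
  have k123 := m123.meromorphicAt isOpen_upper hz
  have k13 := m13.meromorphicAt isOpen_upper hz
  have hc : MeromorphicAt (fun z => (![(d.minorExt upper ![0] ![0] z)⁻¹ • d.phiMinus1 x t z,
      (d.minorExt upper ![0, 1] ![0, 1] z)⁻¹ • (d.chi2Plus x t z -
        (d.minorExt upper ![0, 2] ![0, 1] z / d.minorExt upper ![0, 1, 2] ![0, 1, 2] z) •
          d.chi3Plus x t z),
      (d.minorExt upper ![0, 1, 2] ![0, 1, 2] z)⁻¹ • d.chi3Plus x t z,
      d.phiPlus4 x t z] : Fin 4 → Fin 4 → ℂ) j i) z := by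
    fin_cases j
    · exact k1.inv.mul (c1.meromorphicAt_apply isOpen_upper hz i)
    · exact meromorphicAt_combination k12 k13 k123 (c2.meromorphicAt_apply isOpen_upper hz i)
        (c3.meromorphicAt_apply isOpen_upper hz i)
    · exact k123.inv.mul (c3.meromorphicAt_apply isOpen_upper hz i)
    · exact c4.meromorphicAt_apply isOpen_upper hz i
  refine (hc.mul (expPhase_meromorphicAt d.qo (-Complex.I) x t j
    (ne_zero_of_im (ne_of_gt hz)))).congr (Eventually.of_forall fun w => ?_)
  simp only [MPlus, expPhase, mul_diagonal, transpose_apply, of_apply, Pi.mul_apply]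

lemma Valid.meromorphicAt_MMinus (hd : d.Valid) (x t : ℝ) (i j : Fin 4) {z : ℂ} (hz : z ∈ lower) :
    MeromorphicAt (fun z => d.MMinus x t z i j) z := by
  obtain ⟨m4, m34, m234, m24⟩ := hd.isExtension_lower_minors
  obtain ⟨c1, c2, c3, c4⟩ := hd.isExtension_lower_columns x t
  have k4 := m4.meromorphicAt isOpen_lower hz
  have k34 := m34.meromorphicAt isOpen_lower hz
  have k234 := m234.meromorphicAt isOpen_lower hz
  have k24 := m24.meromorphicAt isOpen_lower hz
  have hc : MeromorphicAt (fun z => (![d.phiPlus1 x t z,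
      (d.minorExt lower ![1, 2, 3] ![1, 2, 3] z)⁻¹ • d.chi2Minus x t z,
      (d.minorExt lower ![2, 3] ![2, 3] z)⁻¹ • (d.chi3Minus x t z -
        (d.minorExt lower ![1, 3] ![2, 3] z / d.minorExt lower ![1, 2, 3] ![1, 2, 3] z) •
          d.chi2Minus x t z),
      (d.minorExt lower ![3] ![3] z)⁻¹ • d.phiMinus4 x t z] : Fin 4 → Fin 4 → ℂ) j i) z := by
    fin_cases j
    · exact c1.meromorphicAt_apply isOpen_lower hz i
    · exact k234.inv.mul (c2.meromorphicAt_apply isOpen_lower hz i)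
    · exact meromorphicAt_combination k34 k24 k234 (c3.meromorphicAt_apply isOpen_lower hz i)
        (c2.meromorphicAt_apply isOpen_lower hz i)
    · exact k4.inv.mul (c4.meromorphicAt_apply isOpen_lower hz i)
  refine (hc.mul (expPhase_meromorphicAt d.qo (-Complex.I) x t j
    (ne_zero_of_im (ne_of_lt hz)))).congr (Eventually.of_forall fun w => ?_)
  simp only [MMinus, expPhase, mul_diagonal, transpose_apply, of_apply, Pi.mul_apply]

lemma M_eqOn_upper (x t : ℝ) : Set.EqOn (d.M x t) (d.MPlus x t) upper := fun _ hz => if_pos hz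

lemma M_eqOn_lower (x t : ℝ) : Set.EqOn (d.M x t) (d.MMinus x t) lower := fun _ hz =>
  if_neg (not_lt.2 (le_of_lt hz))

/-- Off the real axis `M` is a rational expression in analytic functions. A denominator which vanishes
identically does no harm, since the junk value of its inverse is zero. -/
theorem Valid.meromorphicOn_M (hd : d.Valid) (x t : ℝ) (i j : Fin 4) :
    MeromorphicOn (fun z => d.M x t z i j) {z : ℂ | z.im ≠ 0} := by
  intro z hz
  rcases lt_or_gt_of_ne hz with h | h
  · refine (hd.meromorphicAt_MMinus x t i j h).congr
      (eventually_nhdsWithin_of_eventually_nhds ?_)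
    filter_upwards [isOpen_lower.mem_nhds h] with w hw
    rw [M_eqOn_lower x t hw]
  · refine (hd.meromorphicAt_MPlus x t i j h).congr
      (eventually_nhdsWithin_of_eventually_nhds ?_)
    filter_upwards [isOpen_upper.mem_nhds h] with w hw
    rw [M_eqOn_upper x t hw]

lemma tendsto_of_columns {α : Type*} {l : Filter α} {F₀ F₁ F₂ F₃ : α → Fin 4 → ℂ}
    {v₀ v₁ v₂ v₃ : Fin 4 → ℂ} (h₀ : Tendsto F₀ l (𝓝 v₀)) (h₁ : Tendsto F₁ l (𝓝 v₁))
    (h₂ : Tendsto F₂ l (𝓝 v₂)) (h₃ : Tendsto F₃ l (𝓝 v₃)) :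
    Tendsto (fun z => ((of ![F₀ z, F₁ z, F₂ z, F₃ z])ᵀ : Mat)) l (𝓝 (of ![v₀, v₁, v₂, v₃])ᵀ) := by
  refine tendsto_matrix_of_entries fun i j => ?_
  fin_cases j
  · exact tendsto_pi_nhds.1 h₀ i
  · exact tendsto_pi_nhds.1 h₁ i
  · exact tendsto_pi_nhds.1 h₂ i
  · exact tendsto_pi_nhds.1 h₃ i

variable {s : ℝ}

/-- The limit is obtained from continuity up to the boundary, as the denominators do not vanish at `s`. -/
theorem Valid.tendsto_M_upper (hd : d.Valid) (h : d.Regular s) (hn : d.NonSingular s) (x t : ℝ) :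
    Tendsto (d.M x t) (𝓝[upper] (s : ℂ)) (𝓝 (d.phiPlus x t s *
      jumpU (d.scatA s 1 0 / d.scatA s 0 0) (d.scatA s 2 0 / d.scatA s 0 0)
        (d.scatA s 3 0 / d.scatA s 0 0)
        (minor (d.scatA s) ![0, 3] ![0, 1] / minor (d.scatA s) ![0, 1] ![0, 1] -
          minor (d.scatA s) ![0, 1, 3] ![0, 1, 2] / minor (d.scatA s) ![0, 1, 2] ![0, 1, 2] *
            (minor (d.scatA s) ![0, 2] ![0, 1] / minor (d.scatA s) ![0, 1] ![0, 1]))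
        (minor (d.scatA s) ![0, 1, 3] ![0, 1, 2] / minor (d.scatA s) ![0, 1, 2] ![0, 1, 2]) *
      expPhase d.qo (-Complex.I) x t s)) := by
  have hs : (s : ℂ) ≠ 0 := Complex.ofReal_ne_zero.2 h.1
  obtain ⟨m1, m12, m123, m13⟩ := hd.isExtension_upper_minors
  obtain ⟨c1, c2, c3, c4⟩ := hd.isExtension_upper_columns x t
  obtain ⟨n1, n12, n123⟩ := hn
  have k1 := m1.2 s h
  simp only [minor_one] at k1 n1
  have k12 := m12.2 s h
  have k123 := m123.2 s h
  have k13 := m13.2 s h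
  have hlim := (tendsto_of_columns ((k1.inv₀ n1).smul (c1.2 s h))
    ((k12.inv₀ n12).smul ((c2.2 s h).sub ((k13.div k123 n123).smul (c3.2 s h))))
    ((k123.inv₀ n123).smul (c3.2 s h)) (c4.2 s h)).mul
    (tendsto_expPhase d.qo (-Complex.I) x t hs)
  rw [← plus_columns _ n1 n12 n123, ← hd.phiMinus_eq h.1 h.gam_ne_zero x t]
  exact hlim.congr' (eventually_nhdsWithin_of_forall fun z hz => (M_eqOn_upper x t hz).symm)

/-- The extended minors of `A` are traded for those of `B` at the boundary point, where the two
agree. -/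
theorem Valid.tendsto_M_lower (hd : d.Valid) (h : d.Regular s) (hn : d.NonSingular s) (x t : ℝ) :
    Tendsto (d.M x t) (𝓝[lower] (s : ℂ)) (𝓝 (d.phiPlus x t s *
      jumpV (-(d.scatB s 0 1 / d.scatB s 0 0))
        (minor (d.scatB s) ![0, 1] ![1, 2] / minor (d.scatB s) ![0, 1] ![0, 1] -
          d.scatB s 0 1 / d.scatB s 0 0 *
            (minor (d.scatB s) ![0, 1] ![0, 2] / minor (d.scatB s) ![0, 1] ![0, 1]))
        (d.scatA s 0 3 / d.scatA s 3 3) (d.scatA s 1 3 / d.scatA s 3 3)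
        (d.scatA s 2 3 / d.scatA s 3 3) *
      expPhase d.qo (-Complex.I) x t s)) := by
  have hs : (s : ℂ) ≠ 0 := Complex.ofReal_ne_zero.2 h.1
  obtain ⟨m4, m34, m234, m24⟩ := hd.isExtension_lower_minors
  obtain ⟨c1, c2, c3, c4⟩ := hd.isExtension_lower_columns x t
  obtain ⟨-, n1, n12, n4⟩ := hd.denominators h hn
  obtain ⟨-, e34, e234, e24⟩ := hd.minors_scatA h.1 h.gam_ne_zero
  have k4 := m4.2 s h
  have k34 := m34.2 s h
  have k234 := m234.2 s h
  have k24 := m24.2 s h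
  simp only [minor_one] at k4
  simp only [e34] at k34
  simp only [e234] at k234
  simp only [e24] at k24
  have hlim := (tendsto_of_columns (c1.2 s h) ((k234.inv₀ n1).smul (c2.2 s h))
    ((k34.inv₀ n12).smul ((c3.2 s h).sub ((k24.div k234 n1).smul (c2.2 s h))))
    ((k4.inv₀ n4).smul (c4.2 s h))).mul (tendsto_expPhase d.qo (-Complex.I) x t hs)
  rw [← minus_columns _ n1 n12 n4, ← hd.phiMinus_eq h.1 h.gam_ne_zero x t]
  exact hlim.congr' (eventually_nhdsWithin_of_forall fun z hz => (M_eqOn_lower x t hz).symm)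

end Data

end VNLS

end

theorem lemmaL (d : VNLS.Data) (hd : d.Valid) :
    -- `M` is sectionally meromorphic
    (∀ (x t : ℝ) (i j : Fin 4), MeromorphicOn (fun z => d.M x t z i j) {z : ℂ | z.im ≠ 0}) ∧
    -- `M` has boundary values from both sides, which satisfy the jump condition
    (∀ s : ℝ, d.Regular s → d.NonSingular s → ∀ x t : ℝ,
      ∃ Mp Mm : VNLS.Mat,
        Tendsto (d.M x t) (𝓝[VNLS.upper] (s : ℂ)) (𝓝 Mp) ∧
        Tendsto (d.M x t) (𝓝[VNLS.lower] (s : ℂ)) (𝓝 Mm) ∧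
        Mp = Mm * (1 - VNLS.expPhase d.qo Complex.I x t s * d.L s *
          VNLS.expPhase d.qo (-Complex.I) x t s)) ∧
    -- `L` vanishes identically in the reflectionless case
    ((∀ s : ℝ, d.Regular s → d.rho1 s = 0 ∧ d.rho2 s = 0 ∧ d.rho3 s = 0) →
      ∀ s : ℝ, d.Regular s → d.NonSingular s → d.L s = 0) := by
  refine ⟨fun x t i j => hd.meromorphicOn_M x t i j, fun s hs hn x t => ?_, fun hr s hs hn =>
    hd.L_eq_zero hs hn (hr s hs) (hr _ (hs.regular_hat hd))⟩
  refine ⟨_, _, hd.tendsto_M_upper hs hn x t, hd.tendsto_M_lower hs hn x t, ?_⟩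
  rw [hd.jump_factors hs hn]
  simp only [Matrix.mul_assoc, mul_sub, sub_mul, Matrix.mul_one]
  rw [← Matrix.mul_assoc (VNLS.expPhase d.qo (-Complex.I) x t s), VNLS.expPhase_neg_mul,
    Matrix.one_mul]
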